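/- Let $q_0>0$, $q_\pm\in\mathbb C$ with $|q_\pm|=q_0$, fix a time $t$, and let $q(\cdot,t)$ be a continuous function with $q(\cdot,t)-q_\pm\in L^1(\mathbb R^\pm)$ (for instance the potential with nonzero boundary values $q_\pm$ obtained from a solution of the focusing Kundu–Eckhaus equation). Write $*$ for complex conjugation and put, for $z\neq0$, $$k=\tfrac12\Big(z-\frac{q_0^2}{z}\Big),\quad \lambda=\tfrac12\Big(z+\frac{q_0^2}{z}\Big),\quad \theta=\lambda(x+kt),\quad \gamma=1+\frac{q_0^2}{z^2},$$ $$X=\begin{pmatrix}-ik&q\\-q^*&ik\end{pmatrix},\qquad Y_\pm=\begin{pmatrix}1&-iq_\pm/z\\-iq_\pm^*/z&1\end{pmatrix},\qquad D^\pm=\{z:\pm(|z|^2-q_0^2)\operatorname{Im}z>0\},$$ $\Sigma=\mathbb R\cup\{|z|=q_0\}$, oriented so that $D^+$ lies on its left, and $\Sigma_0=\Sigma\setminus\{0,\pm iq_0\}$. Let $\psi_\pm$ be the Jost functions: $\partial_x\psi_\pm=X\psi_\pm$, $\psi_\pm e^{i\theta\sigma_3}\to Y_\pm$ as $x\to\pm\infty$,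 with columns $\psi_{\pm,1},\psi_{\pm,2}$ (defined for $z\in\Sigma_0$; moreover $\psi_{+,1},\psi_{-,2}$ for $z\in D^-$, and $\psi_{-,1},\psi_{+,2}$ for $z\in D^+$). Let $$s_{11}=\frac{\det(\psi_{+,1},\psi_{-,2})}{\gamma},\qquad s_{22}=\frac{\det(\psi_{-,1},\psi_{+,2})}{\gamma},\qquad s_{21}=\frac{\det(\psi_{-,1},\psi_{+,1})}{\gamma},\qquad \rho=\frac{s_{21}}{s_{11}},$$ with $s_{11}$ considered on $D^-\cup\Sigma_0$, $s_{22}$ on $D^+\cup\Sigma_0$, and $s_{21},\rho$ on $\Sigma_0$; on $\Sigma_0$ these are entries of the matrix $S$ with $\psi_+=\psi_-S$. Assume: * the zeros of $s_{11}$ in $D^-\cap\{\operatorname{Im}z<0\}$ are exactly the distinct points $z_1,\dots,z_N$ ($N\ge0$), and they are simple; * $s_{11}\ne0$ on $\Sigma_0$, and for each of the two branch points $p=\pm iq_0$ there is an integer $m$ such that $(z-p)^ms_{11}(z)$ has a finite nonzero limit as $z\to p$ in $D^-$. Then $1+\rho(\zeta)\rho^*(\zeta^*)$ has a continuous logarithm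 on $\Sigma_0$ that is real on $\mathbb R\setminus\{0\}$. Denote it by $\log[1+\rho(\zeta)\rho^*(\zeta^*)]$. All of the integrals below exist, where $\int_\Sigma$ is the limit, as $\varepsilon\to0^+$ and $R\to\infty$, of the integrals over $\{\zeta\in\Sigma:\varepsilon<|\zeta|<R\}$. Trace formulae: for $z\in D^-$, $$s_{11}(z)=\exp\Big(\frac1{2\pi i}\int_\Sigma\frac{\log[1+\rho(\zeta)\rho^*(\zeta^*)]}{\zeta-z}\,d\zeta\Big)\prod_{n=1}^N\frac{(z-z_n)(z+q_0^2/z_n^*)}{(z-z_n^*)(z+q_0^2/z_n)},$$ and for $z\in D^+$, $$s_{22}(z)=\exp\Big(-\frac1{2\pi i}\int_\Sigma\frac{\log[1+\rho(\zeta)\rho^*(\zeta^*)]}{\zeta-z}\,d\zeta\Big)\prod_{n=1}^N\frac{(z-z_n^*)(z+q_0^2/z_n)}{(z-z_n)(z+q_0^2/z_n^*)}.$$ Theta condition: $\int_\Sigma\log[1+\rho(\zeta)\rho^*(\zeta^*)]\,\zeta^{-1}d\zeta$ is real and $$\arg\frac{q_-}{q_+}\equiv-\frac1{2\pi}\int_\Sigma\frac{\log[1+\rho(\zeta)\rho^*(\zeta^*)]}{\zeta}\,d\zeta+4\sum_{n=1}^N\arg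 z_n\pmod{2\pi}.$$ In the reflectionless case ($\rho=0$ on $\Sigma_0$), $\arg(q_- /q_+)\equiv4\sum_{n=1}^N\arg z_n\pmod{2\pi}$. -/

import Mathlib

open Filter Topology MeasureTheory
open scoped ComplexConjugate

noncomputable section

namespace KunduEckhaus

/-! ### Uniformization variable -/

/-- The spectral parameter `k(z) = (z - q₀²/z)/2`. -/
def specK (q₀ : ℝ) (z : ℂ) : ℂ := (z - (q₀ : ℂ) ^ 2 / z) / 2

/-- The function `λ(z) = (z + q₀²/z)/2`, so that `λ² = k² + q₀²` and `z = k + λ`. -/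
def specLam (q₀ : ℝ) (z : ℂ) : ℂ := (z + (q₀ : ℂ) ^ 2 / z) / 2

/-- `θ(x,t;z) = λ(z) (x + k(z) t)`. -/
def phase (q₀ : ℝ) (x t : ℝ) (z : ℂ) : ℂ := specLam q₀ z * ((x : ℂ) + specK q₀ z * (t : ℂ))

/-- `γ(z) = 1 + q₀²/z² = det Y_±(z)`. -/
def gam (q₀ : ℝ) (z : ℂ) : ℂ := 1 + (q₀ : ℂ) ^ 2 / z ^ 2

/-- `D⁺`, the set where `Im λ > 0`. -/
def Dplus (q₀ : ℝ) : Set ℂ := {z | 0 < (‖z‖ ^ 2 - q₀ ^ 2) * z.im}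

/-- `D⁻`, the set where `Im λ < 0`. -/
def Dminus (q₀ : ℝ) : Set ℂ := {z | (‖z‖ ^ 2 - q₀ ^ 2) * z.im < 0}

/-- The continuous spectrum `Σ`, the real line together with the circle of radius `q₀`, without
the branch points `± i q₀` and without the point `0`, where `k` and `λ` are infinite. -/
def Sigma0 (q₀ : ℝ) : Set ℂ :=
  {z | (z.im = 0 ∨ ‖z‖ = q₀) ∧ z ≠ 0 ∧ z ≠ Complex.I * (q₀ : ℂ) ∧ z ≠ -(Complex.I * (q₀ : ℂ))}

/-! ### Lax operator and Jost functions -/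

/-- `X = -i k σ₃ + Q` for the value `q` of the potential. -/
def laxX (k q : ℂ) : Matrix (Fin 2) (Fin 2) ℂ :=
  !![-(Complex.I * k), q; -conj q, Complex.I * k]

/-- `Y_±(z) = I - (i/z) σ₃ Q_±` for the boundary value `qb = q_±`. -/
def eigY (qb z : ℂ) : Matrix (Fin 2) (Fin 2) ℂ :=
  !![1, -(Complex.I * qb / z); -(Complex.I * conj qb / z), 1]

/-- The diagonal entries of `σ₃`. -/
def sgn3 (j : Fin 2) : ℂ := if j = 0 then 1 else -1

/-- `ψ` is the `j`-th column of the Jost function at the end `l` of the line (`atTop` for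
`x → +∞`, `atBot` for `x → -∞`): it solves `ψ_x = X ψ`, and the `j`-th column
`u = ψ e^{iθ (σ₃)_{jj}}` tends to the `j`-th column of `Y(z)` at that end. -/
structure IsJost (q₀ : ℝ) (qb : ℂ) (q : ℝ → ℝ → ℂ) (t : ℝ) (l : Filter ℝ) (j : Fin 2) (z : ℂ)
    (ψ : ℝ → Fin 2 → ℂ) : Prop where
  ode : ∀ x : ℝ, HasDerivAt ψ ((laxX (specK q₀ z) (q x t)).mulVec (ψ x)) x
  lim : Tendsto (fun x : ℝ => Complex.exp (Complex.I * phase q₀ x t z * sgn3 j) • ψ x) l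
    (𝓝 fun i => eigY qb z i j)

/-- The `j`-th column of the Jost function. It is used only where it exists and is unique:
at `+∞` the first column for `z ∈ D⁻ ∪ Σ₀` and the second for `z ∈ D⁺ ∪ Σ₀`, at `-∞` the first
column for `z ∈ D⁺ ∪ Σ₀` and the second for `z ∈ D⁻ ∪ Σ₀`. -/
def jost (q₀ : ℝ) (qb : ℂ) (q : ℝ → ℝ → ℂ) (t : ℝ) (l : Filter ℝ) (j : Fin 2) (z : ℂ) :
    ℝ → Fin 2 → ℂ :=
  Classical.epsilon (IsJost q₀ qb q t l j z)

/-- `ψ_{+,j}(x,t;z)`. -/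
def psiP (q₀ : ℝ) (qp : ℂ) (q : ℝ → ℝ → ℂ) (t : ℝ) (j : Fin 2) (z : ℂ) : ℝ → Fin 2 → ℂ :=
  jost q₀ qp q t atTop j z

/-- `ψ_{-,j}(x,t;z)`. -/
def psiM (q₀ : ℝ) (qm : ℂ) (q : ℝ → ℝ → ℂ) (t : ℝ) (j : Fin 2) (z : ℂ) : ℝ → Fin 2 → ℂ :=
  jost q₀ qm q t atBot j z

/-! ### Scattering coefficients -/

/-- The Wronskian determinant of two columns. -/
def wr (a b : Fin 2 → ℂ) : ℂ := a 0 * b 1 - a 1 * b 0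

/-- Cramer's rule: the quotients of Wronskians below are the entries of the matrix `S` with
`ψ₊ = ψ₋ S`. -/
theorem cramer (a₁ a₂ b : Fin 2 → ℂ) (h : wr a₁ a₂ ≠ 0) :
    b = (wr b a₂ / wr a₁ a₂) • a₁ + (wr a₁ b / wr a₁ a₂) • a₂ := by
  funext i
  simp only [Pi.add_apply, Pi.smul_apply, smul_eq_mul]
  field_simp
  fin_cases i <;> simp [wr] <;> ring

/-- `s₁₁ = Wr(ψ_{+,1}, ψ_{-,2})/γ`, on `D⁻ ∪ Σ₀`. The Wronskian does not depend on `x`, because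
the trace of `X` is zero; it is taken at `x = 0`. -/
def s11 (q₀ : ℝ) (qm qp : ℂ) (q : ℝ → ℝ → ℂ) (t : ℝ) (z : ℂ) : ℂ :=
  wr (psiP q₀ qp q t 0 z 0) (psiM q₀ qm q t 1 z 0) / gam q₀ z

/-- `s₂₂ = Wr(ψ_{-,1}, ψ_{+,2})/γ`, on `D⁺ ∪ Σ₀`. -/
def s22 (q₀ : ℝ) (qm qp : ℂ) (q : ℝ → ℝ → ℂ) (t : ℝ) (z : ℂ) : ℂ :=
  wr (psiM q₀ qm q t 0 z 0) (psiP q₀ qp q t 1 z 0) / gam q₀ z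

/-- `s₂₁ = Wr(ψ_{-,1}, ψ_{+,1})/γ`, on `Σ₀`. -/
def s21 (q₀ : ℝ) (qm qp : ℂ) (q : ℝ → ℝ → ℂ) (t : ℝ) (z : ℂ) : ℂ :=
  wr (psiM q₀ qm q t 0 z 0) (psiP q₀ qp q t 0 z 0) / gam q₀ z

/-- The reflection coefficient `ρ = s₂₁/s₁₁`, on `Σ₀`. -/
def rho (q₀ : ℝ) (qm qp : ℂ) (q : ℝ → ℝ → ℂ) (t : ℝ) (z : ℂ) : ℂ :=
  s21 q₀ qm qp q t z / s11 q₀ qm qp q t z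

/-- `L` is the branch of `log[1 + ρ(ζ) ρ^*(ζ^*)]` on `Σ₀` that is continuous on `Σ₀` and real
on the real line, where `1 + ρ(ζ) ρ^*(ζ^*) = 1 + |ρ(ζ)|²`. (On the circle the argument of the
logarithm is a complex number.) -/
structure IsLogBranch (q₀ : ℝ) (qm qp : ℂ) (q : ℝ → ℝ → ℂ) (t : ℝ) (L : ℂ → ℂ) : Prop where
  cont : ContinuousOn L (Sigma0 q₀)
  exp_eq : ∀ ζ ∈ Sigma0 q₀, Complex.exp (L ζ) =
    1 + rho q₀ qm qp q t ζ * conj (rho q₀ qm qp q t (conj ζ))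
  real : ∀ x : ℝ, x ≠ 0 → (L (x : ℂ)).im = 0

/-! ### Integrals over the oriented contour -/

/-- The integral over the part `ε < |ζ| < R` of `Σ`, oriented so that `D⁺` lies on its left: the
real line to the right for `|ζ| > q₀` and to the left for `|ζ| < q₀`, the upper half circle
clockwise and the lower half circle counterclockwise. -/
def sigmaTrunc (q₀ : ℝ) (f : ℂ → ℂ) (ε R : ℝ) : ℂ :=
  (∫ x in (-R)..(-q₀), f (x : ℂ)) + (∫ x in q₀..R, f (x : ℂ))
    - (∫ x in (-q₀)..(-ε), f (x : ℂ)) - (∫ x in ε..q₀, f (x : ℂ))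
    - (∫ φ in (0 : ℝ)..Real.pi, f (circleMap 0 q₀ φ) * deriv (circleMap 0 q₀) φ)
    + (∫ φ in (-Real.pi)..(0 : ℝ), f (circleMap 0 q₀ φ) * deriv (circleMap 0 q₀) φ)

/-- `∫_Σ f(ζ) dζ = v`: `f` is integrable over bounded parts of `Σ` away from `0`, and the
integrals over `ε < |ζ| < R` tend to `v` as `ε → 0⁺`, `R → ∞` (which is the ordinary integral
if `f` is absolutely integrable over `Σ`). -/
structure HasSigmaIntegral (q₀ : ℝ) (f : ℂ → ℂ) (v : ℂ) : Prop where
  line_pos : ∀ ε R : ℝ, 0 < ε → ε ≤ R →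
    IntervalIntegrable (fun x : ℝ => f (x : ℂ)) volume ε R
  line_neg : ∀ ε R : ℝ, 0 < ε → ε ≤ R →
    IntervalIntegrable (fun x : ℝ => f (x : ℂ)) volume (-R) (-ε)
  circle : IntervalIntegrable (fun φ : ℝ => f (circleMap 0 q₀ φ)) volume (-Real.pi) Real.pi
  lim : Tendsto (fun p : ℝ × ℝ => sigmaTrunc q₀ f p.1 p.2) (𝓝[>] (0 : ℝ) ×ˢ atTop) (𝓝 v)

/-- `∏ₙ (w - zₙ)(w + q₀²/zₙ^*) / ((w - zₙ^*)(w + q₀²/zₙ))`. -/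
def blaschke (q₀ : ℝ) {N : ℕ} (z : Fin N → ℂ) (w : ℂ) : ℂ :=
  ∏ n, ((w - z n) * (w + (q₀ : ℂ) ^ 2 / conj (z n))) /
    ((w - conj (z n)) * (w + (q₀ : ℂ) ^ 2 / z n))

end KunduEckhaus

end

open KunduEckhaus

noncomputable section

namespace KunduEckhaus

open Set

/-! ### Volterra equations on a half line -/

theorem hasDerivAt_integral_Ioi {E : Type*} [NormedAddCommGroup E] [NormedSpace ℝ E]
    [CompleteSpace E] {g : ℝ → E} (hg : Continuous g) (hi : ∀ x, IntegrableOn g (Ioi x)) (x : ℝ) :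
    HasDerivAt (fun x => ∫ y in Ioi x, g y) (-g x) x := by
  have h1 : (fun x => ∫ y in Ioi x, g y) = fun x => (∫ y in Ioi (0 : ℝ), g y) - ∫ y in (0 : ℝ)..x, g y := by
    funext x
    rw [← intervalIntegral.integral_Ioi_sub_Ioi' (hi 0) (hi x)]
    simp
  rw [h1]
  exact (intervalIntegral.integral_hasDerivAt_right (hg.intervalIntegrable _ _)
    (hg.stronglyMeasurableAtFilter _ _) hg.continuousAt).const_sub _

/-- The solution vanishing at `+∞` of `f' = μ f - g`. -/
def expTail (μ : ℂ) (g : ℝ → ℂ) (x : ℝ) : ℂ := ∫ y in Ioi x, Complex.exp (μ * (x - y)) * g y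

theorem norm_exp_mul_sub_le {μ : ℂ} (hμ : 0 ≤ μ.re) {x y : ℝ} (h : x ≤ y) :
    ‖Complex.exp (μ * (x - y))‖ ≤ 1 := by
  rw [Complex.norm_exp, Real.exp_le_one_iff]
  have : (μ * ((x : ℂ) - y)).re = μ.re * (x - y) := by
    rw [← Complex.ofReal_sub, Complex.re_mul_ofReal]
  rw [this]
  exact mul_nonpos_of_nonneg_of_nonpos hμ (by linarith)

theorem integrableOn_exp_mul {μ : ℂ} (hμ : 0 ≤ μ.re) {g : ℝ → ℂ} {x : ℝ}
    (hi : IntegrableOn g (Ioi x)) :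
    IntegrableOn (fun y : ℝ => Complex.exp (μ * (x - y)) * g y) (Ioi x) := by
  refine Integrable.bdd_mul (c := 1) hi (by fun_prop : Continuous _).aestronglyMeasurable ?_
  filter_upwards [ae_restrict_mem measurableSet_Ioi] with y hy
  exact norm_exp_mul_sub_le hμ (le_of_lt hy)

theorem norm_expTail_le {μ : ℂ} (hμ : 0 ≤ μ.re) {g : ℝ → ℂ} {x : ℝ} {h : ℝ → ℝ}
    (hi : IntegrableOn h (Ioi x)) (hgh : ∀ y, x < y → ‖g y‖ ≤ h y) :
    ‖expTail μ g x‖ ≤ ∫ y in Ioi x, h y := by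
  refine norm_integral_le_of_norm_le hi ?_
  filter_upwards [ae_restrict_mem measurableSet_Ioi] with y hy
  rw [norm_mul]
  calc _ ≤ 1 * ‖g y‖ := by gcongr; exact norm_exp_mul_sub_le hμ (le_of_lt hy)
    _ ≤ h y := by rw [one_mul]; exact hgh y hy

theorem hasDerivAt_expTail {μ : ℂ} (hμ : 0 ≤ μ.re) {g : ℝ → ℂ} (hg : Continuous g)
    (hi : ∀ x, IntegrableOn g (Ioi x)) (x : ℝ) :
    HasDerivAt (expTail μ g) (μ * expTail μ g x - g x) x := by
  have key : ∀ x : ℝ, expTail μ g x = Complex.exp (μ * x) * ∫ y in Ioi x, Complex.exp (-(μ * y)) * g y := by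
    intro x
    rw [expTail, ← integral_const_mul]
    congr 1
    funext y
    rw [← mul_assoc, ← Complex.exp_add]
    ring_nf
  -- On `(x, ∞)` the factor `exp (-μ y)` is a constant multiple of the kernel `exp (μ (x - y))`,
  -- which has modulus at most `1`.
  have hi' : ∀ x, IntegrableOn (fun y : ℝ => Complex.exp (-(μ * y)) * g y) (Ioi x) := by
    intro x
    have h := (integrableOn_exp_mul hμ (hi x)).const_mul (Complex.exp (-(μ * x)))
    refine h.congr (ae_of_all _ fun y => ?_)
    simp only
    rw [← mul_assoc, ← Complex.exp_add]
    ring_nf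
  have h1 : HasDerivAt (fun x : ℝ => Complex.exp (μ * x)) (Complex.exp (μ * x) * μ) x := by
    have : HasDerivAt (fun x : ℝ => μ * (x : ℂ)) μ x := by
      simpa using (hasDerivAt_id x).ofReal_comp.const_mul μ
    exact this.cexp
  have h2 := h1.mul (hasDerivAt_integral_Ioi (by fun_prop) hi' x)
  have h3 : expTail μ g = fun x : ℝ =>
      Complex.exp (μ * x) * ∫ y in Ioi x, Complex.exp (-(μ * y)) * g y := funext key
  rw [key x]
  rw [h3]
  refine h2.congr_deriv ?_
  have : Complex.exp (μ * x) * Complex.exp (-(μ * x)) = 1 := by rw [← Complex.exp_add]; simp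
  linear_combination (-(g x)) * this

/-- The source term of the Volterra equation with coefficients `a_{jk} d + b_{jk} d^*`. -/
def src (d : ℝ → ℂ) (a b : Fin 2 → Fin 2 → ℂ) (φ : ℝ → Fin 2 → ℂ) (j : Fin 2) (y : ℝ) : ℂ :=
  ∑ k, (a j k * d y + b j k * conj (d y)) * φ y k

/-- The Volterra operator. -/
def voltStep (d : ℝ → ℂ) (a b : Fin 2 → Fin 2 → ℂ) (μ : Fin 2 → ℂ) (φ : ℝ → Fin 2 → ℂ) (x : ℝ)
    (j : Fin 2) : ℂ := -expTail (μ j) (src d a b φ j) x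

/-- The terms of the Neumann series. -/
def volt (d : ℝ → ℂ) (a b : Fin 2 → Fin 2 → ℂ) (μ : Fin 2 → ℂ) : ℕ → ℝ → Fin 2 → ℂ
  | 0 => fun _ => Pi.single 0 1
  | n + 1 => voltStep d a b μ (volt d a b μ n)

/-- The sum of the Neumann series. -/
def voltSum (d : ℝ → ℂ) (a b : Fin 2 → Fin 2 → ℂ) (μ : Fin 2 → ℂ) (x : ℝ) (j : Fin 2) : ℂ :=
  ∑' n, volt d a b μ n x j

/-- The weight that makes the Volterra operator a contraction. -/
def wgt (d : ℝ → ℂ) (c x : ℝ) : ℝ := Real.exp (2 * c * ∫ y in Ioi x, ‖d y‖)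

theorem norm_src_le {d : ℝ → ℂ} {a b : Fin 2 → Fin 2 → ℂ} {c : ℝ}
    (hc : ∀ j, ∑ k, (‖a j k‖ + ‖b j k‖) ≤ c) {φ : ℝ → Fin 2 → ℂ} (j : Fin 2) {y M : ℝ}
    (hM : ∀ k, ‖φ y k‖ ≤ M) : ‖src d a b φ j y‖ ≤ c * ‖d y‖ * M := by
  have hM0 : 0 ≤ M := (norm_nonneg _).trans (hM 0)
  calc ‖src d a b φ j y‖ ≤ ∑ k, ‖(a j k * d y + b j k * conj (d y)) * φ y k‖ := norm_sum_le _ _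
    _ ≤ ∑ k, (‖a j k‖ + ‖b j k‖) * ‖d y‖ * M := by
        gcongr with k
        rw [norm_mul]
        gcongr
        · refine (norm_add_le _ _).trans_eq ?_
          rw [norm_mul, norm_mul, RCLike.norm_conj, add_mul]
        · exact hM k
    _ = (∑ k, (‖a j k‖ + ‖b j k‖)) * ‖d y‖ * M := by rw [Finset.sum_mul, Finset.sum_mul]
    _ ≤ _ := by gcongr; exact hc j

section

variable {d : ℝ → ℂ} (hd : Continuous d) (hi : ∀ x, IntegrableOn d (Ioi x))
include hd hi

theorem hasDerivAt_wgt (c x : ℝ) :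
    HasDerivAt (wgt d c) (-(2 * (c * ‖d x‖ * wgt d c x))) x := by
  have h := ((hasDerivAt_integral_Ioi hd.norm (fun x => (hi x).norm) x).const_mul (2 * c)).exp
  refine h.congr_deriv ?_
  simp only [wgt]
  ring

omit hd hi in
theorem tendsto_wgt (c : ℝ) : Tendsto (wgt d c) atTop (𝓝 1) := by
  have h : Tendsto (fun x : ℝ => ∫ y in Ioi x, ‖d y‖) atTop (𝓝 0) :=
    tendsto_integral_Ioi_zero tendsto_id
  have := ((h.const_mul (2 * c))).rexp
  change Tendsto (fun x => Real.exp (2 * c * ∫ y in Ioi x, ‖d y‖)) atTop (𝓝 1)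
  simpa using this

theorem continuous_wgt (c : ℝ) : Continuous (wgt d c) :=
  continuous_iff_continuousAt.2 fun x => (hasDerivAt_wgt hd hi c x).continuousAt

theorem integrableOn_wgt {c : ℝ} (hc : 0 ≤ c) (x : ℝ) :
    IntegrableOn (fun y => c * ‖d y‖ * wgt d c y) (Ioi x) := by
  have h := integrableOn_Ioi_deriv_of_nonpos' (a := x) (fun y _ => hasDerivAt_wgt hd hi c y)
    (fun y _ => by
      have : 0 < wgt d c y := Real.exp_pos _
      have : 0 ≤ c * ‖d y‖ * wgt d c y := by positivity
      linarith) (tendsto_wgt c)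
  refine (h.const_mul (-(1 / 2))).congr (ae_of_all _ fun y => ?_)
  simp only
  ring

/-- The weight satisfies `W' = -2 c ‖d‖ W` and `W → 1`, so the integral is exactly `(W x - 1) / 2`.
The factor `2` in the exponent of `wgt` is there to produce the contraction constant `1/2`, whatever
the size of the potential, and hence a geometric Neumann series. -/
theorem integral_wgt_le {c : ℝ} (hc : 0 ≤ c) (x : ℝ) :
    ∫ y in Ioi x, c * ‖d y‖ * wgt d c y ≤ wgt d c x / 2 := by
  have h := integral_Ioi_of_hasDerivAt_of_tendsto' (a := x)
    (fun y _ => hasDerivAt_wgt hd hi c y)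
    (((integrableOn_wgt hd hi hc x).const_mul 2).neg) (tendsto_wgt c)
  rw [integral_neg, integral_const_mul] at h
  linarith

omit hi in
theorem continuous_src {a b : Fin 2 → Fin 2 → ℂ} {φ : ℝ → Fin 2 → ℂ} (hφ : Continuous φ)
    (j : Fin 2) : Continuous (src d a b φ j) := by
  unfold src
  fun_prop

variable {a b : Fin 2 → Fin 2 → ℂ} {μ : Fin 2 → ℂ} {c : ℝ} 
  (hc : ∀ j, ∑ k, (‖a j k‖ + ‖b j k‖) ≤ c) (hμ : ∀ j, 0 ≤ (μ j).re)

include hc in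
omit hd hi in
theorem coeff_bound_nonneg : 0 ≤ c := le_trans (by positivity) (hc 0)

include hc

theorem integrableOn_src {φ : ℝ → Fin 2 → ℂ} (hφ : Continuous φ) {M : ℝ}
    (hM : ∀ y k, ‖φ y k‖ ≤ M * wgt d c y) (j : Fin 2) (x : ℝ) :
    IntegrableOn (src d a b φ j) (Ioi x) := by
  refine Integrable.mono' ((integrableOn_wgt hd hi (coeff_bound_nonneg hc) x).const_mul M)
    (continuous_src hd hφ j).aestronglyMeasurable (ae_of_all _ fun y => ?_)
  refine (norm_src_le hc j (hM y)).trans_eq ?_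
  ring

include hμ

theorem voltStep_bound {φ : ℝ → Fin 2 → ℂ} {M : ℝ} (hM0 : 0 ≤ M)
    (hM : ∀ y k, ‖φ y k‖ ≤ M * wgt d c y) (x : ℝ) (j : Fin 2) :
    ‖voltStep d a b μ φ x j‖ ≤ M * (1 / 2) * wgt d c x := by
  have hc0 := coeff_bound_nonneg hc
  rw [voltStep, norm_neg]
  refine (norm_expTail_le (hμ j) ((integrableOn_wgt hd hi hc0 x).const_mul M)
    fun y _ => (norm_src_le hc j (hM y)).trans_eq (by ring)).trans ?_
  rw [integral_const_mul]
  have := mul_le_mul_of_nonneg_left (integral_wgt_le hd hi hc0 x) hM0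
  linarith

theorem continuous_voltStep {φ : ℝ → Fin 2 → ℂ} (hφ : Continuous φ) {M : ℝ}
    (hM : ∀ y k, ‖φ y k‖ ≤ M * wgt d c y) : Continuous (voltStep d a b μ φ) := by
  refine continuous_pi fun j => continuous_iff_continuousAt.2 fun x => ?_
  exact (hasDerivAt_expTail (hμ j) (continuous_src hd hφ j)
    (integrableOn_src hd hi hc hφ hM j) x).neg.continuousAt

theorem volt_spec (n : ℕ) : Continuous (volt d a b μ n) ∧
    ∀ x k, ‖volt d a b μ n x k‖ ≤ (1 / 2) ^ n * wgt d c x := by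
  induction n with
  | zero =>
    refine ⟨continuous_const, fun x k => ?_⟩
    have h1 : 1 ≤ wgt d c x := by
      rw [wgt, Real.one_le_exp_iff]
      have := coeff_bound_nonneg hc
      have : 0 ≤ ∫ y in Ioi x, ‖d y‖ := integral_nonneg fun _ => norm_nonneg _
      positivity
    have h2 : ‖volt d a b μ 0 x k‖ ≤ 1 := by fin_cases k <;> simp [volt]
    simpa using h2.trans h1
  | succ n ih =>
    refine ⟨continuous_voltStep hd hi hc hμ ih.1 ih.2, fun x k => ?_⟩
    rw [pow_succ]
    exact voltStep_bound hd hi hc hμ (by positivity) ih.2 x k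

theorem summable_volt (x : ℝ) (k : Fin 2) : Summable fun n => volt d a b μ n x k := by
  refine Summable.of_norm_bounded (g := fun n : ℕ => (1 / 2 : ℝ) ^ n * wgt d c x) ?_
    fun n => (volt_spec hd hi hc hμ n).2 x k
  exact (summable_geometric_of_lt_one (by norm_num) (by norm_num)).mul_right _

theorem voltSum_bound (x : ℝ) (k : Fin 2) : ‖voltSum d a b μ x k‖ ≤ 2 * wgt d c x := by
  have hs : HasSum (fun n : ℕ => (1 / 2 : ℝ) ^ n * wgt d c x) (2 * wgt d c x) :=
    hasSum_geometric_two.mul_right _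
  exact tsum_of_norm_bounded hs fun n => (volt_spec hd hi hc hμ n).2 x k

theorem continuous_voltSum : Continuous (voltSum d a b μ) := by
  refine continuous_pi fun k => continuous_iff_continuousAt.2 fun x => ?_
  have hW := (continuous_wgt hd hi c).continuousAt (x := x)
  -- The weight need not be bounded on the whole line, so uniform convergence is only obtained
  -- locally.
  have : ∀ᶠ y in 𝓝 x, wgt d c y < wgt d c x + 1 := hW.eventually_lt continuousAt_const (by linarith)
  obtain ⟨U, hU, hUo, hxU⟩ := eventually_nhds_iff.1 this
  have hco : ContinuousOn (fun x => voltSum d a b μ x k) U := by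
    refine continuousOn_tsum (u := fun n : ℕ => (1 / 2 : ℝ) ^ n * (wgt d c x + 1))
      (fun n => ((continuous_apply k).comp (volt_spec hd hi hc hμ n).1).continuousOn)
      ((summable_geometric_of_lt_one (by norm_num) (by norm_num)).mul_right _) ?_
    intro n y hy
    refine ((volt_spec hd hi hc hμ n).2 y k).trans ?_
    gcongr
    exact (hU y hy).le
  exact hco.continuousAt (hUo.mem_nhds hxU)

/-- Shifting the index turns the tail of the series into the Volterra operator applied termwise. The
geometric bounds make the integrals of the norms summable, so sum and integral may be exchanged. -/
theorem voltSum_eq (x : ℝ) (j : Fin 2) : voltSum d a b μ x j =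
    (Pi.single 0 1 : Fin 2 → ℂ) j + voltStep d a b μ (voltSum d a b μ) x j := by
  have h0 : voltSum d a b μ x j = (Pi.single 0 1 : Fin 2 → ℂ) j +
      ∑' n, volt d a b μ (n + 1) x j := by
    rw [voltSum, (summable_volt hd hi hc hμ x j).tsum_eq_zero_add]
    rfl
  rw [h0]
  congr 1
  have hint := hasSum_integral_of_summable_integral_norm (μ := volume.restrict (Ioi x))
    (F := fun n y => Complex.exp (μ j * (x - y)) * src d a b (volt d a b μ n) j y)
    (fun n => integrableOn_exp_mul (hμ j) (integrableOn_src hd hi hc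
      (volt_spec hd hi hc hμ n).1 (volt_spec hd hi hc hμ n).2 j x)) ?_
  · have h2 : ∑' n, volt d a b μ (n + 1) x j = -∑' n, expTail (μ j) (src d a b (volt d a b μ n) j) x := by
      rw [← tsum_neg]
      rfl
    rw [h2, voltStep]
    congr 1
    refine hint.tsum_eq.trans ?_
    rw [expTail]
    congr 1
    funext y
    rw [tsum_mul_left]
    congr 1
    unfold src
    rw [Summable.tsum_finsetSum fun k _ => (summable_volt hd hi hc hμ y k).mul_left _]
    refine Finset.sum_congr rfl fun k _ => ?_
    rw [tsum_mul_left, voltSum]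
  · have hc0 := coeff_bound_nonneg hc
    refine Summable.of_nonneg_of_le (fun n => integral_nonneg fun _ => norm_nonneg _) (fun n => ?_)
      ((summable_geometric_of_lt_one (r := 1 / 2) (by norm_num) (by norm_num)).mul_right
        (∫ y in Ioi x, c * ‖d y‖ * wgt d c y))
    rw [← integral_const_mul]
    refine integral_mono_of_nonneg (ae_of_all _ fun _ => norm_nonneg _)
      ((integrableOn_wgt hd hi hc0 x).const_mul _) ?_
    filter_upwards [ae_restrict_mem measurableSet_Ioi] with y hy
    rw [norm_mul]
    calc _ ≤ 1 * (c * ‖d y‖ * ((1 / 2) ^ n * wgt d c y)) := by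
          gcongr
          · exact norm_exp_mul_sub_le (hμ j) (le_of_lt hy)
          · exact norm_src_le hc j ((volt_spec hd hi hc hμ n).2 y)
      _ = _ := by ring

theorem hasDerivAt_voltSum (x : ℝ) (j : Fin 2) : HasDerivAt (fun x => voltSum d a b μ x j)
    (μ j * (voltSum d a b μ x j - (Pi.single 0 1 : Fin 2 → ℂ) j) +
      src d a b (voltSum d a b μ) j x) x := by
  have h := (hasDerivAt_expTail (hμ j) (continuous_src hd (continuous_voltSum hd hi hc hμ) j)
    (integrableOn_src hd hi hc (continuous_voltSum hd hi hc hμ)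
      (voltSum_bound hd hi hc hμ) j) x).const_sub ((Pi.single 0 1 : Fin 2 → ℂ) j)
  have e : (fun x => voltSum d a b μ x j) = fun x => (Pi.single 0 1 : Fin 2 → ℂ) j -
      expTail (μ j) (src d a b (voltSum d a b μ) j) x := by
    funext x
    rw [voltSum_eq hd hi hc hμ, voltStep, sub_eq_add_neg]
  rw [e, voltSum_eq hd hi hc hμ, voltStep]
  refine h.congr_deriv ?_
  ring

theorem tendsto_voltSum (j : Fin 2) : Tendsto (fun x => voltSum d a b μ x j) atTop
    (𝓝 ((Pi.single 0 1 : Fin 2 → ℂ) j)) := by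
  have hc0 := coeff_bound_nonneg hc
  have h : Tendsto (fun x => voltStep d a b μ (voltSum d a b μ) x j) atTop (𝓝 0) := by
    have h0 : Tendsto (fun x : ℝ => ∫ y in Ioi x, 2 * (c * ‖d y‖ * wgt d c y)) atTop (𝓝 0) :=
      tendsto_integral_Ioi_zero tendsto_id
    refine squeeze_zero_norm (fun x => ?_) h0
    rw [voltStep, norm_neg]
    exact norm_expTail_le (hμ j) ((integrableOn_wgt hd hi hc0 x).const_mul 2)
      fun y _ => (norm_src_le hc j (voltSum_bound hd hi hc hμ y)).trans_eq (by ring)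
  have h1 := h.const_add ((Pi.single 0 1 : Fin 2 → ℂ) j)
  rw [add_zero] at h1
  exact h1.congr fun x => (voltSum_eq hd hi hc hμ x j).symm

end

end KunduEckhaus

end

noncomputable section

namespace KunduEckhaus

open Set

/-! ### Dependence of Volterra solutions on a parameter -/

/-- For holomorphic integrands no bound on the derivative has to be assumed: Cauchy's estimate on
circles of radius `r / 4` converts the bound on `F` into one on its derivative. -/
theorem differentiableOn_integral_of_dominated {α : Type*} [MeasurableSpace α] {ν : Measure α}
    {S : Set ℂ} (hS : IsOpen S) {F : ℂ → α → ℂ} {bound : α → ℝ}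
    (hm : ∀ z ∈ S, AEStronglyMeasurable (F z) ν) (hb : ∀ᵐ y ∂ν, ∀ z ∈ S, ‖F z y‖ ≤ bound y)
    (hbi : Integrable bound ν) (hd : ∀ᵐ y ∂ν, DifferentiableOn ℂ (fun z => F z y) S) :
    DifferentiableOn ℂ (fun z => ∫ y, F z y ∂ν) S := by
  intro z₀ hz₀
  obtain ⟨r, hr, hrS⟩ := Metric.isOpen_iff.1 hS z₀ hz₀
  have hr2 : 0 < r / 2 := by linarith
  have hsub : ∀ x ∈ Metric.ball z₀ (r / 2), Metric.closedBall x (r / 4) ⊆ S := by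
    intro x hx w hw
    apply hrS
    rw [Metric.mem_ball] at hx ⊢
    rw [Metric.mem_closedBall] at hw
    calc dist w z₀ ≤ dist w x + dist x z₀ := dist_triangle _ _ _
      _ < r := by linarith
  have hderiv : AEStronglyMeasurable (fun y => deriv (fun z => F z y) z₀) ν := by
    -- A sequence of nonzero increments tending to `0` inside the ball: the derivative is the
    -- pointwise limit of measurable difference quotients, hence measurable.
    set h : ℕ → ℂ := fun n => ((r / 2 / (n + 2) : ℝ) : ℂ) with hh
    have hpos : ∀ n : ℕ, 0 < r / 2 / ((n : ℝ) + 2) := fun n => by positivity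
    have hlt : ∀ n : ℕ, r / 2 / ((n : ℝ) + 2) < r := fun n => by
      rw [div_lt_iff₀ (by positivity)]
      have : (0 : ℝ) ≤ n := n.cast_nonneg
      nlinarith
    have hmem : ∀ n, z₀ + h n ∈ S := fun n => by
      apply hrS
      rw [Metric.mem_ball, dist_eq_norm, add_sub_cancel_left, hh]
      simp only [Complex.norm_real, Real.norm_eq_abs]
      rw [abs_of_pos (hpos n)]
      exact hlt n
    have hne : ∀ n, h n ≠ 0 := fun n => by
      simp only [hh, ne_eq, Complex.ofReal_eq_zero]
      exact (hpos n).ne'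
    have hlim : Tendsto h atTop (𝓝[≠] 0) := by
      refine tendsto_nhdsWithin_iff.2 ⟨?_, Eventually.of_forall hne⟩
      have : Tendsto (fun n : ℕ => r / 2 / ((n : ℝ) + 2)) atTop (𝓝 0) :=
        tendsto_const_nhds.div_atTop
          (tendsto_atTop_add_const_right _ _ tendsto_natCast_atTop_atTop)
      simpa [hh] using this.ofReal
    refine aestronglyMeasurable_of_tendsto_ae atTop
      (f := fun n y => (h n)⁻¹ • (F (z₀ + h n) y - F z₀ y))
      (fun n => ((hm _ (hmem n)).sub (hm _ hz₀)).const_smul (h n)⁻¹) ?_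
    filter_upwards [hd] with y hy
    have := (hy.differentiableAt (hS.mem_nhds hz₀)).hasDerivAt.tendsto_slope_zero
    exact this.comp hlim
  have hball : Metric.ball z₀ (r / 2) ⊆ S := fun x hx =>
    hsub x hx (Metric.mem_closedBall_self (by linarith))
  refine (hasDerivAt_integral_of_dominated_loc_of_deriv_le (bound := fun y => bound y / (r / 4))
    (F' := fun z y => deriv (fun z => F z y) z)
    (Metric.ball_mem_nhds z₀ hr2) ?_ ?_ hderiv ?_ (hbi.div_const _) ?_).2.differentiableAt.differentiableWithinAt
  · filter_upwards [hS.mem_nhds hz₀] with z hz using hm z hz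
  · refine Integrable.mono' hbi (hm _ hz₀) ?_
    filter_upwards [hb] with y hy using hy _ hz₀
  · filter_upwards [hb, hd] with y hy hdy x hx
    refine Complex.norm_deriv_le_of_forall_mem_sphere_norm_le (by linarith) ?_ ?_
    · refine (hdy.mono ?_).diffContOnCl
      exact (closure_minimal Metric.ball_subset_closedBall Metric.isClosed_closedBall).trans
        (hsub x hx)
    · intro w hw
      exact hy w (hsub x hx (Metric.sphere_subset_closedBall hw))
  · filter_upwards [hd] with y hdy x hx
    exact (hdy.differentiableAt (hS.mem_nhds (hball hx))).hasDerivAt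

section

variable {d : ℝ → ℂ} (hd : Continuous d) (hi : ∀ x, IntegrableOn d (Ioi x))
  {a b : ℂ → Fin 2 → Fin 2 → ℂ} {μ : ℂ → Fin 2 → ℂ} {c : ℝ} {S : Set ℂ}
  (hc : ∀ z ∈ S, ∀ j, ∑ k, (‖a z j k‖ + ‖b z j k‖) ≤ c) (hμ : ∀ z ∈ S, ∀ j, 0 ≤ (μ z j).re)

theorem norm_volt_integrand_le {d : ℝ → ℂ} {a b : Fin 2 → Fin 2 → ℂ} {μ : ℂ} {c : ℝ}
    (hc : ∀ j, ∑ k, (‖a j k‖ + ‖b j k‖) ≤ c) (hμ : 0 ≤ μ.re) {φ : ℝ → Fin 2 → ℂ} (j : Fin 2)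
    {x y M : ℝ} (hxy : x < y) (hM : ∀ k, ‖φ y k‖ ≤ M * wgt d c y) :
    ‖Complex.exp (μ * (x - y)) * src d a b φ j y‖ ≤ M * (c * ‖d y‖ * wgt d c y) := by
  rw [norm_mul]
  calc _ ≤ 1 * (c * ‖d y‖ * (M * wgt d c y)) := by
        gcongr
        · exact norm_exp_mul_sub_le hμ (le_of_lt hxy)
        · exact norm_src_le hc j hM
    _ = _ := by ring

include hd hi hc hμ

theorem continuousOn_volt (ha : ∀ j k, ContinuousOn (fun z => a z j k) S)
    (hb : ∀ j k, ContinuousOn (fun z => b z j k) S) (hμc : ∀ j, ContinuousOn (fun z => μ z j) S)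
    (n : ℕ) (x : ℝ) (j : Fin 2) :
    ContinuousOn (fun z => volt d (a z) (b z) (μ z) n x j) S := by
  induction n generalizing x j with
  | zero => exact continuousOn_const
  | succ n ih =>
    intro z₀ hz₀
    have hc0 := coeff_bound_nonneg (hc z₀ hz₀)
    refine ContinuousWithinAt.neg ?_
    refine continuousWithinAt_of_dominated
      (bound := fun y => (1 / 2) ^ n * (c * ‖d y‖ * wgt d c y)) ?_ ?_
      ((integrableOn_wgt hd hi hc0 x).const_mul _) ?_
    · filter_upwards [self_mem_nhdsWithin] with z hz
      exact (integrableOn_exp_mul (hμ z hz j) (integrableOn_src hd hi (hc z hz)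
        (volt_spec hd hi (hc z hz) (hμ z hz) n).1
        (volt_spec hd hi (hc z hz) (hμ z hz) n).2 j x)).aestronglyMeasurable
    · filter_upwards [self_mem_nhdsWithin] with z hz
      filter_upwards [ae_restrict_mem measurableSet_Ioi] with y hy
      exact norm_volt_integrand_le (hc z hz) (hμ z hz j) j hy
        ((volt_spec hd hi (hc z hz) (hμ z hz) n).2 y)
    · refine ae_of_all _ fun y => ?_
      refine ContinuousWithinAt.mul (((hμc j z₀ hz₀).mul continuousWithinAt_const).cexp) ?_
      unfold src
      exact tendsto_finsetSum _ fun k _ =>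
        (((ha j k z₀ hz₀).mul continuousWithinAt_const).add
        ((hb j k z₀ hz₀).mul continuousWithinAt_const)).mul (ih y k z₀ hz₀)

theorem differentiableOn_volt (hS : IsOpen S) (ha : ∀ j k, DifferentiableOn ℂ (fun z => a z j k) S)
    (hb : ∀ j k, DifferentiableOn ℂ (fun z => b z j k) S)
    (hμc : ∀ j, DifferentiableOn ℂ (fun z => μ z j) S) (n : ℕ) (x : ℝ) (j : Fin 2) :
    DifferentiableOn ℂ (fun z => volt d (a z) (b z) (μ z) n x j) S := by
  induction n generalizing x j with
  | zero => exact differentiableOn_const _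
  | succ n ih =>
    rcases S.eq_empty_or_nonempty with rfl | ⟨z₀, hz₀⟩
    · exact differentiableOn_empty
    have hc0 := coeff_bound_nonneg (hc z₀ hz₀)
    refine DifferentiableOn.neg ?_
    refine differentiableOn_integral_of_dominated hS
      (bound := fun y => (1 / 2) ^ n * (c * ‖d y‖ * wgt d c y)) ?_ ?_
      ((integrableOn_wgt hd hi hc0 x).const_mul _) ?_
    · intro z hz
      exact (integrableOn_exp_mul (hμ z hz j) (integrableOn_src hd hi (hc z hz)
        (volt_spec hd hi (hc z hz) (hμ z hz) n).1
        (volt_spec hd hi (hc z hz) (hμ z hz) n).2 j x)).aestronglyMeasurable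
    · filter_upwards [ae_restrict_mem measurableSet_Ioi] with y hy z hz
      exact norm_volt_integrand_le (hc z hz) (hμ z hz j) j hy
        ((volt_spec hd hi (hc z hz) (hμ z hz) n).2 y)
    · refine ae_of_all _ fun y => ?_
      refine DifferentiableOn.mul (((hμc j).mul (differentiableOn_const _)).cexp) ?_
      unfold src
      exact DifferentiableOn.fun_sum fun k _ =>
        (((ha j k).mul (differentiableOn_const _)).add
        ((hb j k).mul (differentiableOn_const _))).mul (ih y k)

theorem continuousOn_voltSum (ha : ∀ j k, ContinuousOn (fun z => a z j k) S)
    (hb : ∀ j k, ContinuousOn (fun z => b z j k) S) (hμc : ∀ j, ContinuousOn (fun z => μ z j) S)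
    (x : ℝ) (j : Fin 2) : ContinuousOn (fun z => voltSum d (a z) (b z) (μ z) x j) S :=
  continuousOn_tsum (u := fun n : ℕ => (1 / 2 : ℝ) ^ n * wgt d c x)
    (fun n => continuousOn_volt hd hi hc hμ ha hb hμc n x j)
    ((summable_geometric_of_lt_one (by norm_num) (by norm_num)).mul_right _)
    fun n z hz => (volt_spec hd hi (hc z hz) (hμ z hz) n).2 x j

theorem differentiableOn_voltSum (hS : IsOpen S)
    (ha : ∀ j k, DifferentiableOn ℂ (fun z => a z j k) S)
    (hb : ∀ j k, DifferentiableOn ℂ (fun z => b z j k) S)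
    (hμc : ∀ j, DifferentiableOn ℂ (fun z => μ z j) S) (x : ℝ) (j : Fin 2) :
    DifferentiableOn ℂ (fun z => voltSum d (a z) (b z) (μ z) x j) S :=
  Complex.differentiableOn_tsum_of_summable_norm (u := fun n : ℕ => (1 / 2 : ℝ) ^ n * wgt d c x)
    ((summable_geometric_of_lt_one (by norm_num) (by norm_num)).mul_right _)
    (fun n => differentiableOn_volt hd hi hc hμ hS ha hb hμc n x j) hS
    fun n z hz => (volt_spec hd hi (hc z hz) (hμ z hz) n).2 x j

/-- Only the first iterate needs an oscillation argument. Each later term is an integral of the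
previous one against a bounded kernel with convergent coefficients, so dominated convergence
propagates the limit `0`; the geometric majorant then lets the limit pass through the series,
leaving the zeroth term. -/
theorem tendsto_voltSum_param {l : Filter ℂ} [l.IsCountablyGenerated] (hl : ∀ᶠ z in l, z ∈ S)
    {A B : Fin 2 → Fin 2 → ℂ}
    (ha : ∀ j k, Tendsto (fun z => a z j k) l (𝓝 (A j k)))
    (hb : ∀ j k, Tendsto (fun z => b z j k) l (𝓝 (B j k)))
    (h1 : ∀ x j, Tendsto (fun z => volt d (a z) (b z) (μ z) 1 x j) l (𝓝 0)) (x : ℝ) (j : Fin 2) :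
    Tendsto (fun z => voltSum d (a z) (b z) (μ z) x j) l (𝓝 ((Pi.single 0 1 : Fin 2 → ℂ) j)) := by
  rcases S.eq_empty_or_nonempty with rfl | ⟨z₀, hz₀⟩
  · have : l = ⊥ := by simpa using hl
    rw [this]
    exact tendsto_bot
  have hc0 := coeff_bound_nonneg (hc z₀ hz₀)
  have hterm : ∀ n x j, Tendsto (fun z => volt d (a z) (b z) (μ z) (n + 1) x j) l (𝓝 0) := by
    intro n
    induction n with
    | zero => exact h1
    | succ n ih =>
      intro x j
      rw [← neg_zero]
      refine Tendsto.neg ?_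
      have := tendsto_integral_filter_of_dominated_convergence (μ := volume.restrict (Ioi x))
        (l := l) (f := fun _ => (0 : ℂ))
        (F := fun z y => Complex.exp (μ z j * (x - y)) *
          src d (a z) (b z) (volt d (a z) (b z) (μ z) (n + 1)) j y)
        (fun y => (1 / 2) ^ (n + 1) * (c * ‖d y‖ * wgt d c y)) ?_ ?_
        ((integrableOn_wgt hd hi hc0 x).const_mul _) ?_
      · simpa [expTail] using this
      · filter_upwards [hl] with z hz
        exact (integrableOn_exp_mul (hμ z hz j) (integrableOn_src hd hi (hc z hz)
          (volt_spec hd hi (hc z hz) (hμ z hz) (n + 1)).1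
          (volt_spec hd hi (hc z hz) (hμ z hz) (n + 1)).2 j x)).aestronglyMeasurable
      · filter_upwards [hl] with z hz
        filter_upwards [ae_restrict_mem measurableSet_Ioi] with y hy
        exact norm_volt_integrand_le (hc z hz) (hμ z hz j) j hy
          ((volt_spec hd hi (hc z hz) (hμ z hz) (n + 1)).2 y)
      · filter_upwards [ae_restrict_mem measurableSet_Ioi] with y hy
        have hs : Tendsto (fun z => src d (a z) (b z) (volt d (a z) (b z) (μ z) (n + 1)) j y) l
            (𝓝 0) := by
          have : Tendsto (fun z => src d (a z) (b z) (volt d (a z) (b z) (μ z) (n + 1)) j y) l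
            (𝓝 (∑ k, (A j k * d y + B j k * conj (d y)) * 0)) := 
              tendsto_finsetSum _ fun k _ =>
                (((ha j k).mul_const _).add ((hb j k).mul_const _)).mul (ih y k)
          simpa using this
        refine squeeze_zero_norm' ?_ (tendsto_zero_iff_norm_tendsto_zero.1 hs)
        filter_upwards [hl] with z hz
        rw [norm_mul]
        exact mul_le_of_le_one_left (norm_nonneg _)
          (norm_exp_mul_sub_le (hμ z hz j) (le_of_lt hy))
  have h := tendsto_tsum_of_dominated_convergence (𝓕 := l)
    (f := fun z n => volt d (a z) (b z) (μ z) n x j)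
    (g := fun n : ℕ => if n = 0 then (Pi.single 0 1 : Fin 2 → ℂ) j else 0)
    (bound := fun n : ℕ => (1 / 2 : ℝ) ^ n * wgt d c x)
    ((summable_geometric_of_lt_one (by norm_num) (by norm_num)).mul_right _) ?_ ?_
  · rw [tsum_ite_eq] at h
    exact h
  · intro n
    cases n with
    | zero => exact tendsto_const_nhds
    | succ n => simpa using hterm n x j
  · filter_upwards [hl] with z hz n
    exact (volt_spec hd hi (hc z hz) (hμ z hz) n).2 x j

end

/-! ### The Riemann–Lebesgue lemma in a half plane -/

/-- Integration by parts gains a factor `1 / ‖μ‖`, while all exponentials stay bounded by `1`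
because `0 ≤ μ.re`. -/
theorem norm_integral_exp_mul_le {P P' : ℝ → ℂ} (hP : ∀ y, HasDerivAt P (P' y) y)
    (hP' : Continuous P') {x T : ℝ} (hxT : x ≤ T) {μ : ℂ} (hμ : 0 ≤ μ.re) (h0 : μ ≠ 0) :
    ‖∫ y in x..T, Complex.exp (μ * (x - y)) * P y‖ ≤
      (‖P x‖ + ‖P T‖ + ∫ y in x..T, ‖P' y‖) / ‖μ‖ := by
  have hv : ∀ y : ℝ, HasDerivAt (fun y : ℝ => -Complex.exp (μ * (x - y)) / μ)
      (Complex.exp (μ * (x - y))) y := by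
    intro y
    have h1 : HasDerivAt (fun y : ℝ => μ * ((x : ℂ) - y)) (-μ) y := by
      simpa using ((hasDerivAt_id y).ofReal_comp.const_sub (x : ℂ)).const_mul μ
    refine (h1.cexp.neg.div_const μ).congr_deriv ?_
    field_simp
  have hcP : Continuous P := continuous_iff_continuousAt.2 fun y => (hP y).continuousAt
  have h := intervalIntegral.integral_mul_deriv_eq_deriv_mul (a := x) (b := T)
    (u := P) (v := fun y : ℝ => -Complex.exp (μ * (x - y)) / μ) (u' := P')
    (v' := fun y : ℝ => Complex.exp (μ * (x - y))) (fun y _ => hP y) (fun y _ => hv y)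
    (hP'.intervalIntegrable _ _) (by apply Continuous.intervalIntegrable; fun_prop)
  have hE : ∀ y, x ≤ y → ‖-Complex.exp (μ * (x - y)) / μ‖ ≤ 1 / ‖μ‖ := by
    intro y hy
    rw [norm_div, norm_neg]
    gcongr
    exact norm_exp_mul_sub_le hμ hy
  have hI : ‖∫ y in x..T, P' y * (-Complex.exp (μ * (x - y)) / μ)‖ ≤ (∫ y in x..T, ‖P' y‖) * (1 / ‖μ‖) := by
    rw [← intervalIntegral.integral_mul_const]
    refine intervalIntegral.norm_integral_le_of_norm_le hxT ?_
      (by apply Continuous.intervalIntegrable; fun_prop)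
    refine ae_of_all _ fun y hy => ?_
    rw [norm_mul]
    gcongr
    exact hE y hy.1.le
  simp_rw [mul_comm (Complex.exp _)]
  rw [h]
  refine (norm_sub_le _ _).trans ?_
  refine (add_le_add (norm_sub_le _ _) hI).trans ?_
  rw [norm_mul, norm_mul]
  have h1 := mul_le_mul_of_nonneg_left (hE x le_rfl) (norm_nonneg (P x))
  have h2 := mul_le_mul_of_nonneg_left (hE T hxT) (norm_nonneg (P T))
  calc _ ≤ ‖P T‖ * (1 / ‖μ‖) + ‖P x‖ * (1 / ‖μ‖) + (∫ y in x..T, ‖P' y‖) * (1 / ‖μ‖) := by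
        gcongr
    _ = _ := by ring

/-- The integral beyond a large `T` is small uniformly in `μ`; on `[x, T]` the function is uniformly
close to a polynomial, for which integration by parts applies. No decay of the exponential is used,
so the limit `‖μ‖ → ∞` may be taken up to the imaginary axis. -/
theorem tendsto_expTail_zero {g : ℝ → ℂ} (hg : Continuous g) (hi : ∀ x, IntegrableOn g (Ioi x))
    {ι : Type*} {l : Filter ι} {μ : ι → ℂ} (hμ : ∀ᶠ z in l, 0 ≤ (μ z).re)
    (hinf : Tendsto (fun z => ‖μ z‖) l atTop) (x : ℝ) :
    Tendsto (fun z => expTail (μ z) g x) l (𝓝 0) := by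
  rw [Metric.tendsto_nhds]
  intro ε hε
  have htail : Tendsto (fun T : ℝ => ∫ y in Ioi T, ‖g y‖) atTop (𝓝 0) :=
    tendsto_integral_Ioi_zero tendsto_id
  obtain ⟨T, hT, hxT⟩ := ((htail.eventually_lt_const (show (0 : ℝ) < ε / 4 by linarith)).and
    (eventually_ge_atTop x)).exists
  -- Real and imaginary parts are each approximated within `η`, so the error on `[x, T]` is at most
  -- `2 η (T - x) ≤ ε / 4`; the `+ 1` avoids division by zero when `T = x`.
  set η := ε / 8 / (T - x + 1) with hη
  have hTx : 0 < T - x + 1 := by linarith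
  have hηpos : 0 < η := by positivity
  obtain ⟨p, hp⟩ := exists_polynomial_near_of_continuousOn x T (fun y => (g y).re)
    (by fun_prop) η hηpos
  obtain ⟨r, hr⟩ := exists_polynomial_near_of_continuousOn x T (fun y => (g y).im)
    (by fun_prop) η hηpos
  set P : ℝ → ℂ := fun y => ((p.eval y : ℝ) : ℂ) + ((r.eval y : ℝ) : ℂ) * Complex.I with hPdef
  set P' : ℝ → ℂ := fun y => ((p.derivative.eval y : ℝ) : ℂ) + ((r.derivative.eval y : ℝ) : ℂ) * Complex.I
    with hP'def
  have hP : ∀ y, HasDerivAt P (P' y) y := fun y =>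
    ((p.hasDerivAt y).ofReal_comp).add (((r.hasDerivAt y).ofReal_comp).mul_const _)
  have hP'c : Continuous P' := by fun_prop
  have hPc : Continuous P := by fun_prop
  have hgP : ∀ y ∈ Icc x T, ‖g y - P y‖ ≤ 2 * η := by
    intro y hy
    refine (Complex.norm_le_abs_re_add_abs_im _).trans ?_
    have h1 := hp y hy
    have h2 := hr y hy
    rw [abs_sub_comm] at h1 h2
    have e1 : (g y - P y).re = (g y).re - p.eval y := by simp [hPdef]
    have e2 : (g y - P y).im = (g y).im - r.eval y := by simp [hPdef]
    rw [e1, e2]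
    linarith
  set K := ‖P x‖ + ‖P T‖ + ∫ y in x..T, ‖P' y‖
  have hK : Tendsto (fun z => K / ‖μ z‖) l (𝓝 0) := tendsto_const_nhds.div_atTop hinf
  filter_upwards [hμ, hinf.eventually_gt_atTop 0,
    hK.eventually_lt_const (show (0 : ℝ) < ε / 4 by linarith)] with z hz hz0 hzK
  rw [dist_zero_right]
  have hiz := integrableOn_exp_mul hz (hi x)
  have hsplit : expTail (μ z) g x = (∫ y in x..T, Complex.exp (μ z * (x - y)) * (g y - P y)) +
      (∫ y in x..T, Complex.exp (μ z * (x - y)) * P y) +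
      ∫ y in Ioi T, Complex.exp (μ z * (x - y)) * g y := by
    rw [expTail, ← intervalIntegral.integral_add
      (by apply Continuous.intervalIntegrable; fun_prop)
      (by apply Continuous.intervalIntegrable; fun_prop),
      ← intervalIntegral.integral_interval_add_Ioi hiz (hiz.mono_set (Ioi_subset_Ioi hxT))]
    congr 2
    funext y
    ring
  have b1 : ‖∫ y in x..T, Complex.exp (μ z * (x - y)) * (g y - P y)‖ ≤ 2 * η * |T - x| := by
    refine intervalIntegral.norm_integral_le_of_norm_le_const fun y hy => ?_
    rw [uIoc_of_le hxT] at hy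
    rw [norm_mul]
    exact (mul_le_of_le_one_left (norm_nonneg _) (norm_exp_mul_sub_le hz hy.1.le)).trans
      (hgP y ⟨hy.1.le, hy.2⟩)
  have b2 := norm_integral_exp_mul_le hP hP'c hxT hz (norm_pos_iff.1 hz0)
  have b3 : ‖∫ y in Ioi T, Complex.exp (μ z * (x - y)) * g y‖ ≤ ∫ y in Ioi T, ‖g y‖ := by
    refine norm_integral_le_of_norm_le (hi T).norm ?_
    filter_upwards [ae_restrict_mem measurableSet_Ioi] with y hy
    rw [norm_mul]
    exact mul_le_of_le_one_left (norm_nonneg _)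
      (norm_exp_mul_sub_le hz (hxT.trans (le_of_lt hy)))
  have b4 : 2 * η * |T - x| ≤ ε / 4 := by
    rw [abs_of_nonneg (by linarith), hη]
    rw [show 2 * (ε / 8 / (T - x + 1)) * (T - x) = ε / 4 * ((T - x) / (T - x + 1)) by
      field_simp; ring]
    have : (T - x) / (T - x + 1) ≤ 1 := by rw [div_le_one hTx]; linarith
    nlinarith
  rw [hsplit]
  refine (norm_add₃_le).trans_lt ?_
  linarith

end KunduEckhaus

end

noncomputable section

namespace KunduEckhaus

open Set

/-! ### The spectral domain -/

/-- `D⁻` together with the part `Σ₀` of its boundary. -/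
def DminusCl (q₀ : ℝ) : Set ℂ := Dminus q₀ ∪ Sigma0 q₀

theorem isOpen_Dminus (q₀ : ℝ) : IsOpen (Dminus q₀) :=
  isOpen_lt (by fun_prop) continuous_const

theorem mem_DminusCl_iff {q₀ : ℝ} (hq₀ : 0 < q₀) {z : ℂ} : z ∈ DminusCl q₀ ↔
    (‖z‖ ^ 2 - q₀ ^ 2) * z.im ≤ 0 ∧ z ≠ 0 ∧ z ≠ Complex.I * q₀ ∧ z ≠ -(Complex.I * q₀) := by
  have hnI : ‖Complex.I * (q₀ : ℂ)‖ = q₀ := by simp [abs_of_pos hq₀]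
  constructor
  · rintro (h | ⟨h | h, h0⟩)
    · refine ⟨le_of_lt h, ?_, ?_, ?_⟩
      · rintro rfl
        simp [Dminus] at h
      · rintro rfl
        simp only [Dminus, mem_ofPred_eq, hnI] at h
        simp at h
      · rintro rfl
        simp only [Dminus, mem_ofPred_eq, norm_neg, hnI] at h
        simp at h
    · exact ⟨by simp [h], h0⟩
    · exact ⟨by simp [h], h0⟩
  · rintro ⟨h, h0⟩
    rcases h.lt_or_eq with h | h
    · exact Or.inl h
    · refine Or.inr ⟨?_, h0⟩
      rcases mul_eq_zero.1 h with h | h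
      · right
        have : ‖z‖ ^ 2 = q₀ ^ 2 := by linarith
        exact (pow_left_inj₀ (norm_nonneg _) hq₀.le two_ne_zero).1 this
      · exact Or.inl h

/-- This is the link between the geometry of `D^±` and analysis: on `D⁻ ∪ Σ₀` it gives `Re (2iλ) =
-2 Im λ ≥ 0`, the condition under which the Volterra kernels are bounded. -/
theorem specLam_im {q₀ : ℝ} {z : ℂ} :
    (specLam q₀ z).im = (‖z‖ ^ 2 - q₀ ^ 2) * z.im / (2 * ‖z‖ ^ 2) := by
  rcases eq_or_ne z 0 with rfl | hz
  · simp [specLam]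
  have hn : Complex.normSq z ≠ 0 := by simpa using hz
  have h1 : ((q₀ : ℂ) ^ 2 / z).im = -(q₀ ^ 2 * z.im / Complex.normSq z) := by
    rw [← Complex.ofReal_pow, Complex.div_im, Complex.ofReal_im, Complex.ofReal_re]
    ring
  rw [specLam, show (2 : ℂ) = ((2 : ℝ) : ℂ) by norm_num, Complex.div_ofReal_im, Complex.add_im, h1,
    ← Complex.normSq_eq_norm_sq]
  field_simp
  ring

theorem gam_eq {q₀ : ℝ} {z : ℂ} (hz : z ≠ 0) : gam q₀ z = (z ^ 2 + q₀ ^ 2) / z ^ 2 := by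
  rw [gam]
  field_simp

theorem sq_add_sq_ne_zero {q₀ : ℝ} {z : ℂ} (h1 : z ≠ Complex.I * q₀) (h2 : z ≠ -(Complex.I * q₀)) :
    z ^ 2 + (q₀ : ℂ) ^ 2 ≠ 0 := by
  have : z ^ 2 + (q₀ : ℂ) ^ 2 = (z - Complex.I * q₀) * (z - -(Complex.I * q₀)) := by
    linear_combination ((q₀ : ℂ) ^ 2) * Complex.I_sq
  rw [this]
  exact mul_ne_zero (sub_ne_zero.2 h1) (sub_ne_zero.2 h2)

section

variable {q₀ : ℝ} (hq₀ : 0 < q₀) {z : ℂ} (hz : z ∈ DminusCl q₀)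
include hq₀ hz

theorem ne_zero_of_mem_DminusCl : z ≠ 0 := ((mem_DminusCl_iff hq₀).1 hz).2.1

theorem sq_add_sq_ne_zero_of_mem_DminusCl : z ^ 2 + (q₀ : ℂ) ^ 2 ≠ 0 :=
  sq_add_sq_ne_zero ((mem_DminusCl_iff hq₀).1 hz).2.2.1 ((mem_DminusCl_iff hq₀).1 hz).2.2.2

theorem gam_ne_zero_of_mem_DminusCl : gam q₀ z ≠ 0 := by
  have hz0 := ne_zero_of_mem_DminusCl hq₀ hz
  rw [gam_eq hz0]
  exact div_ne_zero (sq_add_sq_ne_zero_of_mem_DminusCl hq₀ hz) (pow_ne_zero _ hz0)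

theorem specLam_im_nonpos : (specLam q₀ z).im ≤ 0 := by
  rw [specLam_im]
  exact div_nonpos_of_nonpos_of_nonneg ((mem_DminusCl_iff hq₀).1 hz).1 (by positivity)

end

/-! ### Construction of the Jost functions -/

/-- The coefficients of `q - q_+` in the Volterra equation. -/
def jostA (q₀ : ℝ) (Q z : ℂ) : Fin 2 → Fin 2 → ℂ :=
  ![![-(Complex.I * conj Q / z) / gam q₀ z, 1 / gam q₀ z],
    ![(conj Q ^ 2 / z ^ 2) / gam q₀ z, (Complex.I * conj Q / z) / gam q₀ z]]

/-- The coefficients of `(q - q_+)^*` in the Volterra equation. -/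
def jostB (q₀ : ℝ) (Q z : ℂ) : Fin 2 → Fin 2 → ℂ :=
  ![![-(Complex.I * Q / z) / gam q₀ z, -(Q ^ 2 / z ^ 2) / gam q₀ z],
    ![-1 / gam q₀ z, (Complex.I * Q / z) / gam q₀ z]]

/-- The exponents in the Volterra equation. -/
def jostMu (q₀ : ℝ) (z : ℂ) : Fin 2 → ℂ := ![0, 2 * Complex.I * specLam q₀ z]

/-- The first column of `Y_+^{-1} ψ_+ e^{iθσ₃}`. -/
def jostV (q₀ : ℝ) (Q : ℂ) (f : ℝ → ℂ) (z : ℂ) : ℝ → Fin 2 → ℂ :=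
  voltSum (fun x => f x - Q) (jostA q₀ Q z) (jostB q₀ Q z) (jostMu q₀ z)

/-- The first column of `ψ_+ e^{iθσ₃}`. -/
def jostU (q₀ : ℝ) (Q : ℂ) (f : ℝ → ℂ) (z : ℂ) (x : ℝ) : Fin 2 → ℂ :=
  (eigY Q z).mulVec (jostV q₀ Q f z x)

theorem jostMu_re {q₀ : ℝ} (hq₀ : 0 < q₀) {z : ℂ} (hz : z ∈ DminusCl q₀) (j : Fin 2) :
    0 ≤ (jostMu q₀ z j).re := by
  have := specLam_im_nonpos hq₀ hz
  fin_cases j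
  · simp [jostMu]
  · simp [jostMu]
    linarith

theorem conj_mul_of_norm_eq {q₀ : ℝ} {Q : ℂ} (hQ : ‖Q‖ = q₀) : Q * conj Q = (q₀ : ℂ) ^ 2 := by
  rw [Complex.mul_conj, Complex.normSq_eq_norm_sq, hQ]
  simp

/-- `jostA` and `jostB` are the parts of `Y⁻¹ (Q(x) - Q_+) Y` that are linear in `q - q_+` and in
its conjugate, with `Y⁻¹ = γ⁻¹ adj Y`. Multiplying back by `Y` must return the off-diagonal matrix
`Q(x) - Q_+` applied to `Y v`, and these are its two components. -/
theorem eigY_src {q₀ : ℝ} {Q : ℂ} (hQ : ‖Q‖ = q₀) {z : ℂ} (hz0 : z ≠ 0)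
    (hz1 : z ^ 2 + (q₀ : ℂ) ^ 2 ≠ 0) (d : ℝ → ℂ) (v : ℝ → Fin 2 → ℂ) (x : ℝ) :
    src d (jostA q₀ Q z) (jostB q₀ Q z) v 0 x -
        Complex.I * Q / z * src d (jostA q₀ Q z) (jostB q₀ Q z) v 1 x =
      d x * (v x 1 - Complex.I * conj Q / z * v x 0) ∧
    src d (jostA q₀ Q z) (jostB q₀ Q z) v 1 x -
        Complex.I * conj Q / z * src d (jostA q₀ Q z) (jostB q₀ Q z) v 0 x =
      -conj (d x) * (v x 0 - Complex.I * Q / z * v x 1) := by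
  have hQQ := conj_mul_of_norm_eq hQ
  simp only [src, jostA, jostB, Fin.sum_univ_two, Matrix.cons_val_zero, Matrix.cons_val_one,
    gam_eq hz0]
  rw [← hQQ] at hz1 ⊢
  generalize hR : conj Q = R at *
  generalize d x = D
  generalize conj D = D'
  generalize v x 0 = v0
  generalize v x 1 = v1
  have hz2 : z ^ 2 + R * Q ≠ 0 := by rwa [mul_comm R]
  constructor
  · field_simp
    ring_nf
    simp only [Complex.I_sq]
    ring
  · field_simp
    ring_nf
    simp only [Complex.I_sq]
    ring

theorem jostU_apply (q₀ : ℝ) (Q : ℂ) (f : ℝ → ℂ) (z : ℂ) (x : ℝ) (i : Fin 2) : jostU q₀ Q f z x i =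
    eigY Q z i 0 * jostV q₀ Q f z x 0 + eigY Q z i 1 * jostV q₀ Q f z x 1 := by
  simp [jostU, Matrix.mulVec, dotProduct, Fin.sum_univ_two]

section

variable {q₀ : ℝ} (hq₀ : 0 < q₀) {Q : ℂ} {f : ℝ → ℂ} (hf : Continuous f)
  (hi : IntegrableOn (fun x => f x - Q) (Ici 0))

include hf hi in
theorem integrableOn_Ioi_of_Ici (x : ℝ) : IntegrableOn (fun x => f x - Q) (Ioi x) := by
  have h : IntegrableOn (fun x => f x - Q) (Icc x 0 ∪ Ici 0) :=
    ((hf.sub continuous_const).continuousOn.integrableOn_compact isCompact_Icc).union hi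
  refine h.mono_set fun y hy => ?_
  rcases le_total 0 y with h | h
  · exact Or.inr h
  · exact Or.inl ⟨le_of_lt hy, h⟩

theorem exists_coeff_bound (q₀ : ℝ) (Q z : ℂ) :
    ∃ c, ∀ j, ∑ k, (‖jostA q₀ Q z j k‖ + ‖jostB q₀ Q z j k‖) ≤ c :=
  ⟨∑ j, ∑ k, (‖jostA q₀ Q z j k‖ + ‖jostB q₀ Q z j k‖), fun j =>
    Finset.single_le_sum (f := fun j => ∑ k, (‖jostA q₀ Q z j k‖ + ‖jostB q₀ Q z j k‖))
      (fun _ _ => by positivity) (Finset.mem_univ j)⟩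

include hq₀ hf hi

/-- `Y` diagonalizes the asymptotic operator, `X_+ Y = -iλ Y σ₃`. Writing `u = Y v` for the column
`ψ e^{iθ}` shifts the eigenvalues `∓iλ` by `iλ`, which is the origin of the exponents `0` and `2iλ`
in `jostMu`. -/
theorem hasDerivAt_jostU (hQ : ‖Q‖ = q₀) {z : ℂ} (hz : z ∈ DminusCl q₀) (x : ℝ) :
    HasDerivAt (jostU q₀ Q f z)
      ((laxX (specK q₀ z) (f x)).mulVec (jostU q₀ Q f z x) +
        (Complex.I * specLam q₀ z) • jostU q₀ Q f z x) x := by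
  obtain ⟨c, hc⟩ := exists_coeff_bound q₀ Q z
  have hV := hasDerivAt_voltSum (hf.sub continuous_const) (integrableOn_Ioi_of_Ici hf hi) hc
    (jostMu_re hq₀ hz) x
  have h0 := hV 0
  have h1 := hV 1
  have hz0 := ne_zero_of_mem_DminusCl hq₀ hz
  obtain ⟨e0, e1⟩ := eigY_src hQ hz0 (sq_add_sq_ne_zero_of_mem_DminusCl hq₀ hz)
    (fun x => f x - Q) (jostV q₀ Q f z) x
  have hQQ := conj_mul_of_norm_eq hQ
  rw [hasDerivAt_pi]
  intro i
  fin_cases i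
  · have h := (h0.const_mul (eigY Q z 0 0)).add (h1.const_mul (eigY Q z 0 1))
    have e : (fun x => jostU q₀ Q f z x 0) = (fun x => eigY Q z 0 0 * jostV q₀ Q f z x 0) +
        fun x => eigY Q z 0 1 * jostV q₀ Q f z x 1 := by
      funext y
      simp [jostU, Matrix.mulVec, dotProduct, Fin.sum_univ_two]
    simp only [Fin.zero_eta]
    rw [e]
    refine h.congr_deriv ?_
    change _ * (_ * (jostV q₀ Q f z x 0 - _) + src _ _ _ (jostV q₀ Q f z) _ _) +
      _ * (_ * (jostV q₀ Q f z x 1 - _) + src _ _ _ (jostV q₀ Q f z) _ _) = _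
    simp only [jostU, eigY, laxX, Matrix.mulVec, dotProduct, Fin.sum_univ_two, Matrix.of_apply,
      Matrix.cons_val_zero, Matrix.cons_val_one, Pi.add_apply, Pi.smul_apply, smul_eq_mul,
      jostMu, specLam, specK, Pi.single_eq_same, Pi.single_eq_of_ne, ne_eq, one_ne_zero,
      not_false_eq_true, sub_zero, Fin.isValue]
    generalize src _ _ _ (jostV q₀ Q f z) 0 x = S0 at *
    generalize src _ _ _ (jostV q₀ Q f z) 1 x = S1 at *
    generalize jostV q₀ Q f z x 0 = v0 at *
    generalize jostV q₀ Q f z x 1 = v1 at *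
    rw [← hQQ]
    have : S0 - Complex.I * Q / z * S1 = (f x - Q) * (v1 - Complex.I * conj Q / z * v0) := e0
    -- One source term is eliminated by the intertwining identity; the other then cancels through
    -- the factor `-iQ/z` in the first row of `Y`.
    have e2 : S0 = Complex.I * Q / z * S1 + (f x - Q) * (v1 - Complex.I * conj Q / z * v0) := by
      linear_combination this
    rw [e2]
    field_simp
    ring_nf
    simp only [Complex.I_sq]
    ring
  · have h := (h0.const_mul (eigY Q z 1 0)).add (h1.const_mul (eigY Q z 1 1))
    have e : (fun x => jostU q₀ Q f z x 1) = (fun x => eigY Q z 1 0 * jostV q₀ Q f z x 0) +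
        fun x => eigY Q z 1 1 * jostV q₀ Q f z x 1 := by
      funext y
      simp [jostU, Matrix.mulVec, dotProduct, Fin.sum_univ_two]
    simp only [Fin.mk_one]
    rw [e]
    refine h.congr_deriv ?_
    change _ * (_ * (jostV q₀ Q f z x 0 - _) + src _ _ _ (jostV q₀ Q f z) _ _) +
      _ * (_ * (jostV q₀ Q f z x 1 - _) + src _ _ _ (jostV q₀ Q f z) _ _) = _
    simp only [jostU, eigY, laxX, Matrix.mulVec, dotProduct, Fin.sum_univ_two, Matrix.of_apply,
      Matrix.cons_val_zero, Matrix.cons_val_one, Pi.add_apply, Pi.smul_apply, smul_eq_mul,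
      jostMu, specLam, specK, Pi.single_eq_same, Pi.single_eq_of_ne, ne_eq, one_ne_zero,
      not_false_eq_true, sub_zero, Fin.isValue]
    generalize src _ _ _ (jostV q₀ Q f z) 0 x = S0 at *
    generalize src _ _ _ (jostV q₀ Q f z) 1 x = S1 at *
    generalize jostV q₀ Q f z x 0 = v0 at *
    generalize jostV q₀ Q f z x 1 = v1 at *
    rw [← hQQ]
    have : S1 - Complex.I * conj Q / z * S0 = -conj (f x - Q) * (v0 - Complex.I * Q / z * v1) := e1
    have e2 : S1 = Complex.I * conj Q / z * S0 - conj (f x - Q) * (v0 - Complex.I * Q / z * v1) := by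
      linear_combination this
    rw [e2, map_sub]
    field_simp
    ring_nf
    simp only [Complex.I_sq]
    ring

theorem tendsto_jostU {z : ℂ} (hz : z ∈ DminusCl q₀) (i : Fin 2) :
    Tendsto (fun x => jostU q₀ Q f z x i) atTop (𝓝 (eigY Q z i 0)) := by
  obtain ⟨c, hc⟩ := exists_coeff_bound q₀ Q z
  have h := fun j => tendsto_voltSum (hf.sub continuous_const) (integrableOn_Ioi_of_Ici hf hi) hc
    (jostMu_re hq₀ hz) j
  have h2 := ((h 0).const_mul (eigY Q z i 0)).add ((h 1).const_mul (eigY Q z i 1))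
  simp only [Pi.single_eq_same, mul_one, Pi.single_eq_of_ne, ne_eq, one_ne_zero,
    not_false_eq_true, mul_zero, add_zero] at h2
  refine h2.congr fun x => ?_
  rw [jostU_apply]
  rfl

omit hq₀ hf hi in
theorem differentiableAt_gam {z : ℂ} (hz : z ≠ 0) : DifferentiableAt ℂ (gam q₀) z := by
  unfold gam
  fun_prop (disch := simpa using hz)

omit hf hi in
theorem differentiableAt_jostA {z : ℂ} (hz : z ∈ DminusCl q₀) (j k : Fin 2) :
    DifferentiableAt ℂ (fun z => jostA q₀ Q z j k) z := by
  have hz0 := ne_zero_of_mem_DminusCl hq₀ hz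
  have hg := gam_ne_zero_of_mem_DminusCl hq₀ hz
  have hgd := differentiableAt_gam (q₀ := q₀) hz0
  fin_cases j <;> fin_cases k <;> simp [jostA] <;>
    fun_prop (disch := first | assumption | simpa using hz0)

omit hf hi in
theorem differentiableAt_jostB {z : ℂ} (hz : z ∈ DminusCl q₀) (j k : Fin 2) :
    DifferentiableAt ℂ (fun z => jostB q₀ Q z j k) z := by
  have hz0 := ne_zero_of_mem_DminusCl hq₀ hz
  have hg := gam_ne_zero_of_mem_DminusCl hq₀ hz
  have hgd := differentiableAt_gam (q₀ := q₀) hz0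
  fin_cases j <;> fin_cases k <;> simp [jostB] <;>
    fun_prop (disch := first | assumption | simpa using hz0)

omit hf hi in
theorem differentiableAt_jostMu {z : ℂ} (hz : z ∈ DminusCl q₀) (j : Fin 2) :
    DifferentiableAt ℂ (fun z => jostMu q₀ z j) z := by
  have hz0 := ne_zero_of_mem_DminusCl hq₀ hz
  fin_cases j <;> simp [jostMu, specLam] <;>
    fun_prop (disch := first | assumption | simpa using hz0)

omit hf hi in
-- The coefficients carry `1 / z` and `1 / γ`, which are singular at `0` and at the branch points,
-- so no bound holds on all of `DminusCl`. A local one suffices because continuity and holomorphy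
-- are local.
theorem exists_local_coeff_bound {z : ℂ} (hz : z ∈ DminusCl q₀) : ∃ c, ∃ U, IsOpen U ∧ z ∈ U ∧
    ∀ w ∈ U, ∀ j, ∑ k, (‖jostA q₀ Q w j k‖ + ‖jostB q₀ Q w j k‖) ≤ c := by
  obtain ⟨c, hc⟩ := exists_coeff_bound q₀ Q z
  have : ∀ᶠ w in 𝓝 z, ∀ j, ∑ k, (‖jostA q₀ Q w j k‖ + ‖jostB q₀ Q w j k‖) < c + 1 := by
    rw [eventually_all]
    intro j
    refine ContinuousAt.eventually_lt (f := fun w => ∑ k, (‖jostA q₀ Q w j k‖ + ‖jostB q₀ Q w j k‖))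
      (g := fun _ => c + 1) ?_ continuousAt_const ((hc j).trans_lt (by linarith))
    exact tendsto_finsetSum _ fun k _ =>
      ((differentiableAt_jostA hq₀ hz j k).continuousAt.norm).add
        (differentiableAt_jostB hq₀ hz j k).continuousAt.norm
  obtain ⟨U, hU, hUo, hzU⟩ := eventually_nhds_iff.1 this
  exact ⟨c + 1, U, hUo, hzU, fun w hw j => (hU w hw j).le⟩

omit hf hi in
theorem differentiableAt_eigY {z : ℂ} (hz : z ∈ DminusCl q₀) (i j : Fin 2) :
    DifferentiableAt ℂ (fun z => eigY Q z i j) z := by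
  have hz0 := ne_zero_of_mem_DminusCl hq₀ hz
  fin_cases i <;> fin_cases j <;> simp [eigY] <;>
    fun_prop (disch := first | assumption | simpa using hz0)

theorem continuousOn_jostU (x : ℝ) (i : Fin 2) :
    ContinuousOn (fun z => jostU q₀ Q f z x i) (DminusCl q₀) := by
  intro z hz
  obtain ⟨c, U, hUo, hzU, hU⟩ := exists_local_coeff_bound hq₀ (Q := Q) hz
  have h := fun j => continuousOn_voltSum (S := DminusCl q₀ ∩ U)
    (hf.sub continuous_const) (integrableOn_Ioi_of_Ici hf hi) (fun w hw => hU w hw.2)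
    (fun w hw => jostMu_re hq₀ hw.1)
    (fun j k w hw => (differentiableAt_jostA hq₀ hw.1 j k).continuousAt.continuousWithinAt)
    (fun j k w hw => (differentiableAt_jostB hq₀ hw.1 j k).continuousAt.continuousWithinAt)
    (fun j w hw => (differentiableAt_jostMu hq₀ hw.1 j).continuousAt.continuousWithinAt) x j
  have h' := fun j => (continuousWithinAt_inter (hUo.mem_nhds hzU)).1 (h j z ⟨hz, hzU⟩)
  simp only [jostU_apply]
  exact ((differentiableAt_eigY hq₀ hz i 0).continuousAt.continuousWithinAt.mul (h' 0)).add
    ((differentiableAt_eigY hq₀ hz i 1).continuousAt.continuousWithinAt.mul (h' 1))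

theorem differentiableOn_jostU (x : ℝ) (i : Fin 2) :
    DifferentiableOn ℂ (fun z => jostU q₀ Q f z x i) (Dminus q₀) := by
  intro z hz'
  have hz : z ∈ DminusCl q₀ := Or.inl hz'
  obtain ⟨c, U, hUo, hzU, hU⟩ := exists_local_coeff_bound hq₀ (Q := Q) hz
  have hS : IsOpen (Dminus q₀ ∩ U) := (isOpen_Dminus q₀).inter hUo
  have h := fun j => differentiableOn_voltSum (S := Dminus q₀ ∩ U)
    (hf.sub continuous_const) (integrableOn_Ioi_of_Ici hf hi) (fun w hw => hU w hw.2)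
    (fun w hw => jostMu_re hq₀ (Or.inl hw.1)) hS
    (fun j k w hw => (differentiableAt_jostA hq₀ (Or.inl hw.1) j k).differentiableWithinAt)
    (fun j k w hw => (differentiableAt_jostB hq₀ (Or.inl hw.1) j k).differentiableWithinAt)
    (fun j w hw => (differentiableAt_jostMu hq₀ (Or.inl hw.1) j).differentiableWithinAt) x j
  have h' := fun j => (h j).differentiableAt (hS.mem_nhds ⟨hz', hzU⟩)
  simp only [jostU_apply]
  exact (((differentiableAt_eigY hq₀ hz i 0).mul (h' 0)).add
    ((differentiableAt_eigY hq₀ hz i 1).mul (h' 1))).differentiableWithinAt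

omit hq₀ hf hi in
theorem tendsto_inv_cobounded_complex : Tendsto (fun z : ℂ => z⁻¹) (Bornology.cobounded ℂ) (𝓝 0) := by
  rw [tendsto_zero_iff_norm_tendsto_zero]
  simp only [norm_inv]
  exact tendsto_inv_atTop_zero.comp tendsto_norm_cobounded_atTop

omit hq₀ hf hi in
theorem tendsto_gam (q₀ : ℝ) : Tendsto (gam q₀) (Bornology.cobounded ℂ) (𝓝 1) := by
  have h := ((tendsto_inv_cobounded_complex.pow 2).const_mul ((q₀ : ℂ) ^ 2)).const_add 1
  simp only [ne_eq, OfNat.ofNat_ne_zero, not_false_eq_true, zero_pow, mul_zero, add_zero] at h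
  refine h.congr fun z => ?_
  rw [gam, inv_pow, div_eq_mul_inv]

/-- As `z → ∞` the coefficient matrices tend to the off-diagonal potential. Starting from `e₁`, the
component with exponent `0` has vanishing coefficients, and the other one, whose coefficient tends
to `-1`, dies by Riemann–Lebesgue since `‖2iλ‖ → ∞`. Finally `Y → 1`. -/
theorem tendsto_jostU_param (x : ℝ) (i : Fin 2) :
    Tendsto (fun z => jostU q₀ Q f z x i) (Bornology.cobounded ℂ ⊓ 𝓟 (DminusCl q₀))
      (𝓝 ((Pi.single 0 1 : Fin 2 → ℂ) i)) := by
  set l : Filter ℂ := Bornology.cobounded ℂ ⊓ 𝓟 (DminusCl q₀) with hl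
  have hlc : l.IsCountablyGenerated := by
    rw [hl, ← comap_norm_atTop]
    infer_instance
  have hinv : Tendsto (fun z : ℂ => z⁻¹) l (𝓝 0) := tendsto_inv_cobounded_complex.mono_left inf_le_left
  have hgam : Tendsto (fun z => (gam q₀ z)⁻¹) l (𝓝 1) := by
    simpa using Tendsto.inv₀ (l := l) ((tendsto_gam q₀).mono_left inf_le_left) one_ne_zero
  have hA : ∀ j k, Tendsto (fun z => jostA q₀ Q z j k) l
      (𝓝 ((![![0, 1], ![0, 0]] : Fin 2 → Fin 2 → ℂ) j k)) := by
    intro j k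
    fin_cases j <;> fin_cases k
    · simpa [jostA, div_eq_mul_inv] using ((hinv.const_mul (Complex.I * conj Q)).neg).mul hgam
    · simpa [jostA, div_eq_mul_inv] using hgam
    · simpa [jostA, div_eq_mul_inv] using (((hinv.pow 2).const_mul (conj Q ^ 2))).mul hgam
    · simpa [jostA, div_eq_mul_inv] using ((hinv.const_mul (Complex.I * conj Q))).mul hgam
  have hB : ∀ j k, Tendsto (fun z => jostB q₀ Q z j k) l
      (𝓝 ((![![0, 0], ![-1, 0]] : Fin 2 → Fin 2 → ℂ) j k)) := by
    intro j k
    fin_cases j <;> fin_cases k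
    · simpa [jostB, div_eq_mul_inv] using ((hinv.const_mul (Complex.I * Q)).neg).mul hgam
    · simpa [jostB, div_eq_mul_inv] using (((hinv.pow 2).const_mul (Q ^ 2)).neg).mul hgam
    · simpa [jostB, div_eq_mul_inv] using hgam.neg
    · simpa [jostB, div_eq_mul_inv] using ((hinv.const_mul (Complex.I * Q))).mul hgam
  have hd : Continuous fun x => f x - Q := hf.sub continuous_const
  have hdi := integrableOn_Ioi_of_Ici hf hi
  have hdc : Continuous fun x => conj (f x - Q) := by fun_prop
  have hdci : ∀ x, IntegrableOn (fun x => conj (f x - Q)) (Ioi x) := fun x =>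
    Integrable.congr' (hdi x) hdc.aestronglyMeasurable
      (ae_of_all _ fun y => (RCLike.norm_conj _).symm)
  have hmem : ∀ᶠ z in l, z ∈ DminusCl q₀ := mem_inf_of_right (mem_principal_self _)
  -- In the limit each row has total coefficient norm `1`, so `2` is an eventual common bound.
  have hS : ∀ᶠ z in l, z ∈ {z | z ∈ DminusCl q₀ ∧
      ∀ j, ∑ k, (‖jostA q₀ Q z j k‖ + ‖jostB q₀ Q z j k‖) ≤ 2} := by
    refine hmem.and (eventually_all.2 fun j => ?_)
    have h := tendsto_finsetSum (Finset.univ : Finset (Fin 2))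
      fun k _ => (hA j k).norm.add (hB j k).norm
    refine (h.eventually_lt_const (u := 2) ?_).mono fun z hz => hz.le
    fin_cases j <;> norm_num [Fin.sum_univ_two]
  have hlam : Tendsto (fun z => ‖jostMu q₀ z 1‖) l atTop := by
    have h1 : Tendsto (fun z : ℂ => ‖z‖ - q₀ ^ 2 * ‖z⁻¹‖) l atTop := by
      have := (tendsto_norm_cobounded_atTop (E := ℂ)).mono_left
        (inf_le_left (b := 𝓟 (DminusCl q₀)))
      have h2 := (hinv.norm.const_mul (q₀ ^ 2)).neg
      simpa [sub_eq_add_neg] using this.atTop_add h2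
    refine tendsto_atTop_mono (fun z => ?_) h1
    have : ‖jostMu q₀ z 1‖ = ‖z - -((q₀ : ℂ) ^ 2 * z⁻¹)‖ := by
      have : jostMu q₀ z 1 = Complex.I * (z - -((q₀ : ℂ) ^ 2 * z⁻¹)) := by
        simp only [jostMu, specLam, Matrix.cons_val_one, Matrix.cons_val_fin_one]
        ring
      rw [this, norm_mul, Complex.norm_I, one_mul]
    rw [this]
    refine le_trans (le_of_eq ?_) (norm_sub_norm_le _ _)
    simp
  have h1 : ∀ x j, Tendsto (fun z => volt (fun x => f x - Q) (jostA q₀ Q z) (jostB q₀ Q z)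
      (jostMu q₀ z) 1 x j) l (𝓝 0) := by
    intro x j
    have he : ∀ᶠ z in l, -(jostA q₀ Q z j 0 * expTail (jostMu q₀ z j) (fun x => f x - Q) x +
        jostB q₀ Q z j 0 * expTail (jostMu q₀ z j) (fun x => conj (f x - Q)) x) =
        volt (fun x => f x - Q) (jostA q₀ Q z) (jostB q₀ Q z) (jostMu q₀ z) 1 x j := by
      filter_upwards [hmem] with z hz
      rw [volt, voltStep]
      congr 1
      unfold expTail
      rw [← integral_const_mul, ← integral_const_mul, ← integral_add
        ((integrableOn_exp_mul (jostMu_re hq₀ hz j) (hdi x)).const_mul _)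
        ((integrableOn_exp_mul (jostMu_re hq₀ hz j) (hdci x)).const_mul _)]
      congr 1
      funext y
      simp only [src, volt, Fin.sum_univ_two, Pi.single_eq_same, Pi.single_eq_of_ne, ne_eq,
        one_ne_zero, not_false_eq_true, mul_zero, add_zero, mul_one]
      ring
    refine Tendsto.congr' he ?_
    fin_cases j
    -- There is no oscillation in this component; the limits of `jostA` and `jostB` at entry `(0,
    -- 0)` are both `0`.
    · have := (((hA 0 0).mul_const (expTail 0 (fun x => f x - Q) x)).add
        ((hB 0 0).mul_const (expTail 0 (fun x => conj (f x - Q)) x))).neg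
      simpa [jostMu] using this
    · have hre : ∀ᶠ z in l, 0 ≤ (jostMu q₀ z 1).re := hmem.mono fun z hz => jostMu_re hq₀ hz 1
      have := (((hA 1 0).mul (tendsto_expTail_zero hd hdi hre hlam x)).add
        ((hB 1 0).mul (tendsto_expTail_zero hdc hdci hre hlam x))).neg
      simpa using this
  have hlim := fun j => tendsto_voltSum_param hd hdi (S := {z | z ∈ DminusCl q₀ ∧
      ∀ j, ∑ k, (‖jostA q₀ Q z j k‖ + ‖jostB q₀ Q z j k‖) ≤ 2}) (fun z hz => hz.2)
      (fun z hz => jostMu_re hq₀ hz.1) hS hA hB h1 x j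
  have hY : ∀ i j, Tendsto (fun z => eigY Q z i j) l (𝓝 ((1 : Matrix (Fin 2) (Fin 2) ℂ) i j)) := by
    intro i j
    fin_cases i <;> fin_cases j
    · simpa [eigY] using tendsto_const_nhds
    · simpa [eigY, div_eq_mul_inv] using (hinv.const_mul (Complex.I * Q)).neg
    · simpa [eigY, div_eq_mul_inv] using (hinv.const_mul (Complex.I * conj Q)).neg
    · simpa [eigY] using tendsto_const_nhds
  have hfin := ((hY i 0).mul (hlim 0)).add ((hY i 1).mul (hlim 1))
  simp only [jostU_apply]
  have e : ∀ i, (Pi.single 0 1 : Fin 2 → ℂ) i = (1 : Matrix (Fin 2) (Fin 2) ℂ) i 0 *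
      (Pi.single 0 1 : Fin 2 → ℂ) 0 + (1 : Matrix (Fin 2) (Fin 2) ℂ) i 1 *
      (Pi.single 0 1 : Fin 2 → ℂ) 1 := by
    rw [Fin.forall_fin_two]
    constructor <;> simp
  rw [e]
  exact hfin

end

end KunduEckhaus

end

noncomputable section

namespace KunduEckhaus

open Set

/-! ### Linear systems: Wronskians and uniqueness -/

/-- `ψ` solves `ψ' = X ψ`. -/
def IsLaxSol (k : ℂ) (f : ℝ → ℂ) (ψ : ℝ → Fin 2 → ℂ) : Prop :=
  ∀ x, HasDerivAt ψ ((laxX k (f x)).mulVec (ψ x)) x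

theorem laxX_mulVec_zero (k q : ℂ) (v : Fin 2 → ℂ) :
    (laxX k q).mulVec v 0 = -(Complex.I * k) * v 0 + q * v 1 := by
  simp [laxX, Matrix.mulVec, dotProduct, Fin.sum_univ_two]

theorem laxX_mulVec_one (k q : ℂ) (v : Fin 2 → ℂ) :
    (laxX k q).mulVec v 1 = -conj q * v 0 + Complex.I * k * v 1 := by
  simp [laxX, Matrix.mulVec, dotProduct, Fin.sum_univ_two]

theorem isLaxSol_iff {k : ℂ} {f : ℝ → ℂ} {ψ : ℝ → Fin 2 → ℂ} : IsLaxSol k f ψ ↔ ∀ x,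
    HasDerivAt (fun x => ψ x 0) (-(Complex.I * k) * ψ x 0 + f x * ψ x 1) x ∧
    HasDerivAt (fun x => ψ x 1) (-conj (f x) * ψ x 0 + Complex.I * k * ψ x 1) x := by
  refine forall_congr' fun x => ?_
  rw [hasDerivAt_pi, Fin.forall_fin_two, laxX_mulVec_zero, laxX_mulVec_one]

theorem IsLaxSol.const_smul {k : ℂ} {f : ℝ → ℂ} {ψ : ℝ → Fin 2 → ℂ} (h : IsLaxSol k f ψ) (c : ℂ) :
    IsLaxSol k f fun x => c • ψ x := fun x => by
  rw [Matrix.mulVec_smul]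
  exact (h x).const_smul c

theorem IsLaxSol.wr_const {k : ℂ} {f : ℝ → ℂ} {ψ φ : ℝ → Fin 2 → ℂ} (h : IsLaxSol k f ψ)
    (h' : IsLaxSol k f φ) (x y : ℝ) : wr (ψ x) (φ x) = wr (ψ y) (φ y) := by
  rw [isLaxSol_iff] at h h'
  have hd : ∀ x, HasDerivAt (fun x => wr (ψ x) (φ x)) 0 x := fun x =>
    (((h x).1.mul (h' x).2).sub ((h x).2.mul (h' x).1)).congr_deriv (by ring)
  exact is_const_of_deriv_eq_zero (fun x => (hd x).differentiableAt) (fun x => (hd x).deriv) x y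

theorem IsLaxSol.eq_of_eq {k : ℂ} {f : ℝ → ℂ} (hf : Continuous f) {ψ φ : ℝ → Fin 2 → ℂ}
    (h : IsLaxSol k f ψ) (h' : IsLaxSol k f φ) {x₀ : ℝ} (h0 : ψ x₀ = φ x₀) : ψ = φ := by
  funext x
  set a := min x x₀ - 1
  set b := max x x₀ + 1
  obtain ⟨C, hC⟩ := (isCompact_Icc (a := a) (b := b)).exists_bound_of_continuousOn hf.continuousOn
  have hx₀ : x₀ ∈ Ioo a b := ⟨by linarith [min_le_right x x₀], by linarith [le_max_right x x₀]⟩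
  have hx : x ∈ Ioo a b := ⟨by linarith [min_le_left x x₀], by linarith [le_max_left x x₀]⟩
  have hC0 : 0 ≤ C := (norm_nonneg _).trans (hC x (Ioo_subset_Icc_self hx))
  refine ODE_solution_unique_of_mem_Ioo (v := fun x v => (laxX k (f x)).mulVec v)
    (s := fun _ => univ) (K := ⟨‖k‖ + C, by positivity⟩) ?_ hx₀
    (fun t _ => ⟨h t, mem_univ _⟩) (fun t _ => ⟨h' t, mem_univ _⟩) h0 hx
  intro y hy
  have hy' := hC y (Ioo_subset_Icc_self hy)
  refine (LipschitzWith.of_dist_le_mul fun v w => ?_).lipschitzOnWith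
  rw [dist_eq_norm, dist_eq_norm, ← Matrix.mulVec_sub]
  change _ ≤ (‖k‖ + C) * _
  rw [pi_norm_le_iff_of_nonneg (by positivity), Fin.forall_fin_two]
  rw [laxX_mulVec_zero, laxX_mulVec_one]
  have e0 := norm_le_pi_norm (v - w) 0
  have e1 := norm_le_pi_norm (v - w) 1
  constructor
  · refine (norm_add_le _ _).trans ?_
    rw [norm_mul, norm_mul, norm_neg, norm_mul, Complex.norm_I, one_mul, add_mul]
    gcongr
  · refine (norm_add_le _ _).trans ?_
    rw [norm_mul, norm_mul, norm_neg, norm_mul, Complex.norm_I, one_mul, add_mul, RCLike.norm_conj,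
      add_comm]
    gcongr

/-! ### Jost functions -/

theorem isJost_iff {q₀ : ℝ} {Q : ℂ} {q : ℝ → ℝ → ℂ} {t : ℝ} {l : Filter ℝ} {j : Fin 2} {z : ℂ}
    {ψ : ℝ → Fin 2 → ℂ} : IsJost q₀ Q q t l j z ψ ↔ IsLaxSol (specK q₀ z) (fun x => q x t) ψ ∧
      ∀ i, Tendsto (fun x : ℝ => Complex.exp (Complex.I * phase q₀ x t z * sgn3 j) * ψ x i) l
        (𝓝 (eigY Q z i j)) := by
  constructor
  · rintro ⟨h1, h2⟩
    exact ⟨h1, fun i => (tendsto_pi_nhds.1 h2) i⟩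
  · rintro ⟨h1, h2⟩
    exact ⟨h1, tendsto_pi_nhds.2 h2⟩

theorem sgn3_zero : sgn3 0 = 1 := rfl

theorem sgn3_one : sgn3 1 = -1 := rfl

theorem eigY_zero_zero (Q z : ℂ) : eigY Q z 0 0 = 1 := rfl

theorem eigY_one_one (Q z : ℂ) : eigY Q z 1 1 = 1 := rfl

theorem eigY_zero_one (Q z : ℂ) : eigY Q z 0 1 = -(Complex.I * Q / z) := rfl

theorem eigY_one_zero (Q z : ℂ) : eigY Q z 1 0 = -(Complex.I * conj Q / z) := rfl

theorem isJost_jostU {q₀ : ℝ} (hq₀ : 0 < q₀) {Q : ℂ} (hQ : ‖Q‖ = q₀) {q : ℝ → ℝ → ℂ} {t : ℝ}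
    (hf : Continuous fun x => q x t) (hi : IntegrableOn (fun x => q x t - Q) (Ici 0)) {z : ℂ}
    (hz : z ∈ DminusCl q₀) : IsJost q₀ Q q t atTop 0 z
      fun x => Complex.exp (-(Complex.I * phase q₀ x t z)) • jostU q₀ Q (fun x => q x t) z x := by
  rw [isJost_iff]
  constructor
  · intro x
    have h := hasDerivAt_jostU hq₀ hf hi hQ hz x
    have h1 : HasDerivAt (fun x : ℝ => phase q₀ x t z) (specLam q₀ z) x := by
      have := ((hasDerivAt_id x).ofReal_comp.add_const (specK q₀ z * t)).const_mul (specLam q₀ z)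
      simpa [phase] using this
    have h2 := ((h1.const_mul Complex.I).neg).cexp
    refine (h2.smul h).congr_deriv ?_
    rw [smul_add, Matrix.mulVec_smul, smul_smul, add_assoc, ← add_smul]
    simp only [Pi.neg_apply]
    have e : Complex.exp (-(Complex.I * phase q₀ x t z)) * (Complex.I * specLam q₀ z) +
      Complex.exp (-(Complex.I * phase q₀ x t z)) * -(Complex.I * specLam q₀ z) = 0 := by ring
    rw [e, zero_smul, add_zero]
  · intro i
    refine (tendsto_jostU hq₀ hf hi hz i).congr fun x => ?_
    rw [Pi.smul_apply, smul_eq_mul, ← mul_assoc, ← Complex.exp_add, sgn3_zero]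
    simp

theorem phase_im {q₀ x t : ℝ} {z : ℂ} :
    (phase q₀ x t z).im = (specLam q₀ z).im * x + (specLam q₀ z * specK q₀ z * t).im := by
  rw [phase, mul_add, ← mul_assoc, Complex.add_im, Complex.im_mul_ofReal]

/-- The constant Wronskian of two candidates equals `e^{-2iθ}` times a quantity tending to `0`, as
both columns have the same limit. For `Im λ ≤ 0` that factor is bounded as `x → +∞`, so the
Wronskian vanishes and the candidates are proportional; the entry `1` of `Y` forces the constant to
be `1`. This is what makes the `epsilon` in `jost` computable. -/
theorem IsJost.unique {q₀ : ℝ} (hq₀ : 0 < q₀) {Q : ℂ} {q : ℝ → ℝ → ℂ} {t : ℝ}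
    (hf : Continuous fun x => q x t) {z : ℂ} (hz : z ∈ DminusCl q₀) {ψ φ : ℝ → Fin 2 → ℂ}
    (h : IsJost q₀ Q q t atTop 0 z ψ) (h' : IsJost q₀ Q q t atTop 0 z φ) : ψ = φ := by
  rw [isJost_iff] at h h'
  obtain ⟨h1, h2⟩ := h
  obtain ⟨h1', h2'⟩ := h'
  simp only [sgn3_zero, mul_one] at h2 h2'
  have hlam := specLam_im_nonpos hq₀ hz
  have hW : ∀ x, wr (ψ x) (φ x) = 0 := by
    intro y
    have hlim := ((h2 0).mul (h2' 1)).sub ((h2 1).mul (h2' 0))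
    rw [mul_comm (eigY Q z 1 0), sub_self] at hlim
    have hb : ∀ᶠ x : ℝ in atTop, ‖Complex.exp (-(2 * Complex.I * phase q₀ x t z))‖ ≤
        Real.exp (2 * (specLam q₀ z * specK q₀ z * t).im) := by
      filter_upwards [eventually_ge_atTop 0] with x hx
      rw [Complex.norm_exp]
      gcongr
      have : (-(2 * Complex.I * phase q₀ x t z)).re = 2 * (phase q₀ x t z).im := by simp
      rw [this, phase_im]
      nlinarith
    have h0 := hlim.zero_mul_isBoundedUnder_le (isBoundedUnder_of_eventually_le hb)
    refine tendsto_nhds_unique (tendsto_const_nhds.congr fun x => ?_) h0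
    · rw [h1.wr_const h1' y x, wr]
      have e : Complex.exp (-(2 * Complex.I * phase q₀ x t z)) *
        (Complex.exp (Complex.I * phase q₀ x t z) * Complex.exp (Complex.I * phase q₀ x t z)) = 1 := by
        rw [← Complex.exp_add, ← Complex.exp_add, Complex.exp_eq_one_iff]
        exact ⟨0, by push_cast; ring⟩
      linear_combination (-(ψ x 0 * φ x 1 - ψ x 1 * φ x 0)) * e
  have hne : ∀ᶠ x : ℝ in atTop, Complex.exp (Complex.I * phase q₀ x t z) * ψ x 0 ≠ 0 :=
    (h2 0).eventually_ne (by simp [eigY])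
  obtain ⟨x₁, hx₁⟩ := hne.exists
  have hψ : ψ x₁ 0 ≠ 0 := right_ne_zero_of_mul hx₁
  set c := φ x₁ 0 / ψ x₁ 0 with hc
  have hφ : φ = fun x => c • ψ x := by
    refine h1'.eq_of_eq hf (h1.const_smul c) (x₀ := x₁) ?_
    have := hW x₁
    rw [wr] at this
    funext i
    rw [Pi.smul_apply, smul_eq_mul, hc]
    fin_cases i
    · simp only [Fin.zero_eta]
      field_simp
    · simp only [Fin.mk_one]
      field_simp
      linear_combination this
  have hc1 : c = 1 := by
    have e := (h2 0).const_mul c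
    rw [eigY_zero_zero, mul_one] at e
    refine tendsto_nhds_unique e ((h2' 0).congr fun x => ?_)
    rw [hφ]
    simp only [Pi.smul_apply, smul_eq_mul]
    ring
  rw [hφ, hc1]
  simp

/-! ### Symmetries -/

theorem conj_specK (q₀ : ℝ) (z : ℂ) : conj (specK q₀ z) = specK q₀ (conj z) := by
  simp [specK, map_ofNat]

theorem conj_specLam (q₀ : ℝ) (z : ℂ) : conj (specLam q₀ z) = specLam q₀ (conj z) := by
  simp [specLam, map_ofNat]

theorem conj_phase (q₀ x t : ℝ) (z : ℂ) : conj (phase q₀ x t z) = phase q₀ x t (conj z) := by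
  simp [phase, conj_specK, conj_specLam]

theorem conj_gam (q₀ : ℝ) (z : ℂ) : conj (gam q₀ z) = gam q₀ (conj z) := by
  simp [gam]

/-- `X(k)` is anti-Hermitian for real `k` and traceless, so conjugation followed by the rotation
`(a, b) ↦ (-b, a)` sends solutions for `k` to solutions for `conj k`. At the level of Jost functions
it exchanges the two columns. -/
theorem IsLaxSol.conj {k : ℂ} {f : ℝ → ℂ} {ψ : ℝ → Fin 2 → ℂ} (h : IsLaxSol k f ψ) :
    IsLaxSol (conj k) f fun x => ![-conj (ψ x 1), conj (ψ x 0)] := by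
  rw [isLaxSol_iff] at h ⊢
  intro x
  constructor
  · refine ((h x).2.star.neg).congr_deriv ?_
    simp only [Complex.star_def, map_add, map_mul, map_neg, Complex.conj_I, Complex.conj_conj,
      Matrix.cons_val_zero, Matrix.cons_val_one]
    ring
  · refine ((h x).1.star).congr_deriv ?_
    simp only [Complex.star_def, map_add, map_mul, map_neg, Complex.conj_I,
      Matrix.cons_val_zero, Matrix.cons_val_one]
    ring

section

variable {q₀ : ℝ} {Q : ℂ} {q : ℝ → ℝ → ℂ} {t : ℝ} {l : Filter ℝ} {z : ℂ} {ψ φ : ℝ → Fin 2 → ℂ}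

theorem IsJost.conj_zero (h : IsJost q₀ Q q t l 0 z ψ) :
    IsJost q₀ Q q t l 1 (conj z) fun x => ![-conj (ψ x 1), conj (ψ x 0)] := by
  rw [isJost_iff] at h ⊢
  refine ⟨conj_specK q₀ z ▸ h.1.conj, ?_⟩
  have e : ∀ x : ℝ, Complex.exp (Complex.I * phase q₀ x t (conj z) * sgn3 1) =
      conj (Complex.exp (Complex.I * phase q₀ x t z * sgn3 0)) := fun x => by
    rw [← Complex.exp_conj, sgn3_zero, sgn3_one]
    simp [conj_phase]
  rw [Fin.forall_fin_two]
  constructor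
  · convert (h.2 1).star.neg using 2
    · rw [e]
      simp
    · simp [eigY, neg_div]
  · convert (h.2 0).star using 2
    · rw [e]
      simp
    · simp [eigY]

theorem IsJost.conj_one (h : IsJost q₀ Q q t l 1 z ψ) :
    IsJost q₀ Q q t l 0 (conj z) fun x => ![conj (ψ x 1), -conj (ψ x 0)] := by
  rw [isJost_iff] at h ⊢
  have e : ∀ x : ℝ, Complex.exp (Complex.I * phase q₀ x t (conj z) * sgn3 0) =
      conj (Complex.exp (Complex.I * phase q₀ x t z * sgn3 1)) := fun x => by
    rw [← Complex.exp_conj, sgn3_zero, sgn3_one]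
    simp [conj_phase]
  constructor
  · have := (conj_specK q₀ z ▸ h.1.conj).const_smul (-1)
    convert this using 2 with x
    funext i
    fin_cases i <;> simp
  rw [Fin.forall_fin_two]
  constructor
  · convert (h.2 1).star using 2
    · rw [e]
      simp
    · simp [eigY]
  · convert (h.2 0).star.neg using 2
    · rw [e]
      simp
    · simp [eigY, neg_div]

theorem specK_inv (hq₀ : q₀ ≠ 0) (hz : z ≠ 0) : specK q₀ (-((q₀ : ℂ) ^ 2 / z)) = specK q₀ z := by
  have : (q₀ : ℂ) ≠ 0 := by exact_mod_cast hq₀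
  rw [specK, specK]
  field_simp
  ring

theorem specLam_inv (hq₀ : q₀ ≠ 0) (hz : z ≠ 0) :
    specLam q₀ (-((q₀ : ℂ) ^ 2 / z)) = -specLam q₀ z := by
  have : (q₀ : ℂ) ≠ 0 := by exact_mod_cast hq₀
  rw [specLam, specLam]
  field_simp
  ring

theorem phase_inv (hq₀ : q₀ ≠ 0) (hz : z ≠ 0) (x t : ℝ) :
    phase q₀ x t (-((q₀ : ℂ) ^ 2 / z)) = -phase q₀ x t z := by
  rw [phase, phase, specK_inv hq₀ hz, specLam_inv hq₀ hz]
  ring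

theorem gam_inv (hq₀ : q₀ ≠ 0) (hz : z ≠ 0) :
    gam q₀ (-((q₀ : ℂ) ^ 2 / z)) = z ^ 2 / (q₀ : ℂ) ^ 2 * gam q₀ z := by
  have : (q₀ : ℂ) ≠ 0 := by exact_mod_cast hq₀
  rw [gam, gam]
  field_simp
  ring

/-- Under `z ↦ -q₀²/z` the parameter `k` is invariant while `λ` and `θ` change sign, so the same
solution has the asymptotics of the other column. The factor is read off by comparing the
corresponding columns of `Y`, using `Q Q* = q₀²`. -/
theorem IsJost.inv_one (hq₀ : 0 < q₀) (hQ : ‖Q‖ = q₀) (hz : z ≠ 0) (h : IsJost q₀ Q q t l 1 z ψ) :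
    IsJost q₀ Q q t l 0 (-((q₀ : ℂ) ^ 2 / z))
      fun x => (Complex.I * conj Q * z / (q₀ : ℂ) ^ 2) • ψ x := by
  have hQQ := conj_mul_of_norm_eq hQ
  have hq' : (q₀ : ℂ) ≠ 0 := by exact_mod_cast hq₀.ne'
  rw [isJost_iff] at h ⊢
  refine ⟨by rw [specK_inv hq₀.ne' hz]; exact h.1.const_smul _, fun i => ?_⟩
  have h2 := (h.2 i).const_mul (Complex.I * conj Q * z / (q₀ : ℂ) ^ 2)
  simp only [phase_inv hq₀.ne' hz, sgn3_zero, sgn3_one, Pi.smul_apply, smul_eq_mul] at h2 ⊢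
  convert h2 using 2
  · simp only [mul_neg, mul_one]
    ring
  · fin_cases i
    · simp only [Fin.zero_eta, eigY_zero_zero, eigY_zero_one]
      field_simp
      linear_combination ((q₀ : ℂ) ^ 2) * Complex.I_sq + Complex.I ^ 2 * hQQ
    · simp only [Fin.mk_one, eigY_one_zero, eigY_one_one]
      field_simp

theorem IsJost.inv_zero (hq₀ : 0 < q₀) (hQ : ‖Q‖ = q₀) (hz : z ≠ 0) (h : IsJost q₀ Q q t l 0 z ψ) :
    IsJost q₀ Q q t l 1 (-((q₀ : ℂ) ^ 2 / z))
      fun x => (Complex.I * Q * z / (q₀ : ℂ) ^ 2) • ψ x := by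
  have hQQ := conj_mul_of_norm_eq hQ
  have hq' : (q₀ : ℂ) ≠ 0 := by exact_mod_cast hq₀.ne'
  rw [isJost_iff] at h ⊢
  refine ⟨by rw [specK_inv hq₀.ne' hz]; exact h.1.const_smul _, fun i => ?_⟩
  have h2 := (h.2 i).const_mul (Complex.I * Q * z / (q₀ : ℂ) ^ 2)
  simp only [phase_inv hq₀.ne' hz, sgn3_zero, sgn3_one, Pi.smul_apply, smul_eq_mul] at h2 ⊢
  convert h2 using 2
  · simp only [mul_neg, mul_one, neg_neg]
    ring
  · fin_cases i
    · simp only [Fin.zero_eta, eigY_zero_zero, eigY_zero_one]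
      field_simp
    · simp only [Fin.mk_one, eigY_one_zero, eigY_one_one]
      field_simp
      linear_combination ((q₀ : ℂ) ^ 2) * Complex.I_sq + Complex.I ^ 2 * hQQ

/-- The potential `q^*(-x,-t)`. -/
def reflect (q : ℝ → ℝ → ℂ) (x t : ℝ) : ℂ := conj (q (-x) (-t))

/-- The map `ψ ↦ σ₁ ψ(-x)`. -/
def swapRefl (ψ : ℝ → Fin 2 → ℂ) (x : ℝ) : Fin 2 → ℂ := ![ψ (-x) 1, ψ (-x) 0]

theorem swapRefl_swapRefl (ψ : ℝ → Fin 2 → ℂ) : swapRefl (swapRefl ψ) = ψ := by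
  funext x i
  fin_cases i <;> simp [swapRefl]

theorem reflect_reflect (q : ℝ → ℝ → ℂ) : reflect (reflect q) = q := by
  funext x t
  simp [reflect]

theorem IsLaxSol.swapRefl {k : ℂ} {f : ℝ → ℂ} (h : IsLaxSol k f ψ) :
    IsLaxSol k (fun x => conj (f (-x))) (swapRefl ψ) := by
  rw [isLaxSol_iff] at h ⊢
  intro x
  have hn := (hasDerivAt_id x).neg
  constructor
  · refine ((h (-x)).2.scomp x hn).congr_deriv ?_
    simp only [KunduEckhaus.swapRefl, Matrix.cons_val_zero, Matrix.cons_val_one,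
      Complex.real_smul]
    push_cast
    ring
  · refine ((h (-x)).1.scomp x hn).congr_deriv ?_
    simp only [KunduEckhaus.swapRefl, Matrix.cons_val_zero, Matrix.cons_val_one,
      Complex.real_smul, Complex.conj_conj]
    push_cast
    ring

theorem phase_neg_neg (q₀ x t : ℝ) (z : ℂ) : phase q₀ (-x) (-t) z = -phase q₀ x t z := by
  rw [phase, phase]
  push_cast
  ring

/-- This symmetry reduces the construction at `-∞` to the one at `+∞`. Time is reversed together
with space because `θ(-x, -t) = -θ(x, t)`; that sign turns the first column into the second without
changing `z`. -/
theorem IsJost.swapRefl_zero {l' : Filter ℝ} (hl : Tendsto (fun x : ℝ => -x) l' l)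
    (h : IsJost q₀ Q q t l 0 z ψ) :
    IsJost q₀ (conj Q) (reflect q) (-t) l' 1 z (swapRefl ψ) := by
  rw [isJost_iff] at h ⊢
  refine ⟨by simpa [reflect] using h.1.swapRefl, ?_⟩
  have e : ∀ x : ℝ, Complex.exp (Complex.I * phase q₀ x (-t) z * sgn3 1) =
      Complex.exp (Complex.I * phase q₀ (-x) t z * sgn3 0) := fun x => by
    rw [← neg_neg x, phase_neg_neg, sgn3_zero, sgn3_one]
    simp
  rw [Fin.forall_fin_two]
  constructor
  · convert (h.2 1).comp hl using 2
    · simp [e, swapRefl]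
    · simp [eigY]
  · convert (h.2 0).comp hl using 2
    · simp [e, swapRefl]
    · rfl

theorem IsJost.swapRefl_one {l' : Filter ℝ} (hl : Tendsto (fun x : ℝ => -x) l' l)
    (h : IsJost q₀ Q q t l 1 z ψ) :
    IsJost q₀ (conj Q) (reflect q) (-t) l' 0 z (swapRefl ψ) := by
  rw [isJost_iff] at h ⊢
  refine ⟨by simpa [reflect] using h.1.swapRefl, ?_⟩
  have e : ∀ x : ℝ, Complex.exp (Complex.I * phase q₀ x (-t) z * sgn3 0) =
      Complex.exp (Complex.I * phase q₀ (-x) t z * sgn3 1) := fun x => by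
    rw [← neg_neg x, phase_neg_neg, sgn3_zero, sgn3_one]
    simp
  rw [Fin.forall_fin_two]
  constructor
  · convert (h.2 1).comp hl using 2
    · simp [e, swapRefl]
    · rfl
  · convert (h.2 0).comp hl using 2
    · simp [e, swapRefl]
    · simp [eigY]

theorem IsJost.wr_eq_gam [l.NeBot] (hQ : ‖Q‖ = q₀) (h : IsJost q₀ Q q t l 0 z ψ)
    (h' : IsJost q₀ Q q t l 1 z φ) (x : ℝ) : wr (ψ x) (φ x) = gam q₀ z := by
  have hQQ := conj_mul_of_norm_eq hQ
  rw [isJost_iff] at h h'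
  have hlim := ((h.2 0).mul (h'.2 1)).sub ((h.2 1).mul (h'.2 0))
  have hg : eigY Q z 0 0 * eigY Q z 1 1 - eigY Q z 1 0 * eigY Q z 0 1 = gam q₀ z := by
    rw [eigY_zero_zero, eigY_one_one, eigY_one_zero, eigY_zero_one, gam, ← hQQ]
    linear_combination (-(Q * conj Q / z ^ 2)) * Complex.I_sq
  rw [hg] at hlim
  refine tendsto_nhds_unique (tendsto_const_nhds.congr fun y => ?_) hlim
  rw [h.1.wr_const h'.1 x y, wr, sgn3_zero, sgn3_one]
  have e : Complex.exp (Complex.I * phase q₀ y t z * 1) *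
      Complex.exp (Complex.I * phase q₀ y t z * -1) = 1 := by
    rw [← Complex.exp_add]
    simp
  linear_combination (-(ψ y 0 * φ y 1 - ψ y 1 * φ y 0)) * e

end

end KunduEckhaus

end

noncomputable section

namespace KunduEckhaus

open Set

/-! ### Geometry of the spectral domain -/

theorem conj_mem_Sigma0 {q₀ : ℝ} {z : ℂ} (hz : z ∈ Sigma0 q₀) : conj z ∈ Sigma0 q₀ := by
  obtain ⟨h1, h2, h3, h4⟩ := hz
  refine ⟨by simpa using h1, by simpa using h2, fun h => h4 ?_, fun h => h3 ?_⟩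
  · simpa using congrArg conj h
  · simpa using congrArg conj h

theorem Sigma0_subset_DminusCl (q₀ : ℝ) : Sigma0 q₀ ⊆ DminusCl q₀ := subset_union_right

theorem conj_mem_Dminus {q₀ : ℝ} {z : ℂ} : conj z ∈ Dminus q₀ ↔ z ∈ Dplus q₀ := by
  simp [Dminus, Dplus]

/-- The antiholomorphic involution `z ↦ -q₀²/z^*`. -/
def refl (q₀ : ℝ) (z : ℂ) : ℂ := -((q₀ : ℂ) ^ 2 / conj z)

theorem refl_eq (q₀ : ℝ) (z : ℂ) : refl q₀ z = ((-(q₀ ^ 2 / ‖z‖ ^ 2) : ℝ) : ℂ) * z := by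
  rcases eq_or_ne z 0 with rfl | hz
  · simp [refl]
  have hn : (‖z‖ : ℂ) ≠ 0 := by simpa using hz
  have hc : conj z ≠ 0 := by simpa using hz
  have : z * conj z = (‖z‖ : ℂ) ^ 2 := Complex.mul_conj' z
  rw [refl]
  push_cast
  rw [← this]
  field_simp

theorem norm_refl (q₀ : ℝ) (z : ℂ) : ‖refl q₀ z‖ = q₀ ^ 2 / ‖z‖ := by
  rw [refl, norm_neg, norm_div, RCLike.norm_conj, norm_pow, Complex.norm_real, Real.norm_eq_abs,
    sq_abs]

theorem refl_refl {q₀ : ℝ} (hq₀ : q₀ ≠ 0) {z : ℂ} (hz : z ≠ 0) : refl q₀ (refl q₀ z) = z := by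
  have : (q₀ : ℂ) ≠ 0 := by exact_mod_cast hq₀
  have hc : conj z ≠ 0 := by simpa using hz
  simp only [refl, map_neg, map_div₀, map_pow, Complex.conj_ofReal, Complex.conj_conj]
  field_simp

/-- `refl` multiplies by a negative real number and inverts the modulus about `q₀`, so both factors
change sign and the product keeps its sign. Hence `refl` preserves `D⁻`, exchanging its outer lower
and inner upper components. -/
theorem refl_sign {q₀ : ℝ} {z : ℂ} (hz : z ≠ 0) : (‖refl q₀ z‖ ^ 2 - q₀ ^ 2) * (refl q₀ z).im =
    q₀ ^ 4 / ‖z‖ ^ 4 * ((‖z‖ ^ 2 - q₀ ^ 2) * z.im) := by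
  have hn : ‖z‖ ≠ 0 := by simpa using hz
  rw [norm_refl, refl_eq, Complex.im_ofReal_mul]
  field_simp
  ring

theorem refl_mem_DminusCl {q₀ : ℝ} (hq₀ : 0 < q₀) {z : ℂ} (hz : z ∈ DminusCl q₀) :
    refl q₀ z ∈ DminusCl q₀ := by
  rw [mem_DminusCl_iff hq₀] at hz ⊢
  obtain ⟨h1, h2, h3, h4⟩ := hz
  have hq : (q₀ : ℂ) ≠ 0 := by exact_mod_cast hq₀.ne'
  have hI : ∀ w, refl q₀ w = refl q₀ z → w ≠ 0 → w = z := fun w hw hw0 => by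
    rw [← refl_refl hq₀.ne' hw0, hw, refl_refl hq₀.ne' h2]
  -- The involution exchanges the branch points, so neither can be the image of a point of the
  -- domain.
  have e1 : refl q₀ (-(Complex.I * q₀)) = Complex.I * q₀ := by
    simp only [refl, map_neg, map_mul, Complex.conj_I, Complex.conj_ofReal]
    field_simp
    simp
  have e2 : refl q₀ (Complex.I * q₀) = -(Complex.I * q₀) := by
    rw [← e1, refl_refl hq₀.ne' (by simpa using hq), e1]
  refine ⟨?_, ?_, fun h => h4 ?_, fun h => h3 ?_⟩
  · rw [refl_sign h2]
    exact mul_nonpos_of_nonneg_of_nonpos (by positivity) h1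
  · simpa [refl, hq] using h2
  · exact (hI _ (e1.trans h.symm) (by simpa using hq)).symm
  · exact (hI _ (e2.trans h.symm) (by simpa using hq)).symm

/-! ### Scattering coefficients -/

/-- The standing assumptions on the potential. -/
structure IsPotential (q₀ : ℝ) (qm qp : ℂ) (q : ℝ → ℝ → ℂ) (t : ℝ) : Prop where
  pos : 0 < q₀
  norm_m : ‖qm‖ = q₀
  norm_p : ‖qp‖ = q₀
  cont : Continuous fun x : ℝ => q x t
  int_p : IntegrableOn (fun x : ℝ => q x t - qp) (Ici 0)
  int_m : IntegrableOn (fun x : ℝ => q x t - qm) (Iic 0)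

namespace IsPotential

variable {q₀ : ℝ} {qm qp : ℂ} {q : ℝ → ℝ → ℂ} {t : ℝ} (H : IsPotential q₀ qm qp q t)
include H

theorem cont_reflect : Continuous fun x => reflect q x (-t) := by
  have h : (fun x => reflect q x (-t)) = fun x => conj (q (-x) t) := by
    funext x
    simp [reflect]
  rw [h]
  exact Complex.continuous_conj.comp (H.cont.comp continuous_neg)

theorem int_reflect : IntegrableOn (fun x => reflect q x (-t) - conj qm) (Ici 0) := by
  have h : IntegrableOn (fun x => q (-x) t - qm) (Ici 0) := by
    exact IntegrableOn.comp_neg_Ici (f := fun x => q x t - qm) (by simpa using H.int_m)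
  refine Integrable.congr' h ?_ ?_
  · exact (H.cont_reflect.sub continuous_const).aestronglyMeasurable
  · refine ae_of_all _ fun x => ?_
    rw [reflect, neg_neg, ← map_sub, RCLike.norm_conj]

variable {z : ℂ}

theorem psiP_zero_isJost (hz : z ∈ DminusCl q₀) : IsJost q₀ qp q t atTop 0 z (psiP q₀ qp q t 0 z) :=
  Classical.epsilon_spec (p := IsJost q₀ qp q t atTop 0 z)
    ⟨_, isJost_jostU H.pos H.norm_p H.cont H.int_p hz⟩

theorem psiP_zero_eq (hz : z ∈ DminusCl q₀) {ψ : ℝ → Fin 2 → ℂ}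
    (h : IsJost q₀ qp q t atTop 0 z ψ) : psiP q₀ qp q t 0 z = ψ :=
  (H.psiP_zero_isJost hz).unique H.pos H.cont hz h

theorem isJost_swapRefl_jostU (hz : z ∈ DminusCl q₀) : IsJost q₀ qm q t atBot 1 z
    (swapRefl fun x => Complex.exp (-(Complex.I * phase q₀ x (-t) z)) •
      jostU q₀ (conj qm) (fun x => reflect q x (-t)) z x) := by
  have h := (isJost_jostU H.pos (by rw [RCLike.norm_conj]; exact H.norm_m) H.cont_reflect
    H.int_reflect hz).swapRefl_zero (l' := atBot) tendsto_neg_atBot_atTop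
  rwa [reflect_reflect, neg_neg, Complex.conj_conj] at h

theorem psiM_one_isJost (hz : z ∈ DminusCl q₀) : IsJost q₀ qm q t atBot 1 z (psiM q₀ qm q t 1 z) :=
  Classical.epsilon_spec (p := IsJost q₀ qm q t atBot 1 z) ⟨_, H.isJost_swapRefl_jostU hz⟩

theorem psiM_one_eq (hz : z ∈ DminusCl q₀) {ψ : ℝ → Fin 2 → ℂ}
    (h : IsJost q₀ qm q t atBot 1 z ψ) : psiM q₀ qm q t 1 z = ψ := by
  have h1 := (H.psiM_one_isJost hz).swapRefl_one (l' := atTop) tendsto_neg_atTop_atBot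
  have h2 := h.swapRefl_one (l' := atTop) tendsto_neg_atTop_atBot
  have := h1.unique H.pos H.cont_reflect hz h2
  rw [← swapRefl_swapRefl (psiM q₀ qm q t 1 z), this, swapRefl_swapRefl]

theorem psiP_one_isJost (hz : z ∈ DminusCl q₀) :
    IsJost q₀ qp q t atTop 1 (conj z) (psiP q₀ qp q t 1 (conj z)) :=
  Classical.epsilon_spec (p := IsJost q₀ qp q t atTop 1 (conj z)) 
    ⟨_, (H.psiP_zero_isJost hz).conj_zero⟩

theorem psiM_zero_isJost (hz : z ∈ DminusCl q₀) :
    IsJost q₀ qm q t atBot 0 (conj z) (psiM q₀ qm q t 0 (conj z)) :=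
  Classical.epsilon_spec (p := IsJost q₀ qm q t atBot 0 (conj z))
    ⟨_, (H.psiM_one_isJost hz).conj_one⟩

theorem psiP_one_conj (hz : z ∈ DminusCl q₀) (x : ℝ) : psiP q₀ qp q t 1 (conj z) x =
    ![-conj (psiP q₀ qp q t 0 z x 1), conj (psiP q₀ qp q t 0 z x 0)] := by
  have h := (H.psiP_one_isJost hz).conj_one
  rw [Complex.conj_conj] at h
  rw [H.psiP_zero_eq hz h]
  funext i
  fin_cases i <;> simp

theorem psiM_zero_conj (hz : z ∈ DminusCl q₀) (x : ℝ) : psiM q₀ qm q t 0 (conj z) x =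
    ![conj (psiM q₀ qm q t 1 z x 1), -conj (psiM q₀ qm q t 1 z x 0)] := by
  have h := (H.psiM_zero_isJost hz).conj_zero
  rw [Complex.conj_conj] at h
  rw [H.psiM_one_eq hz h]
  funext i
  fin_cases i <;> simp

theorem s22_conj (hz : z ∈ DminusCl q₀) : s22 q₀ qm qp q t (conj z) = conj (s11 q₀ qm qp q t z) := by
  rw [s22, s11, map_div₀, conj_gam, H.psiP_one_conj hz, H.psiM_zero_conj hz]
  congr 1
  simp only [wr, map_sub, map_mul, Matrix.cons_val_zero, Matrix.cons_val_one]
  ring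

theorem s11_refl (hz : z ∈ DminusCl q₀) :
    s11 q₀ qm qp q t (refl q₀ z) = qm / qp * conj (s11 q₀ qm qp q t z) := by
  have hz0 : conj z ≠ 0 := by simpa using ne_zero_of_mem_DminusCl H.pos hz
  have hzr := refl_mem_DminusCl H.pos hz
  have hP := H.psiP_zero_eq hzr ((H.psiP_one_isJost hz).inv_one H.pos H.norm_p hz0)
  have hM := H.psiM_one_eq hzr ((H.psiM_zero_isJost hz).inv_zero H.pos H.norm_m hz0)
  have hq : (q₀ : ℂ) ≠ 0 := by exact_mod_cast H.pos.ne'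
  have hqp : qp ≠ 0 := by
    rintro rfl
    have := H.norm_p
    simp at this
    exact H.pos.ne this
  have hg : gam q₀ (conj z) ≠ 0 := by
    rw [← conj_gam]
    simpa using gam_ne_zero_of_mem_DminusCl H.pos hz
  have hQQ := conj_mul_of_norm_eq H.norm_p
  rw [← H.s22_conj hz, s11, s22, hP, hM, refl, gam_inv H.pos.ne' hz0]
  simp only [wr, Pi.smul_apply, smul_eq_mul]
  generalize psiP q₀ qp q t 1 (conj z) 0 0 = a
  generalize psiP q₀ qp q t 1 (conj z) 0 1 = b
  generalize psiM q₀ qm q t 0 (conj z) 0 0 = c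
  generalize psiM q₀ qm q t 0 (conj z) 0 1 = d
  rw [← hQQ]
  have hcp : conj qp ≠ 0 := by simpa using hqp
  field_simp
  linear_combination qm * (a * d - b * c) * Complex.I_sq

/-- This is `det S = 1`, with the second column of `S` expressed through the first by the
conjugation symmetry. The Wronskians of `ψ_+` and of `ψ_-` both equal `γ`, and the rest is the
Plücker identity in dimension two. -/
theorem s11_mul_s22_add {ζ : ℂ} (hζ : ζ ∈ Sigma0 q₀) :
    s11 q₀ qm qp q t ζ * conj (s11 q₀ qm qp q t (conj ζ)) +
      s21 q₀ qm qp q t ζ * conj (s21 q₀ qm qp q t (conj ζ)) = 1 := by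
  have h1 := Sigma0_subset_DminusCl q₀ hζ
  have h2 := Sigma0_subset_DminusCl q₀ (conj_mem_Sigma0 hζ)
  have hg := gam_ne_zero_of_mem_DminusCl H.pos h1
  have hp2 := H.psiP_one_isJost h2
  have hm1 := H.psiM_zero_isJost h2
  rw [Complex.conj_conj] at hp2 hm1
  have w1 := (H.psiP_zero_isJost h1).wr_eq_gam H.norm_p hp2 0
  have w2 := hm1.wr_eq_gam H.norm_m (H.psiM_one_isJost h1) 0
  have e1 := H.psiP_one_conj h2 0
  have e2 := H.psiM_zero_conj h2 0
  have e3 := H.psiM_zero_conj h1 0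
  rw [Complex.conj_conj] at e1 e2
  rw [e1] at w1
  rw [e2] at w2
  simp only [s11, s21, map_div₀, conj_gam, Complex.conj_conj, e2, e3]
  simp only [wr, map_sub, map_mul, map_neg, Matrix.cons_val_zero, Matrix.cons_val_one,
    Complex.conj_conj] at w1 w2 ⊢
  field_simp
  linear_combination (gam q₀ ζ) * w1 + (psiP q₀ qp q t 0 ζ 0 0 * conj (psiP q₀ qp q t 0 (conj ζ) 0 0)
    + psiP q₀ qp q t 0 ζ 0 1 * conj (psiP q₀ qp q t 0 (conj ζ) 0 1)) * w2

theorem one_add_rho {ζ : ℂ} (hζ : ζ ∈ Sigma0 q₀) (h1 : s11 q₀ qm qp q t ζ ≠ 0)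
    (h2 : s11 q₀ qm qp q t (conj ζ) ≠ 0) :
    1 + rho q₀ qm qp q t ζ * conj (rho q₀ qm qp q t (conj ζ)) =
      (s11 q₀ qm qp q t ζ * conj (s11 q₀ qm qp q t (conj ζ)))⁻¹ := by
  have h := H.s11_mul_s22_add hζ
  have h2' : conj (s11 q₀ qm qp q t (conj ζ)) ≠ 0 := by simpa using h2
  rw [rho, rho, map_div₀]
  field_simp
  exact h

/-- At `x = 0` the exponentials at times `t` and `-t` are mutually inverse, so only the normalized
columns remain, whose dependence on `z` is known. Continuity, holomorphy and the limit at infinity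
of `s11` all follow from this formula. -/
theorem s11_eq (hz : z ∈ DminusCl q₀) : s11 q₀ qm qp q t z =
    (jostU q₀ qp (fun x => q x t) z 0 0 *
        jostU q₀ (conj qm) (fun x => reflect q x (-t)) z 0 0 -
      jostU q₀ qp (fun x => q x t) z 0 1 *
        jostU q₀ (conj qm) (fun x => reflect q x (-t)) z 0 1) / gam q₀ z := by
  rw [s11, H.psiP_zero_eq hz (isJost_jostU H.pos H.norm_p H.cont H.int_p hz),
    H.psiM_one_eq hz (H.isJost_swapRefl_jostU hz)]
  congr 1
  have e : Complex.exp (-(Complex.I * phase q₀ 0 t z)) *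
      Complex.exp (-(Complex.I * phase q₀ 0 (-t) z)) = 1 := by
    have := phase_neg_neg q₀ 0 t z
    rw [neg_zero] at this
    rw [this, ← Complex.exp_add]
    simp
  simp only [wr, swapRefl, Pi.smul_apply, smul_eq_mul, neg_zero, Matrix.cons_val_zero,
    Matrix.cons_val_one]
  generalize jostU q₀ (conj qm) (fun x => reflect q x (-t)) z 0 0 = a
  generalize jostU q₀ (conj qm) (fun x => reflect q x (-t)) z 0 1 = b
  linear_combination (jostU q₀ qp (fun x => q x t) z 0 0 * a -
      jostU q₀ qp (fun x => q x t) z 0 1 * b) * e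

theorem continuousOn_s11 : ContinuousOn (s11 q₀ qm qp q t) (DminusCl q₀) := by
  have h1 := continuousOn_jostU H.pos H.cont H.int_p 0
  have h2 := continuousOn_jostU H.pos H.cont_reflect H.int_reflect 0
  refine (ContinuousOn.div (((h1 0).mul (h2 0)).sub ((h1 1).mul (h2 1))) ?_
    fun z hz => gam_ne_zero_of_mem_DminusCl H.pos hz).congr fun z hz => H.s11_eq hz
  exact fun z hz => (differentiableAt_gam
    (ne_zero_of_mem_DminusCl H.pos hz)).continuousAt.continuousWithinAt

theorem differentiableOn_s11 : DifferentiableOn ℂ (s11 q₀ qm qp q t) (Dminus q₀) := by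
  have h1 := differentiableOn_jostU H.pos H.cont H.int_p 0
  have h2 := differentiableOn_jostU H.pos H.cont_reflect H.int_reflect 0
  refine (DifferentiableOn.div (((h1 0).mul (h2 0)).sub ((h1 1).mul (h2 1))) ?_
    fun z hz => gam_ne_zero_of_mem_DminusCl H.pos (Or.inl hz)).congr fun z hz => H.s11_eq (Or.inl hz)
  exact fun z hz => (differentiableAt_gam
    (ne_zero_of_mem_DminusCl H.pos (Or.inl hz))).differentiableWithinAt

theorem tendsto_s11 :
    Tendsto (s11 q₀ qm qp q t) (Bornology.cobounded ℂ ⊓ 𝓟 (DminusCl q₀)) (𝓝 1) := by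
  have h1 := tendsto_jostU_param H.pos H.cont H.int_p 0
  have h2 := tendsto_jostU_param H.pos H.cont_reflect H.int_reflect 0
  have h := Tendsto.div (((h1 0).mul (h2 0)).sub ((h1 1).mul (h2 1)))
    ((tendsto_gam q₀).mono_left inf_le_left) one_ne_zero
  simp only [Pi.single_eq_same, mul_one, Pi.single_eq_of_ne, ne_eq, one_ne_zero,
    not_false_eq_true, mul_zero, sub_zero, div_one] at h
  refine h.congr' ?_
  filter_upwards [mem_inf_of_right (mem_principal_self _)] with z hz
  exact (H.s11_eq hz).symm

end IsPotential

end KunduEckhaus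

end

noncomputable section

namespace KunduEckhaus

open Set Asymptotics

/-! ### Continuous logarithms on star-shaped sets -/

/-- The radial homotopy from the constant map at `x₀` to the identity is lifted through the covering
`exp`; its endpoint is the logarithm. Openness of `S` is not needed, so boundary points can be
included. -/
theorem exists_continuousOn_log_of_starConvex {S : Set ℂ} {x₀ : ℂ} (hS : StarConvex ℝ x₀ S)
    (hx₀ : x₀ ∈ S) {g : ℂ → ℂ} (hg : ContinuousOn g S) (h0 : ∀ x ∈ S, g x ≠ 0) :
    ∃ F : ℂ → ℂ, ContinuousOn F S ∧ ∀ x ∈ S, Complex.exp (F x) = g x := by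
  classical
  have hmem : ∀ (t : unitInterval) (a : S), x₀ + (t : ℝ) • ((a : ℂ) - x₀) ∈ S := fun t a =>
    hS.add_smul_sub_mem a.2 t.2.1 t.2.2
  have hcont : Continuous fun p : unitInterval × S =>
      (⟨x₀ + (p.1 : ℝ) • ((p.2 : ℂ) - x₀), hmem p.1 p.2⟩ : S) :=
    Continuous.subtype_mk (by fun_prop) _
  have hgS : Continuous fun a : S => g a := continuousOn_iff_continuous_domRestrict.1 hg
  let H : C(unitInterval × S, {z : ℂ // z ≠ 0}) :=
    ⟨fun p => ⟨g (x₀ + (p.1 : ℝ) • ((p.2 : ℂ) - x₀)), h0 _ (hmem p.1 p.2)⟩,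
      Continuous.subtype_mk (hgS.comp hcont) _⟩
  let f : C(S, ℂ) := ContinuousMap.const S (Complex.log (g x₀))
  have H0 : ∀ a, H (0, a) = (⟨Complex.exp (f a), (f a).exp_ne_zero⟩ : {z : ℂ // z ≠ 0}) := by
    intro a
    apply Subtype.ext
    simp [H, f, Complex.exp_log (h0 x₀ hx₀)]
  obtain ⟨Ft, hF⟩ : ∃ Ft : C(unitInterval × S, ℂ), ∀ p, Complex.exp (Ft p) = (H p).1 :=
    ⟨Complex.isCoveringMap_exp.liftHomotopy H f H0, fun p => congrArg Subtype.val
      (congrFun (Complex.isCoveringMap_exp.liftHomotopy_lifts H f H0) p)⟩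
  refine ⟨fun z => if hz : z ∈ S then Ft (1, ⟨z, hz⟩) else 0, ?_, ?_⟩
  · rw [continuousOn_iff_continuous_domRestrict]
    have : Continuous fun a : S => Ft (1, a) := Ft.continuous.comp (by fun_prop)
    convert this with a
    simp [Set.domRestrict]
  · intro x hx
    simp only [dif_pos hx, hF]
    simp [H]

/-! ### Functions with a logarithmic singularity on the boundary -/

/-- `f` is continuous on `S` without `p` and holomorphic in `U`, with at most a logarithmic
singularity at `p`. -/
structure LogGood (f : ℂ → ℂ) (S U : Set ℂ) (p : ℂ) : Prop where
  cont : ContinuousOn f (S \ {p})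
  diff : DifferentiableOn ℂ f U
  growth : f =O[𝓝[S \ {p}] p] fun s => Real.log ‖s - p‖

theorem tendsto_norm_log_norm_sub (p : ℂ) (S : Set ℂ) :
    Tendsto (fun s => ‖Real.log ‖s - p‖‖) (𝓝[S \ {p}] p) atTop := by
  have h1 : Tendsto (fun s => ‖s - p‖) (𝓝[≠] p) (𝓝[>] 0) := tendsto_norm_sub_self_nhdsNE p
  have h2 := tendsto_abs_atBot_atTop.comp (Real.tendsto_log_nhdsGT_zero.comp h1)
  exact h2.mono_left (nhdsWithin_mono _ fun s hs => hs.2)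

namespace LogGood

variable {f : ℂ → ℂ} {S U : Set ℂ} {p : ℂ}

theorem const_isBigO (c : ℂ) : (fun _ => c) =O[𝓝[S \ {p}] p] fun s => Real.log ‖s - p‖ :=
  (isLittleO_const_left.2 (Or.inr (tendsto_norm_log_norm_sub p S))).isBigO

theorem add_const (h : LogGood f S U p) (c : ℂ) : LogGood (fun s => f s + c) S U p :=
  ⟨h.cont.add continuousOn_const, h.diff.add_const c, h.growth.add (const_isBigO c)⟩

theorem neg (h : LogGood f S U p) : LogGood (fun s => -f s) S U p :=
  ⟨h.cont.neg, h.diff.neg, h.growth.neg_left⟩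

theorem mul (h : LogGood f S U p) {g : ℂ → ℂ} (hg : ContinuousOn g S) (hp : p ∈ S)
    (hd : DifferentiableOn ℂ g U) : LogGood (fun s => f s * g s) S U p := by
  refine ⟨h.cont.mul (hg.mono sdiff_subset), h.diff.mul hd, ?_⟩
  have h1 : g =O[𝓝[S \ {p}] p] fun _ => (1 : ℝ) :=
    ((hg p hp).mono sdiff_subset).isBigO_one ℝ
  simpa using h.growth.mul h1

theorem mono (h : LogGood f S U p) {S' U' : Set ℂ} (hS : S' ⊆ S) (hU : U' ⊆ U) :
    LogGood f S' U' p :=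
  ⟨h.cont.mono (sdiff_subset_sdiff_left hS), h.diff.mono hU,
    h.growth.mono (nhdsWithin_mono _ (sdiff_subset_sdiff_left hS))⟩

theorem comp_const_sub (h : LogGood f S U p) (c : ℂ) {S' U' : Set ℂ}
    (hS : MapsTo (fun s => c - s) S' S) (hU : MapsTo (fun s => c - s) U' U) :
    LogGood (fun s => f (c - s)) S' U' (c - p) := by
  have hS' : MapsTo (fun s => c - s) (S' \ {c - p}) (S \ {p}) := fun s hs =>
    ⟨hS hs.1, fun h => hs.2 (by
      have h : c - s = p := h
      rw [mem_singleton_iff, ← h]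
      ring)⟩
  refine ⟨h.cont.comp (by fun_prop) hS', h.diff.comp (by fun_prop) hU, ?_⟩
  have ht : Tendsto (fun s => c - s) (𝓝[S' \ {c - p}] (c - p)) (𝓝[S \ {p}] p) := by
    refine tendsto_nhdsWithin_iff.2 ⟨?_, ?_⟩
    · have : Tendsto (fun s => c - s) (𝓝 (c - p)) (𝓝 (c - (c - p))) :=
        (continuous_const.sub continuous_id).tendsto _
      rw [sub_sub_cancel] at this
      exact this.mono_left inf_le_left
    · filter_upwards [self_mem_nhdsWithin] with s hs using hS' hs
  refine (h.growth.comp_tendsto ht).congr_right fun s => ?_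
  simp only [Function.comp]
  rw [← norm_neg]
  congr 2
  ring

theorem conj_conj (h : LogGood f S U p) (hUo : IsOpen U) {S' U' : Set ℂ}
    (hS : MapsTo conj S' S) (hU : MapsTo conj U' U) :
    LogGood (fun s => conj (f (conj s))) S' U' (conj p) := by
  have hS' : MapsTo conj (S' \ {conj p}) (S \ {p}) := fun s hs =>
    ⟨hS hs.1, fun h => hs.2 (by
      have h : conj s = p := h
      rw [mem_singleton_iff, ← h, Complex.conj_conj])⟩
  refine ⟨Complex.continuous_conj.comp_continuousOn
    (h.cont.comp Complex.continuous_conj.continuousOn hS'), ?_, ?_⟩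
  · intro s hs
    have h1 := h.diff.differentiableAt (hUo.mem_nhds (hU hs))
    have h2 := h1.conj_conj
    rw [Complex.conj_conj] at h2
    exact h2.differentiableWithinAt
  have ht : Tendsto conj (𝓝[S' \ {conj p}] (conj p)) (𝓝[S \ {p}] p) := by
    refine tendsto_nhdsWithin_iff.2 ⟨?_, ?_⟩
    · have : Tendsto conj (𝓝 (conj p)) (𝓝 (conj (conj p))) := Complex.continuous_conj.tendsto _
      rw [Complex.conj_conj] at this
      exact this.mono_left inf_le_left
    · filter_upwards [self_mem_nhdsWithin] with s hs using hS' hs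
  refine IsBigO.congr' (f₁ := fun s => conj (f (conj s))) (g₁ := fun s => Real.log ‖conj s - p‖) ?_
    EventuallyEq.rfl (Eventually.of_forall fun s => ?_)
  · exact isBigO_norm_left.1 (by simpa [Function.comp_def] using (h.growth.comp_tendsto ht).norm_left)
  · simp only
    rw [← RCLike.norm_conj (conj s - p), map_sub, Complex.conj_conj]

/-- The numerator `f s - f s₀` cancels the simple zero of `E`: both are replaced by their divided
differences, which keep continuity and holomorphy, and the one of `E` is nonzero on `S`. Away from
`s₀`, in particular near `p`, the factor `g / E` is bounded. -/
theorem sub_mul_inv (h : LogGood f S U p) (hUo : IsOpen U) (hUS : U ⊆ S) (hpS : p ∈ S) (hpU : p ∉ U)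
    {s₀ : ℂ} (hs₀ : s₀ ∈ U) {g E : ℂ → ℂ} (hg : Continuous g) (hgd : Differentiable ℂ g)
    (hE : Differentiable ℂ E) (hE0 : ∀ s ∈ S, E s = 0 → s = s₀) (hEs : E s₀ = 0)
    (hE' : deriv E s₀ ≠ 0) :
    ∃ k, LogGood k S U p ∧ ∀ s ∈ S, s ≠ s₀ → k s = (f s - f s₀) * (g s / E s) := by
  have hps : p ≠ s₀ := fun h => hpU (h ▸ hs₀)
  have hSn : S ∈ 𝓝 s₀ := mem_of_superset (hUo.mem_nhds hs₀) hUS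
  have hSpn : S \ {p} ∈ 𝓝 s₀ := inter_mem hSn (isOpen_compl_singleton.mem_nhds hps.symm)
  have hfd := h.diff.differentiableAt (hUo.mem_nhds hs₀)
  have hEne : ∀ s ∈ S, dslope E s₀ s ≠ 0 := by
    intro s hs
    rcases eq_or_ne s s₀ with rfl | hne
    · rwa [dslope_same]
    · rw [dslope_of_ne _ hne, slope_def_field, hEs, sub_zero]
      exact div_ne_zero (fun h => hne (hE0 s hs h)) (sub_ne_zero.2 hne)
  have hEc : Continuous (dslope E s₀) := by
    rw [← continuousOn_univ, continuousOn_dslope univ_mem]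
    exact ⟨hE.continuous.continuousOn, hE s₀⟩
  have hEd : Differentiable ℂ (dslope E s₀) := by
    rw [← differentiableOn_univ, Complex.differentiableOn_dslope univ_mem]
    exact hE.differentiableOn
  have heq : ∀ s ∈ S, s ≠ s₀ → dslope f s₀ s * (g s / dslope E s₀ s) =
      (f s - f s₀) * (g s / E s) := by
    intro s hs hne
    have h1 : s - s₀ ≠ 0 := sub_ne_zero.2 hne
    have h2 : E s ≠ 0 := fun h => hne (hE0 s hs h)
    rw [dslope_of_ne _ hne, dslope_of_ne _ hne, slope_def_field, slope_def_field, hEs, sub_zero]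
    field_simp
  refine ⟨fun s => dslope f s₀ s * (g s / dslope E s₀ s), ⟨?_, ?_, ?_⟩, heq⟩
  · exact ((continuousOn_dslope hSpn).2 ⟨h.cont, hfd⟩).mul
      (hg.continuousOn.div hEc.continuousOn fun s hs => hEne s hs.1)
  · exact ((Complex.differentiableOn_dslope (hUo.mem_nhds hs₀)).2 h.diff).mul
      (hgd.differentiableOn.div hEd.differentiableOn fun s hs => hEne s (hUS hs))
  · have h1 : (fun s => f s - f s₀) =O[𝓝[S \ {p}] p] fun s => Real.log ‖s - p‖ := by
      simpa [sub_eq_add_neg] using (h.add_const (-f s₀)).growth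
    have hEp : E p ≠ 0 := fun h => hps (hE0 p hpS h)
    have h2 : (fun s => g s / E s) =O[𝓝[S \ {p}] p] fun _ => (1 : ℝ) :=
      ((hg.continuousAt.div hE.continuous.continuousAt hEp).continuousWithinAt).isBigO_one ℝ
    have h3 := h1.mul h2
    refine IsBigO.congr' h3 ?_ (Eventually.of_forall fun s => by simp)
    have hne : ∀ᶠ s in 𝓝[S \ {p}] p, s ≠ s₀ := nhdsWithin_le_nhds (isOpen_compl_singleton.mem_nhds hps)
    filter_upwards [self_mem_nhdsWithin, hne] with s hs hs'
    exact (heq s hs.1 hs').symm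

end LogGood

end KunduEckhaus

end

noncomputable section

namespace KunduEckhaus

open Set Asymptotics

/-! ### Cauchy's theorem for rectangles with a logarithmic singularity on a vertical side -/

namespace LogGood

variable {f : ℂ → ℂ} {a b c d : ℝ} {p : ℂ}

/-- Within distance `1` of `p` logarithms are negative and `|Im (s - p)| ≤ ‖s - p‖`, so the
singularity may be measured by the imaginary part alone; elsewhere compactness gives a constant. A
bound depending only on `Im s` is an integrable majorant on all vertical segments at once. -/
theorem exists_log_bound {U : Set ℂ} (h : LogGood f (Icc a b ×ℂ Icc c d) U p) :
    ∃ C, 0 ≤ C ∧ ∀ s ∈ Icc a b ×ℂ Icc c d, s.im ≠ p.im →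
      ‖f s‖ ≤ C * (1 + |Real.log (s.im - p.im)|) := by
  obtain ⟨C₁, hC₁, hb⟩ := h.growth.exists_pos
  rw [isBigOWith_iff, eventually_nhdsWithin_iff, Metric.eventually_nhds_iff] at hb
  obtain ⟨δ, hδ, hb⟩ := hb
  set δ' := min δ 1
  have hδ' : 0 < δ' := lt_min hδ one_pos
  have hK : IsCompact ((Icc a b ×ℂ Icc c d) \ Metric.ball p δ') :=
    (isCompact_Icc.reProdIm isCompact_Icc).diff Metric.isOpen_ball
  obtain ⟨C₂, hC₂⟩ := hK.exists_bound_of_continuousOn (h.cont.mono fun s hs => ⟨hs.1, fun e => hs.2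
    (by rw [mem_singleton_iff.1 e]; exact Metric.mem_ball_self hδ')⟩)
  refine ⟨max C₁ C₂, le_max_of_le_left hC₁.le, fun s hs hsp => ?_⟩
  by_cases hball : s ∈ Metric.ball p δ'
  · have hsne : s ≠ p := fun e => hsp (by rw [e])
    have hd : dist s p < δ' := hball
    have h1 := hb (hd.trans_le (min_le_left _ _)) ⟨hs, hsne⟩
    have him : |s.im - p.im| ≤ ‖s - p‖ := by
      rw [← Complex.sub_im]
      exact Complex.abs_im_le_norm _
    have hpos : 0 < |s.im - p.im| := abs_pos.2 (sub_ne_zero.2 hsp)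
    have hlt : ‖s - p‖ < 1 := by
      rw [← dist_eq_norm]
      exact hd.trans_le (min_le_right _ _)
    have h2 : |Real.log ‖s - p‖| ≤ |Real.log (s.im - p.im)| := by
      rw [← Real.log_abs (s.im - p.im), abs_of_nonpos (Real.log_nonpos (norm_nonneg _) hlt.le),
        abs_of_nonpos (Real.log_nonpos hpos.le (him.trans hlt.le))]
      exact neg_le_neg (Real.log_le_log hpos him)
    calc ‖f s‖ ≤ C₁ * |Real.log ‖s - p‖| := h1
      _ ≤ max C₁ C₂ * (1 + |Real.log (s.im - p.im)|) := by
        gcongr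
        · exact le_max_left _ _
        · linarith
  · calc ‖f s‖ ≤ C₂ := hC₂ s ⟨hs, hball⟩
      _ ≤ max C₁ C₂ * 1 := by rw [mul_one]; exact le_max_right _ _
      _ ≤ _ := by
        gcongr
        linarith [abs_nonneg (Real.log (s.im - p.im))]

theorem intervalIntegrable_log_abs_sub (x c d : ℝ) :
    IntervalIntegrable (fun y => |Real.log (y - x)|) volume c d := by
  have h : IntervalIntegrable (fun y => Real.log (y - x)) volume c d := by
    have := (intervalIntegral.intervalIntegrable_log' (a := c - x) (b := d - x)).comp_sub_right x
    simpa using this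
  exact h.abs

theorem intervalIntegrable_of_bound {U : Set ℂ} (h : LogGood f (Icc a b ×ℂ Icc c d) U p)
    {x : ℝ} (hx : x ∈ Icc a b) (hcd : c ≤ d) :
    IntervalIntegrable (fun y : ℝ => f (x + y * Complex.I)) volume c d := by
  obtain ⟨C, hC0, hC⟩ := h.exists_log_bound
  have hmem : ∀ y ∈ Icc c d, (x + y * Complex.I : ℂ) ∈ Icc a b ×ℂ Icc c d := fun y hy => by
    rw [Complex.mem_reProdIm]
    simpa using ⟨hx, hy⟩
  have hae : ∀ᵐ y : ℝ, y ≠ p.im := (countable_singleton p.im).ae_notMem volume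
  have hm : AEStronglyMeasurable (fun y : ℝ => f (x + y * Complex.I)) (volume.restrict (Ioc c d)) := by
    have hco : ContinuousOn (fun y : ℝ => f (x + y * Complex.I)) (Ioc c d \ {p.im}) := by
      refine h.cont.comp (by fun_prop) fun y hy => ⟨hmem y (Ioc_subset_Icc_self hy.1), fun e => ?_⟩
      apply hy.2
      rw [mem_singleton_iff, ← mem_singleton_iff.1 e]
      simp
    have := hco.aestronglyMeasurable (μ := volume) (measurableSet_Ioc.diff (measurableSet_singleton _))
    rwa [Measure.restrict_congr_set (sdiff_null_ae_eq_self (by simp))] at this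
  have hI : IntervalIntegrable (fun y => C * (1 + |Real.log (y - p.im)|)) volume c d :=
    ((intervalIntegrable_const (c := (1 : ℝ))).add (intervalIntegrable_log_abs_sub _ _ _)).const_mul C
  rw [intervalIntegrable_iff_integrableOn_Ioc_of_le hcd] at hI ⊢
  refine Integrable.mono' hI hm ?_
  filter_upwards [ae_restrict_mem measurableSet_Ioc, ae_restrict_of_ae hae] with y hy hne
  have := hC _ (hmem y (Ioc_subset_Icc_self hy)) (by simpa using hne)
  simpa using this

/-- The boundary integral of a function with a logarithmic singularity at a point of the vertical
sides of the rectangle vanishes. -/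
theorem integral_boundary_rect_eq_zero (hab : a < b) (hcp : c < p.im) (hpd : p.im < d)
    (h : LogGood f (Icc a b ×ℂ Icc c d) (Ioo a b ×ℂ Ioo c d) p) :
    (∫ x : ℝ in a..b, f (x + c * Complex.I)) - (∫ x : ℝ in a..b, f (x + d * Complex.I)) +
      Complex.I • (∫ y : ℝ in c..d, f (b + y * Complex.I)) -
      Complex.I • (∫ y : ℝ in c..d, f (a + y * Complex.I)) = 0 := by
  obtain ⟨C, hC0, hC⟩ := h.exists_log_bound
  have hcd : c < d := hcp.trans hpd
  -- The rectangle is contracted towards a point at the height of `p`. Then `Im s - Im p` is just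
  -- multiplied by `1 - η`, and the logarithmic majorant changes by at most `log 2` when `η < 1/2`,
  -- so the ordinary Cauchy theorem on the contracted rectangles passes to the limit by dominated
  -- convergence.
  set m : ℂ := ⟨(a + b) / 2, p.im⟩ with hm
  set T : ℝ → ℂ → ℂ := fun η s => m + ((1 - η : ℝ) : ℂ) * (s - m) with hT
  have hTre : ∀ η s, (T η s).re = (a + b) / 2 + (1 - η) * (s.re - (a + b) / 2) := fun η s => by
    simp only [hT, Complex.add_re, Complex.re_ofReal_mul, Complex.sub_re, hm]
  have hTim : ∀ η s, (T η s).im = p.im + (1 - η) * (s.im - p.im) := fun η s => by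
    simp only [hT, Complex.add_im, Complex.im_ofReal_mul, Complex.sub_im, hm]
  have hTmem : ∀ η ∈ Ioo (0 : ℝ) 1, ∀ s ∈ Icc a b ×ℂ Icc c d, T η s ∈ Ioo a b ×ℂ Ioo c d := by
    intro η hη s hs
    rw [Complex.mem_reProdIm] at hs ⊢
    obtain ⟨⟨h1, h2⟩, h3, h4⟩ := hs
    have e1 : 0 < η := hη.1
    have e2 : 0 < 1 - η := by linarith [hη.2]
    rw [hTre, hTim]
    refine ⟨⟨?_, ?_⟩, ?_, ?_⟩ <;> nlinarith
  have hzero : ∀ η ∈ Ioo (0 : ℝ) 1,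
      (∫ x : ℝ in a..b, f (T η (x + c * Complex.I))) - (∫ x : ℝ in a..b, f (T η (x + d * Complex.I))) +
      Complex.I • (∫ y : ℝ in c..d, f (T η (b + y * Complex.I))) -
      Complex.I • (∫ y : ℝ in c..d, f (T η (a + y * Complex.I))) = 0 := by
    intro η hη
    have hTd : Differentiable ℂ (T η) := by
      simp only [hT]
      fun_prop
    have := Complex.integral_boundary_rect_eq_zero_of_differentiableOn (fun s => f (T η s))
      ⟨a, c⟩ ⟨b, d⟩ ?_
    · exact this
    · simp only [uIcc_of_le hab.le, uIcc_of_le hcd.le]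
      exact h.diff.comp hTd.differentiableOn (hTmem η hη)
  have hlim : ∀ (γ : ℝ → ℂ) (u v : ℝ), u ≤ v → Continuous γ →
      (∀ y ∈ Icc u v, γ y ∈ Icc a b ×ℂ Icc c d) → (∀ᵐ y : ℝ, (γ y).im ≠ p.im) →
      IntervalIntegrable (fun y => |Real.log ((γ y).im - p.im)|) volume u v →
      Tendsto (fun η => ∫ y in u..v, f (T η (γ y))) (𝓝[>] 0) (𝓝 (∫ y in u..v, f (γ y))) := by
    intro γ u v huv hγ hγm hγne hγi
    have hη : ∀ᶠ η : ℝ in 𝓝[>] 0, η ∈ Ioo (0 : ℝ) (1 / 2) := Ioo_mem_nhdsGT (by norm_num)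
    refine intervalIntegral.tendsto_integral_filter_of_dominated_convergence
      (fun y => C * (1 + (Real.log 2 + |Real.log ((γ y).im - p.im)|))) ?_ ?_ ?_ ?_
    · filter_upwards [hη] with η hη
      have hη1 : η ∈ Ioo (0 : ℝ) 1 := ⟨hη.1, hη.2.trans (by norm_num)⟩
      have : ContinuousOn (fun y => f (T η (γ y))) (Icc u v) := by
        refine h.diff.continuousOn.comp ?_ fun y hy => hTmem η hη1 _ (hγm y hy)
        simp only [hT]
        fun_prop
      rw [uIoc_of_le huv]
      exact (this.mono Ioc_subset_Icc_self).aestronglyMeasurable measurableSet_Ioc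
    · filter_upwards [hη] with η hη
      have hη1 : η ∈ Ioo (0 : ℝ) 1 := ⟨hη.1, hη.2.trans (by norm_num)⟩
      filter_upwards [hγne] with y hne hy
      rw [uIoc_of_le huv] at hy
      have hmem := hTmem η hη1 _ (hγm y (Ioc_subset_Icc_self hy))
      have hne' : (γ y).im - p.im ≠ 0 := sub_ne_zero.2 hne
      have h1η : (0 : ℝ) < 1 - η := by linarith [hη1.2]
      have e : (T η (γ y)).im - p.im = (1 - η) * ((γ y).im - p.im) := by rw [hTim]; ring
      have hb := hC _ ⟨Ioo_subset_Icc_self hmem.1, Ioo_subset_Icc_self hmem.2⟩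
        (sub_ne_zero.1 (by rw [e]; exact mul_ne_zero h1η.ne' hne'))
      refine hb.trans ?_
      gcongr
      rw [e, Real.log_mul h1η.ne' hne']
      refine (abs_add_le _ _).trans ?_
      gcongr
      rw [abs_of_nonpos (Real.log_nonpos h1η.le (by linarith [hη1.1])), ← Real.log_inv]
      apply Real.log_le_log (by positivity)
      rw [inv_le_comm₀ h1η (by norm_num)]
      linarith [hη.2]
    · exact ((intervalIntegrable_const (c := (1 : ℝ))).add
        ((intervalIntegrable_const (c := Real.log 2)).add hγi)).const_mul C
    · filter_upwards [hγne] with y hne hy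
      rw [uIoc_of_le huv] at hy
      have hmem := hγm y (Ioc_subset_Icc_self hy)
      have hcw := h.cont (γ y) ⟨hmem, fun e => hne (by rw [mem_singleton_iff.1 e])⟩
      refine hcw.tendsto.comp (tendsto_nhdsWithin_iff.2 ⟨?_, ?_⟩)
      · have : Continuous fun η => T η (γ y) := by
          simp only [hT]
          fun_prop
        have h0 : T 0 (γ y) = γ y := by simp [hT]
        have := this.tendsto 0
        rw [h0] at this
        exact this.mono_left inf_le_left
      · filter_upwards [hη] with η hη
        have hη1 : η ∈ Ioo (0 : ℝ) 1 := ⟨hη.1, hη.2.trans (by norm_num)⟩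
        have hm' := hTmem η hη1 _ hmem
        refine ⟨⟨Ioo_subset_Icc_self hm'.1, Ioo_subset_Icc_self hm'.2⟩, fun e => ?_⟩
        have e' : (T η (γ y)).im - p.im = (1 - η) * ((γ y).im - p.im) := by rw [hTim]; ring
        rw [mem_singleton_iff.1 e, sub_self] at e'
        exact mul_ne_zero (by linarith [hη1.2]) (sub_ne_zero.2 hne) e'.symm
  have hae : ∀ᵐ y : ℝ, y ≠ p.im := (countable_singleton p.im).ae_notMem volume
  have L1 := hlim (fun x => x + c * Complex.I) a b hab.le (by fun_prop)
    (fun y hy => by rw [Complex.mem_reProdIm]; simpa using ⟨hy, hcd.le⟩)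
    (ae_of_all _ fun y => by simpa using hcp.ne) (by simp)
  have L2 := hlim (fun x => x + d * Complex.I) a b hab.le (by fun_prop)
    (fun y hy => by rw [Complex.mem_reProdIm]; simpa using ⟨hy, hcd.le⟩)
    (ae_of_all _ fun y => by simpa using hpd.ne') (by simp)
  have L3 := hlim (fun y => b + y * Complex.I) c d hcd.le (by fun_prop)
    (fun y hy => by rw [Complex.mem_reProdIm]; simpa using ⟨hab.le, hy⟩)
    (hae.mono fun y hy => by simpa using hy) (by simpa using intervalIntegrable_log_abs_sub p.im c d)
  have L4 := hlim (fun y => a + y * Complex.I) c d hcd.le (by fun_prop)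
    (fun y hy => by rw [Complex.mem_reProdIm]; simpa using ⟨hab.le, hy⟩)
    (hae.mono fun y hy => by simpa using hy) (by simpa using intervalIntegrable_log_abs_sub p.im c d)
  have L := ((L1.sub L2).add (L3.const_smul Complex.I)).sub (L4.const_smul Complex.I)
  refine (tendsto_nhds_unique (tendsto_const_nhds.congr' ?_) L).symm
  filter_upwards [Ioo_mem_nhdsGT (show (0 : ℝ) < 1 by norm_num)] with η hη
  exact (hzero η hη).symm

end LogGood

end KunduEckhaus

end

noncomputable section

namespace KunduEckhaus

open Set Asymptotics

/-! ### The contour in the logarithmic coordinate -/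

/-- The integrand in the coordinate `s = log (ζ / q₀)`. -/
def logInt (q₀ : ℝ) (f : ℂ → ℂ) (s : ℂ) : ℂ := f (q₀ * Complex.exp s) * (q₀ * Complex.exp s)

theorem ofReal_mul_exp (q₀ σ : ℝ) :
    (q₀ : ℂ) * Complex.exp σ = ((q₀ * Real.exp σ : ℝ) : ℂ) := by push_cast; ring

theorem ofReal_mul_exp_add_pi (q₀ σ : ℝ) :
    (q₀ : ℂ) * Complex.exp (σ + Real.pi * Complex.I) = ((-(q₀ * Real.exp σ) : ℝ) : ℂ) := by
  rw [Complex.exp_add, Complex.exp_pi_mul_I]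
  push_cast
  ring

theorem integral_exp_subst {q₀ : ℝ} (hq₀ : 0 < q₀) {g : ℝ → ℂ} (hg : ContinuousOn g (Ioi 0))
    (u v : ℝ) : ∫ x in (q₀ * Real.exp u)..(q₀ * Real.exp v), g x =
      ∫ σ in u..v, g (q₀ * Real.exp σ) * ((q₀ * Real.exp σ : ℝ) : ℂ) := by
  have h := intervalIntegral.integral_deriv_smul_comp' (a := u) (b := v) (g := g)
    (f := fun σ => q₀ * Real.exp σ) (f' := fun σ => q₀ * Real.exp σ)
    (fun σ _ => (Real.hasDerivAt_exp σ).const_mul q₀) (by fun_prop)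
    (hg.mono (by
      rintro _ ⟨σ, _, rfl⟩
      exact mul_pos hq₀ (Real.exp_pos σ)))
  rw [← h]
  refine intervalIntegral.integral_congr fun σ _ => ?_
  simp only [Complex.real_smul, Function.comp]
  ring

section

variable {q₀ : ℝ} (hq₀ : 0 < q₀) {f : ℂ → ℂ} (hpos : ContinuousOn (fun x : ℝ => f x) (Ioi 0))
  (hneg : ContinuousOn (fun x : ℝ => f x) (Iio 0))
include hq₀ hpos hneg

omit hneg in
theorem integral_pos_eq (u v : ℝ) : ∫ x in (q₀ * Real.exp u)..(q₀ * Real.exp v), f (x : ℂ) =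
    ∫ σ in u..v, logInt q₀ f (σ : ℝ) := by
  rw [integral_exp_subst hq₀ hpos]
  refine intervalIntegral.integral_congr fun σ _ => ?_
  simp only [logInt, ofReal_mul_exp]

omit hpos in
theorem integral_neg_eq (u v : ℝ) :
    ∫ x in (-(q₀ * Real.exp v))..(-(q₀ * Real.exp u)), f (x : ℂ) =
      -∫ σ in u..v, logInt q₀ f ((σ : ℝ) + Real.pi * Complex.I) := by
  rw [← intervalIntegral.integral_comp_neg fun x : ℝ => f (x : ℂ),
    integral_exp_subst hq₀ (g := fun x : ℝ => f ((-x : ℝ) : ℂ)), ← intervalIntegral.integral_neg]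
  · refine intervalIntegral.integral_congr fun σ _ => ?_
    simp only [logInt, ofReal_mul_exp_add_pi]
    push_cast
    ring
  · exact hneg.comp continuous_neg.continuousOn fun x hx => by simpa using hx

theorem sigmaTrunc_eq (ρ ρ' : ℝ) :
    sigmaTrunc q₀ f (q₀ * Real.exp (-ρ')) (q₀ * Real.exp ρ) =
      (∫ σ in (0 : ℝ)..ρ, logInt q₀ f σ) -
        (∫ σ in (0 : ℝ)..ρ, logInt q₀ f (σ + Real.pi * Complex.I)) -
      ((∫ σ in (-ρ')..0, logInt q₀ f (σ : ℝ)) -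
        ∫ σ in (-ρ')..0, logInt q₀ f ((σ : ℝ) + Real.pi * Complex.I)) -
      Complex.I * (∫ τ in (0 : ℝ)..Real.pi, logInt q₀ f ((τ : ℝ) * Complex.I)) +
      Complex.I * ∫ τ in (-Real.pi)..(0 : ℝ), logInt q₀ f ((τ : ℝ) * Complex.I) := by
  have e1 := integral_pos_eq hq₀ hpos 0 ρ
  have e2 := integral_pos_eq hq₀ hpos (-ρ') 0
  have e3 := integral_neg_eq hq₀ hneg 0 ρ
  have e4 := integral_neg_eq hq₀ hneg (-ρ') 0
  simp only [Real.exp_zero, mul_one] at e1 e2 e3 e4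
  have e5 : ∀ τ : ℝ, f (circleMap 0 q₀ τ) * deriv (circleMap 0 q₀) τ =
      Complex.I * logInt q₀ f (τ * Complex.I) := fun τ => by
    simp only [deriv_circleMap, logInt, circleMap, zero_add]
    ring
  simp only [sigmaTrunc, e1, e2, e3, e4, e5, intervalIntegral.integral_const_mul]
  ring

end

/-- The quarter strips that correspond to the components of `D^±`. -/
def strip₁ : Set ℂ := Ici 0 ×ℂ Icc (-Real.pi) 0
/-- The image of the upper part of `D⁺`. -/
def strip₂ : Set ℂ := Ici 0 ×ℂ Icc 0 Real.pi
/-- The image of the upper part of `D⁻`. -/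
def strip₃ : Set ℂ := Iic 0 ×ℂ Icc 0 Real.pi
/-- The image of the lower part of `D⁺`. -/
def strip₄ : Set ℂ := Iic 0 ×ℂ Icc (-Real.pi) 0
/-- The interior of `strip₁`. -/
def ostrip₁ : Set ℂ := Ioi 0 ×ℂ Ioo (-Real.pi) 0
/-- The interior of `strip₂`. -/
def ostrip₂ : Set ℂ := Ioi 0 ×ℂ Ioo 0 Real.pi
/-- The interior of `strip₃`. -/
def ostrip₃ : Set ℂ := Iio 0 ×ℂ Ioo 0 Real.pi
/-- The interior of `strip₄`. -/
def ostrip₄ : Set ℂ := Iio 0 ×ℂ Ioo (-Real.pi) 0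

/-- The branch point in the upper half plane. -/
def brU : ℂ := Real.pi / 2 * Complex.I
/-- The branch point in the lower half plane. -/
def brL : ℂ := -(Real.pi / 2 * Complex.I)

theorem brU_im : brU.im = Real.pi / 2 := by simp [brU]

theorem brL_im : brL.im = -(Real.pi / 2) := by simp [brL]

theorem brU_re : brU.re = 0 := by simp [brU]

theorem brL_re : brL.re = 0 := by simp [brL]

/-! ### Cauchy's theorem summed over the four half strips -/

theorem LogGood.continuousOn_horizontal {f : ℂ → ℂ} {S U : Set ℂ} {p : ℂ} (h : LogGood f S U p)
    {y : ℂ} {A : Set ℝ} (hy : y.im ≠ p.im) (hA : ∀ x ∈ A, (x + y : ℂ) ∈ S) :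
    ContinuousOn (fun x : ℝ => f (x + y)) A :=
  h.cont.comp (by fun_prop) fun x hx => ⟨hA x hx, fun e => hy (by
    rw [← mem_singleton_iff.1 e]
    simp)⟩

theorem intervalIntegrable_circle {f : ℂ → ℂ} {q₀ : ℝ} (hq₀ : 0 < q₀) {u v : ℝ} {g : ℂ → ℂ}
    (hg : IntervalIntegrable (fun τ : ℝ => g (τ * Complex.I)) volume u v)
    (h : ∀ᵐ τ : ℝ, τ ∈ uIoc u v → logInt q₀ f (τ * Complex.I) = g (τ * Complex.I)) :
    IntervalIntegrable (fun τ : ℝ => f (circleMap 0 q₀ τ)) volume u v := by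
  have hne : ∀ τ : ℝ, (q₀ : ℂ) * Complex.exp (τ * Complex.I) ≠ 0 := fun τ =>
    mul_ne_zero (by exact_mod_cast hq₀.ne') (Complex.exp_ne_zero _)
  have h1 : IntervalIntegrable (fun τ : ℝ => g (τ * Complex.I) *
      ((q₀ : ℂ) * Complex.exp (τ * Complex.I))⁻¹) volume u v :=
    hg.mul_continuousOn (ContinuousOn.inv₀ (by fun_prop) fun τ _ => hne τ)
  refine h1.congr_ae ?_
  rw [EventuallyEq, ae_restrict_iff' measurableSet_uIoc]
  filter_upwards [h] with τ hτ hτm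
  rw [← hτ hτm, logInt, mul_assoc, mul_inv_cancel₀ (hne τ), mul_one, circleMap, zero_add]

/-- Cauchy's theorem is applied to truncated rectangles in each strip and the four identities are
added. On the sides lying over `Σ` the boundary values combine into jumps, which are the integrand;
only the vertical sides at the two ends survive. The negative axis is the line `Im s = π` for the
upper strips and `Im s = -π` for the lower ones, whence the mixed signs in `j₂` and `j₄`. -/
theorem hasSigmaIntegral_of_logGood {q₀ : ℝ} (hq₀ : 0 < q₀) {f : ℂ → ℂ}
    (hpos : ContinuousOn (fun x : ℝ => f x) (Ioi 0))
    (hneg : ContinuousOn (fun x : ℝ => f x) (Iio 0)) {g₁ g₂ g₃ g₄ : ℂ → ℂ}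
    (h₁ : LogGood g₁ strip₁ ostrip₁ brL) (h₂ : LogGood g₂ strip₂ ostrip₂ brU)
    (h₃ : LogGood g₃ strip₃ ostrip₃ brU) (h₄ : LogGood g₄ strip₄ ostrip₄ brL)
    (j₁ : ∀ σ : ℝ, 0 ≤ σ → logInt q₀ f σ = g₂ σ - g₁ σ)
    (j₂ : ∀ σ : ℝ, 0 ≤ σ → logInt q₀ f (σ + Real.pi * Complex.I) =
      g₂ (σ + Real.pi * Complex.I) - g₁ (σ - Real.pi * Complex.I))
    (j₃ : ∀ σ : ℝ, σ ≤ 0 → logInt q₀ f σ = g₄ σ - g₃ σ)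
    (j₄ : ∀ σ : ℝ, σ ≤ 0 → logInt q₀ f (σ + Real.pi * Complex.I) =
      g₄ (σ - Real.pi * Complex.I) - g₃ (σ + Real.pi * Complex.I))
    (j₅ : ∀ τ : ℝ, -Real.pi ≤ τ → τ ≤ 0 → τ ≠ -(Real.pi / 2) →
      logInt q₀ f (τ * Complex.I) = g₄ (τ * Complex.I) - g₁ (τ * Complex.I))
    (j₆ : ∀ τ : ℝ, 0 ≤ τ → τ ≤ Real.pi → τ ≠ Real.pi / 2 →
      logInt q₀ f (τ * Complex.I) = g₂ (τ * Complex.I) - g₃ (τ * Complex.I))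
    {A₁ A₂ A₃ A₄ : ℂ}
    (l₁ : Tendsto (fun ρ : ℝ => ∫ τ in (-Real.pi)..0, g₁ (ρ + (τ : ℝ) * Complex.I)) atTop (𝓝 A₁))
    (l₂ : Tendsto (fun ρ : ℝ => ∫ τ in 0..Real.pi, g₂ (ρ + (τ : ℝ) * Complex.I)) atTop (𝓝 A₂))
    (l₃ : Tendsto (fun ρ : ℝ => ∫ τ in 0..Real.pi, g₃ (ρ + (τ : ℝ) * Complex.I)) atBot (𝓝 A₃))
    (l₄ : Tendsto (fun ρ : ℝ => ∫ τ in (-Real.pi)..0, g₄ (ρ + (τ : ℝ) * Complex.I)) atBot (𝓝 A₄)) :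
    HasSigmaIntegral q₀ f (Complex.I * (A₃ + A₄ - A₁ - A₂)) := by
  have hpi := Real.pi_pos
  have r₁ : ∀ ρ : ℝ, LogGood g₁ (Icc 0 ρ ×ℂ Icc (-Real.pi) 0) (Ioo 0 ρ ×ℂ Ioo (-Real.pi) 0) brL :=
    fun ρ => h₁.mono (inter_subset_inter_left _ fun s hs => hs.1)
      (inter_subset_inter_left _ fun s hs => hs.1)
  have r₂ : ∀ ρ : ℝ, LogGood g₂ (Icc 0 ρ ×ℂ Icc 0 Real.pi) (Ioo 0 ρ ×ℂ Ioo 0 Real.pi) brU :=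
    fun ρ => h₂.mono (inter_subset_inter_left _ fun s hs => hs.1)
      (inter_subset_inter_left _ fun s hs => hs.1)
  have r₃ : ∀ ρ : ℝ, LogGood g₃ (Icc ρ 0 ×ℂ Icc 0 Real.pi) (Ioo ρ 0 ×ℂ Ioo 0 Real.pi) brU :=
    fun ρ => h₃.mono (inter_subset_inter_left _ fun s hs => hs.2)
      (inter_subset_inter_left _ fun s hs => hs.2)
  have r₄ : ∀ ρ : ℝ, LogGood g₄ (Icc ρ 0 ×ℂ Icc (-Real.pi) 0) (Ioo ρ 0 ×ℂ Ioo (-Real.pi) 0) brL :=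
    fun ρ => h₄.mono (inter_subset_inter_left _ fun s hs => hs.2)
      (inter_subset_inter_left _ fun s hs => hs.2)
  have v₁ : IntervalIntegrable (fun τ : ℝ => g₁ (τ * Complex.I)) volume (-Real.pi) 0 := by
    simpa using (r₁ 1).intervalIntegrable_of_bound (x := 0) (by simp) (by linarith)
  have v₂ : IntervalIntegrable (fun τ : ℝ => g₂ (τ * Complex.I)) volume 0 Real.pi := by
    simpa using (r₂ 1).intervalIntegrable_of_bound (x := 0) (by simp) (by linarith)
  have v₃ : IntervalIntegrable (fun τ : ℝ => g₃ (τ * Complex.I)) volume 0 Real.pi := by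
    simpa using (r₃ (-1)).intervalIntegrable_of_bound (x := 0) (by simp) (by linarith)
  have v₄ : IntervalIntegrable (fun τ : ℝ => g₄ (τ * Complex.I)) volume (-Real.pi) 0 := by
    simpa using (r₄ (-1)).intervalIntegrable_of_bound (x := 0) (by simp) (by linarith)
  have aeL : ∀ᵐ τ : ℝ, τ ≠ -(Real.pi / 2) :=
    (countable_singleton (-(Real.pi / 2))).ae_notMem volume
  have aeU : ∀ᵐ τ : ℝ, τ ≠ Real.pi / 2 := (countable_singleton (Real.pi / 2)).ae_notMem volume
  have k₅ : ∀ᵐ τ : ℝ, τ ∈ uIoc (-Real.pi) 0 →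
      logInt q₀ f (τ * Complex.I) = g₄ (τ * Complex.I) - g₁ (τ * Complex.I) := by
    filter_upwards [aeL] with τ hτ hm
    rw [uIoc_of_le (by linarith)] at hm
    exact j₅ τ hm.1.le hm.2 hτ
  have k₆ : ∀ᵐ τ : ℝ, τ ∈ uIoc 0 Real.pi →
      logInt q₀ f (τ * Complex.I) = g₂ (τ * Complex.I) - g₃ (τ * Complex.I) := by
    filter_upwards [aeU] with τ hτ hm
    rw [uIoc_of_le (by linarith)] at hm
    exact j₆ τ hm.1.le hm.2 hτ
  refine ⟨?_, ?_, ?_, ?_⟩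
  · intro ε R hε hR
    refine ContinuousOn.intervalIntegrable (hpos.mono fun x hx => ?_)
    rw [uIcc_of_le hR] at hx
    exact hε.trans_le hx.1
  · intro ε R hε hR
    refine ContinuousOn.intervalIntegrable (hneg.mono fun x hx => ?_)
    rw [uIcc_of_le (by linarith)] at hx
    exact hx.2.trans_lt (by simpa using hε)
  · exact (intervalIntegrable_circle hq₀ (g := fun s => g₄ s - g₁ s) (v₄.sub v₁) k₅).trans
      (intervalIntegrable_circle hq₀ (g := fun s => g₂ s - g₃ s) (v₂.sub v₃) k₆)
  -- the truncated contour integral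
  have key : ∀ ρ ρ' : ℝ, 0 < ρ → 0 < ρ' →
      sigmaTrunc q₀ f (q₀ * Real.exp (-ρ')) (q₀ * Real.exp ρ) =
      Complex.I * ((∫ τ in 0..Real.pi, g₃ ((-ρ' : ℝ) + (τ : ℝ) * Complex.I)) +
        (∫ τ in (-Real.pi)..0, g₄ ((-ρ' : ℝ) + (τ : ℝ) * Complex.I)) -
        (∫ τ in (-Real.pi)..0, g₁ (ρ + (τ : ℝ) * Complex.I)) -
        ∫ τ in 0..Real.pi, g₂ (ρ + (τ : ℝ) * Complex.I)) := by
    intro ρ ρ' hρ hρ'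
    have c₁ := (r₁ ρ).integral_boundary_rect_eq_zero hρ (by rw [brL_im]; linarith)
      (by rw [brL_im]; linarith)
    have c₂ := (r₂ ρ).integral_boundary_rect_eq_zero hρ (by rw [brU_im]; linarith)
      (by rw [brU_im]; linarith)
    have c₃ := (r₃ (-ρ')).integral_boundary_rect_eq_zero (by linarith) (by rw [brU_im]; linarith)
      (by rw [brU_im]; linarith)
    have c₄ := (r₄ (-ρ')).integral_boundary_rect_eq_zero (by linarith) (by rw [brL_im]; linarith)
      (by rw [brL_im]; linarith)
    have hz : ∀ g : ℂ → ℂ, ∀ x : ℝ, g (x + (0 : ℂ)) = g x := fun g x => by rw [add_zero]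
    have ii : ∀ {g : ℂ → ℂ} {S U : Set ℂ} {p : ℂ}, LogGood g S U p → ∀ (y : ℂ) (u v : ℝ), u ≤ v →
        y.im ≠ p.im → (∀ x ∈ Icc u v, (x + y : ℂ) ∈ S) →
        IntervalIntegrable (fun x : ℝ => g (x + y)) volume u v := by
      intro g S U p hg y u v huv hy hA
      refine ContinuousOn.intervalIntegrable ?_
      rw [uIcc_of_le huv]
      exact hg.continuousOn_horizontal hy hA
    have i₁ := ii h₁ 0 0 ρ hρ.le (by rw [brL_im]; simp) (fun x hx => by
      rw [strip₁, Complex.mem_reProdIm]; simp [hx.1, hpi.le])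
    have i₁' := ii h₁ (-(Real.pi * Complex.I)) 0 ρ hρ.le (by rw [brL_im]; simp; linarith) (fun x hx => by
      rw [strip₁, Complex.mem_reProdIm]; simp [hx.1, hpi.le])
    have i₂ := ii h₂ 0 0 ρ hρ.le (by rw [brU_im]; simpa using (half_pos hpi).ne) (fun x hx => by
      rw [strip₂, Complex.mem_reProdIm]; simp [hx.1, hpi.le])
    have i₂' := ii h₂ (Real.pi * Complex.I) 0 ρ hρ.le (by rw [brU_im]; simp; linarith) (fun x hx => by
      rw [strip₂, Complex.mem_reProdIm]; simp [hx.1, hpi.le])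
    have i₃ := ii h₃ 0 (-ρ') 0 (by linarith) (by rw [brU_im]; simpa using (half_pos hpi).ne) (fun x hx => by
      rw [strip₃, Complex.mem_reProdIm]; simp [hx.2, hpi.le])
    have i₃' := ii h₃ (Real.pi * Complex.I) (-ρ') 0 (by linarith) (by rw [brU_im]; simp; linarith)
      (fun x hx => by rw [strip₃, Complex.mem_reProdIm]; simp [hx.2, hpi.le])
    have i₄ := ii h₄ 0 (-ρ') 0 (by linarith) (by rw [brL_im]; simp) (fun x hx => by
      rw [strip₄, Complex.mem_reProdIm]; simp [hx.2, hpi.le])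
    have i₄' := ii h₄ (-(Real.pi * Complex.I)) (-ρ') 0 (by linarith) (by rw [brL_im]; simp; linarith)
      (fun x hx => by rw [strip₄, Complex.mem_reProdIm]; simp [hx.2, hpi.le])
    simp only [hz] at i₁ i₂ i₃ i₄
    simp only [← sub_eq_add_neg] at i₁' i₄'
    rw [sigmaTrunc_eq hq₀ hpos hneg]
    have t₁ : ∫ σ in (0 : ℝ)..ρ, logInt q₀ f σ =
        (∫ σ in (0 : ℝ)..ρ, g₂ σ) - ∫ σ in (0 : ℝ)..ρ, g₁ σ := by
      rw [← intervalIntegral.integral_sub i₂ i₁]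
      refine intervalIntegral.integral_congr fun σ hσ => ?_
      rw [uIcc_of_le hρ.le] at hσ
      exact j₁ σ hσ.1
    have t₂ : ∫ σ in (0 : ℝ)..ρ, logInt q₀ f (σ + Real.pi * Complex.I) =
        (∫ σ in (0 : ℝ)..ρ, g₂ (σ + Real.pi * Complex.I)) -
          ∫ σ in (0 : ℝ)..ρ, g₁ (σ - Real.pi * Complex.I) := by
      rw [← intervalIntegral.integral_sub i₂' i₁']
      refine intervalIntegral.integral_congr fun σ hσ => ?_
      rw [uIcc_of_le hρ.le] at hσ
      exact j₂ σ hσ.1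
    have t₃ : ∫ σ in (-ρ')..0, logInt q₀ f (σ : ℝ) =
        (∫ σ in (-ρ')..0, g₄ (σ : ℝ)) - ∫ σ in (-ρ')..0, g₃ (σ : ℝ) := by
      rw [← intervalIntegral.integral_sub i₄ i₃]
      refine intervalIntegral.integral_congr fun σ hσ => ?_
      rw [uIcc_of_le (by linarith)] at hσ
      exact j₃ σ hσ.2
    have t₄ : ∫ σ in (-ρ')..0, logInt q₀ f ((σ : ℝ) + Real.pi * Complex.I) =
        (∫ σ in (-ρ')..0, g₄ ((σ : ℝ) - Real.pi * Complex.I)) -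
          ∫ σ in (-ρ')..0, g₃ ((σ : ℝ) + Real.pi * Complex.I) := by
      rw [← intervalIntegral.integral_sub i₄' i₃']
      refine intervalIntegral.integral_congr fun σ hσ => ?_
      rw [uIcc_of_le (by linarith)] at hσ
      exact j₄ σ hσ.2
    have t₅ : ∫ τ in (-Real.pi)..(0 : ℝ), logInt q₀ f ((τ : ℝ) * Complex.I) =
        (∫ τ in (-Real.pi)..(0 : ℝ), g₄ ((τ : ℝ) * Complex.I)) -
          ∫ τ in (-Real.pi)..(0 : ℝ), g₁ ((τ : ℝ) * Complex.I) := by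
      rw [← intervalIntegral.integral_sub v₄ v₁]
      exact intervalIntegral.integral_congr_ae k₅
    have t₆ : ∫ τ in (0 : ℝ)..Real.pi, logInt q₀ f ((τ : ℝ) * Complex.I) =
        (∫ τ in (0 : ℝ)..Real.pi, g₂ ((τ : ℝ) * Complex.I)) -
          ∫ τ in (0 : ℝ)..Real.pi, g₃ ((τ : ℝ) * Complex.I) := by
      rw [← intervalIntegral.integral_sub v₂ v₃]
      exact intervalIntegral.integral_congr_ae k₆
    rw [t₁, t₂, t₃, t₄, t₅, t₆]
    simp only [Complex.ofReal_zero, zero_mul, zero_add, add_zero, smul_eq_mul, Complex.ofReal_neg,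
      neg_mul, ← sub_eq_add_neg] at c₁ c₂ c₃ c₄ ⊢
    linear_combination c₁ + c₂ + c₃ + c₄
  have hL : Tendsto (fun p : ℝ × ℝ => Complex.I *
      ((∫ τ in 0..Real.pi, g₃ ((Real.log (p.1 / q₀) : ℝ) + (τ : ℝ) * Complex.I)) +
        (∫ τ in (-Real.pi)..0, g₄ ((Real.log (p.1 / q₀) : ℝ) + (τ : ℝ) * Complex.I)) -
        (∫ τ in (-Real.pi)..0, g₁ ((Real.log (p.2 / q₀) : ℝ) + (τ : ℝ) * Complex.I)) -
        ∫ τ in 0..Real.pi, g₂ ((Real.log (p.2 / q₀) : ℝ) + (τ : ℝ) * Complex.I)))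
      (𝓝[>] (0 : ℝ) ×ˢ atTop) (𝓝 (Complex.I * (A₃ + A₄ - A₁ - A₂))) := by
    have t1 : Tendsto (fun p : ℝ × ℝ => Real.log (p.1 / q₀)) (𝓝[>] (0 : ℝ) ×ˢ atTop) atBot := by
      have h0 : Tendsto (fun x : ℝ => x / q₀) (𝓝[>] 0) (𝓝[>] 0) := by
        refine tendsto_nhdsWithin_iff.2 ⟨?_, eventually_nhdsWithin_of_forall fun x hx =>
          div_pos hx hq₀⟩
        have : Tendsto (fun x : ℝ => x / q₀) (𝓝 0) (𝓝 (0 / q₀)) :=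
          (continuous_id.div_const q₀).tendsto 0
        rw [zero_div] at this
        exact this.mono_left inf_le_left
      exact (Real.tendsto_log_nhdsGT_zero.comp h0).comp tendsto_fst
    have t2 : Tendsto (fun p : ℝ × ℝ => Real.log (p.2 / q₀)) (𝓝[>] (0 : ℝ) ×ˢ atTop) atTop :=
      (Real.tendsto_log_atTop.comp (tendsto_id.atTop_div_const hq₀)).comp tendsto_snd
    exact (((((l₃.comp t1).add (l₄.comp t1)).sub (l₁.comp t2)).sub (l₂.comp t2))).const_mul _
  refine hL.congr' ?_
  have hev : ∀ᶠ p : ℝ × ℝ in 𝓝[>] (0 : ℝ) ×ˢ atTop, p.1 ∈ Ioo 0 q₀ ∧ q₀ < p.2 :=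
    (show ∀ᶠ x in 𝓝[>] (0 : ℝ), x ∈ Ioo 0 q₀ from Ioo_mem_nhdsGT hq₀).prod_mk (eventually_gt_atTop q₀)
  filter_upwards [hev] with p hp
  have e1 : q₀ * Real.exp (-(-Real.log (p.1 / q₀))) = p.1 := by
    rw [neg_neg, Real.exp_log (div_pos hp.1.1 hq₀)]
    field_simp
  have e2 : q₀ * Real.exp (Real.log (p.2 / q₀)) = p.2 := by
    rw [Real.exp_log (div_pos (hq₀.trans hp.2) hq₀)]
    field_simp
  have := key (Real.log (p.2 / q₀)) (-Real.log (p.1 / q₀))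
    (Real.log_pos ((one_lt_div hq₀).2 hp.2))
    (neg_pos.2 (Real.log_neg (div_pos hp.1.1 hq₀) ((div_lt_one hq₀).2 hp.1.2)))
  rw [e1, e2, neg_neg] at this
  exact this.symm

end KunduEckhaus

end

noncomputable section

namespace KunduEckhaus

open Set Asymptotics

/-! ### Division by simple zeros -/

theorem exists_eq_prod_mul {ι : Type*} {S U : Set ℂ} (hU : IsOpen U) (hUS : U ⊆ S) {f : ℂ → ℂ}
    (hf : ContinuousOn f S) (hd : DifferentiableOn ℂ f U) {z : ι → ℂ} (hz : Function.Injective z)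
    (hzU : ∀ n, z n ∈ U) (h0 : ∀ n, f (z n) = 0) (s : Finset ι) :
    ∃ g : ℂ → ℂ, ContinuousOn g S ∧ DifferentiableOn ℂ g U ∧
      ∀ w, f w = (∏ n ∈ s, (w - z n)) * g w := by
  classical
  induction s using Finset.induction_on with
  | empty => exact ⟨f, hf, hd, by simp⟩
  | insert a s ha ih =>
    obtain ⟨g, hg, hgd, he⟩ := ih
    have hUa := hU.mem_nhds (hzU a)
    -- The factors already removed do not vanish at `z a`, by injectivity, so the zero persists in
    -- the quotient.
    have hga : g (z a) = 0 := by
      have := he (z a)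
      rw [h0 a, zero_eq_mul, Finset.prod_eq_zero_iff] at this
      refine this.resolve_left ?_
      rintro ⟨n, hn, hn'⟩
      exact ha (hz (sub_eq_zero.1 hn') ▸ hn)
    refine ⟨dslope g (z a), (continuousOn_dslope (mem_of_superset hUa hUS)).2
      ⟨hg, hgd.differentiableAt hUa⟩, (Complex.differentiableOn_dslope hUa).2 hgd, fun w => ?_⟩
    have h := sub_smul_dslope g (z a) w
    rw [hga, sub_zero, smul_eq_mul] at h
    rw [he w, ← h, Finset.prod_insert ha]
    ring

/-- If the quotient vanished at some `z n`, the product rule would give a zero derivative of `f`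
there. -/
theorem exists_eq_prod_mul_of_simple {N : ℕ} {S U : Set ℂ} (hU : IsOpen U) (hUS : U ⊆ S)
    {f : ℂ → ℂ} (hf : ContinuousOn f S) (hd : DifferentiableOn ℂ f U) {z : Fin N → ℂ}
    (hz : Function.Injective z) (hzU : ∀ n, z n ∈ U) (h0 : ∀ n, f (z n) = 0)
    (h1 : ∀ n, deriv f (z n) ≠ 0) :
    ∃ g : ℂ → ℂ, ContinuousOn g S ∧ DifferentiableOn ℂ g U ∧
      (∀ w, f w = (∏ n, (w - z n)) * g w) ∧ ∀ n, g (z n) ≠ 0 := by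
  obtain ⟨g, hg, hgd, he⟩ := exists_eq_prod_mul hU hUS hf hd hz hzU h0 Finset.univ
  refine ⟨g, hg, hgd, he, fun n hn => h1 n ?_⟩
  have hfe : f = fun w => (w - z n) * ((∏ i ∈ Finset.univ.erase n, (w - z i)) * g w) := by
    funext w
    rw [he w, ← Finset.mul_prod_erase _ _ (Finset.mem_univ n)]
    ring
  have hg1 := hgd.differentiableAt (hU.mem_nhds (hzU n))
  have hh : DifferentiableAt ℂ (fun w => (∏ i ∈ Finset.univ.erase n, (w - z i)) * g w) (z n) :=
    DifferentiableAt.mul (by fun_prop) hg1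
  have := ((hasDerivAt_id (z n)).sub_const (z n)).mul hh.hasDerivAt
  rw [hfe]
  refine HasDerivAt.deriv (this.congr_deriv ?_)
  simp [hn]

/-! ### Logarithms -/

theorem eqOn_of_exp_eqOn {A : Type*} [TopologicalSpace A] {S : Set A} (hS : IsPreconnected S)
    {f g : A → ℂ} (hf : ContinuousOn f S)
    (hg : ContinuousOn g S) (h : ∀ s ∈ S, Complex.exp (f s) = Complex.exp (g s)) {a : A}
    (ha : a ∈ S) (hfg : f a = g a) : EqOn f g S :=
  Complex.isCoveringMap_exp.eqOn_of_comp_eqOn hS hf hg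
    (fun s hs => Subtype.ext (h s hs)) ha hfg

theorem eqOn_add_const_of_exp_eqOn {S : Set ℂ} (hS : IsPreconnected S) {f g : ℂ → ℂ}
    (hf : ContinuousOn f S) (hg : ContinuousOn g S)
    (h : ∀ s ∈ S, Complex.exp (f s) = Complex.exp (g s)) {a : ℂ} (ha : a ∈ S) :
    EqOn f (fun s => g s + (f a - g a)) S := by
  refine eqOn_of_exp_eqOn hS hf (hg.add continuousOn_const) (fun s hs => ?_) ha (by ring)
  rw [Complex.exp_add, Complex.exp_sub, h a ha, div_self (Complex.exp_ne_zero _), mul_one, h s hs]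

/-- Near `s` continuity keeps `F w - F s` within imaginary part `π`, so it coincides with the
principal logarithm of `b w / b s`, which is holomorphic. -/
theorem differentiableOn_of_exp_eqOn {U : Set ℂ} (hU : IsOpen U) {F b : ℂ → ℂ}
    (hF : ContinuousOn F U) (hb : DifferentiableOn ℂ b U)
    (h : ∀ s ∈ U, Complex.exp (F s) = b s) : DifferentiableOn ℂ F U := by
  intro s hs
  have hUs := hU.mem_nhds hs
  have hne : b s ≠ 0 := h s hs ▸ Complex.exp_ne_zero _
  have h1 : DifferentiableAt ℂ (fun w => F s + Complex.log (b w / b s)) s :=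
    (((hb.differentiableAt hUs).div_const (b s)).clog
      (by rw [div_self hne]; exact Complex.one_mem_slitPlane)).const_add (F s)
  refine (h1.congr_of_eventuallyEq ?_).differentiableWithinAt
  have h2 : ∀ᶠ w in 𝓝 s, F w ∈ Metric.ball (F s) Real.pi :=
    (hF.continuousAt hUs).eventually (Metric.ball_mem_nhds _ Real.pi_pos)
  filter_upwards [h2, hUs] with w hw hwU
  have h3 : |(F w - F s).im| < Real.pi := by
    rw [Metric.mem_ball, dist_eq_norm] at hw
    exact (Complex.abs_im_le_norm _).trans_lt hw
  rw [← h w hwU, ← h s hs, ← Complex.exp_sub, Complex.log_exp (abs_lt.1 h3).1 (abs_lt.1 h3).2.le]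
  ring

/-! ### The logarithm on the quarter strip -/

theorem isOpen_ostrip₁ : IsOpen ostrip₁ := isOpen_Ioi.reProdIm isOpen_Ioo

theorem ostrip₁_subset : ostrip₁ ⊆ strip₁ :=
  inter_subset_inter (preimage_mono Ioi_subset_Ici_self) (preimage_mono Ioo_subset_Icc_self)

theorem brL_notMem_ostrip₁ : brL ∉ ostrip₁ := fun h => by
  have := h.1
  simp [brL_re] at this

theorem brL_mem_strip₁ : brL ∈ strip₁ := by
  rw [strip₁, Complex.mem_reProdIm, brL_re, brL_im]
  have := Real.pi_pos
  exact ⟨self_mem_Ici, by linarith, by linarith⟩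

theorem ostrip₁_subset' : ostrip₁ ⊆ strip₁ \ {brL} := fun _ hs =>
  ⟨ostrip₁_subset hs, fun h => brL_notMem_ostrip₁ (mem_singleton_iff.1 h ▸ hs)⟩

theorem convex_reProdIm {A B : Set ℝ} (hA : Convex ℝ A) (hB : Convex ℝ B) :
    Convex ℝ (A ×ℂ B) :=
  (hA.linear_preimage Complex.reLm).inter (hB.linear_preimage Complex.imLm)

theorem convex_ostrip₁ : Convex ℝ ostrip₁ := convex_reProdIm (convex_Ioi 0) (convex_Ioo _ _)

theorem brL_add_one_mem : brL + 1 ∈ ostrip₁ := by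
  rw [ostrip₁, Complex.mem_reProdIm]
  have := Real.pi_pos
  simp only [Complex.add_re, Complex.add_im, brL_re, brL_im, Complex.one_re, Complex.one_im]
  exact ⟨by simp, by linarith, by linarith⟩

theorem add_smul_mem_ostrip₁ {s : ℂ} (hs : s ∈ strip₁) {x : ℝ} (hx : 0 < x) (hx1 : x ≤ 1) :
    s + (x : ℂ) * (brL + 1 - s) ∈ ostrip₁ := by
  have := Real.pi_pos
  rw [strip₁, Complex.mem_reProdIm] at hs
  obtain ⟨h1, h2, h3⟩ := hs
  have h1 : 0 ≤ s.re := h1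
  rw [ostrip₁, Complex.mem_reProdIm]
  simp only [Complex.add_re, Complex.add_im, Complex.re_ofReal_mul, Complex.im_ofReal_mul,
    Complex.sub_re, Complex.sub_im, brL_re, brL_im, Complex.one_re, Complex.one_im, mem_Ioi, mem_Ioo]
  refine ⟨?_, ?_, ?_⟩ <;> nlinarith

/-- The centre is interior to the strip, so a segment from it stays in the open strip until its
endpoint and cannot meet the boundary point `brL` unless it ends there. -/
theorem starConvex_strip₁_diff : StarConvex ℝ (brL + 1) (strip₁ \ {brL}) := by
  rw [starConvex_iff_forall_pos (ostrip₁_subset' brL_add_one_mem)]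
  intro s hs a b ha hb hab
  have h := add_smul_mem_ostrip₁ hs.1 ha (by linarith)
  have e : a • (brL + 1) + b • s = s + (a : ℂ) * (brL + 1 - s) := by
    have hb' : (b : ℂ) = 1 - a := by rw [← Complex.ofReal_one, ← hab]; push_cast; ring
    rw [Complex.real_smul, Complex.real_smul, hb']
    ring
  rw [e]
  exact ostrip₁_subset' h

theorem sub_brL_mem_slitPlane {s : ℂ} (hs : s ∈ strip₁ \ {brL}) : s - brL ∈ Complex.slitPlane := by
  rw [Complex.mem_slitPlane_iff]
  have h1 : 0 ≤ s.re := hs.1.1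
  rcases h1.eq_or_lt with h | h
  · right
    intro h2
    refine hs.2 (Complex.ext ?_ ?_)
    · rw [← h, brL_re]
    · rw [Complex.sub_im] at h2
      linarith
  · left
    rw [Complex.sub_re, brL_re]
    linarith

/-- The filter `Re s → ∞` in the strip. -/
def rightEnd : Filter ℂ := comap Complex.re atTop ⊓ 𝓟 strip₁

/-- Far to the right `b` is near `1`, so its principal logarithm is continuous on a half strip and
tends to `0`. Connectedness makes `F₀` differ from it by one constant, a period of `exp`. -/
theorem exists_log_right {F₀ b : ℂ → ℂ} (hF : ContinuousOn F₀ (strip₁ \ {brL}))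
    (hexp : ∀ s ∈ strip₁ \ {brL}, Complex.exp (F₀ s) = b s) (hb : Tendsto b rightEnd (𝓝 1)) :
    ∃ c : ℂ, Complex.exp c = 1 ∧ Tendsto (fun s => F₀ s - c) rightEnd (𝓝 0) := by
  have hpi := Real.pi_pos
  have h1 : ∀ᶠ s in rightEnd, b s ∈ Complex.slitPlane :=
    hb (Complex.isOpen_slitPlane.mem_nhds Complex.one_mem_slitPlane)
  rw [rightEnd, eventually_inf_principal, eventually_comap] at h1
  obtain ⟨M, hM⟩ := eventually_atTop.1 h1
  set M' := max M 1
  have hMM : M ≤ M' := le_max_left _ _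
  have hM1 : 1 ≤ M' := le_max_right _ _
  set S : Set ℂ := Ici M' ×ℂ Icc (-Real.pi) 0 with hS
  have hSs : S ⊆ strip₁ := inter_subset_inter_left _ fun s hs =>
    zero_le_one.trans (hM1.trans hs)
  have hSp : S ⊆ strip₁ \ {brL} := fun s hs => ⟨hSs hs, fun h => by
    have h1 : M' ≤ s.re := hs.1
    rw [mem_singleton_iff.1 h, brL_re] at h1
    linarith⟩
  have hSl : ∀ s ∈ S, b s ∈ Complex.slitPlane := fun s hs =>
    hM s.re (hMM.trans hs.1) s rfl (hSs hs)
  have hbc : ContinuousOn b (strip₁ \ {brL}) :=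
    hF.cexp.congr fun s hs => (hexp s hs).symm
  have hlog : ContinuousOn (fun s => Complex.log (b s)) S := (hbc.mono hSp).clog hSl
  have ha : (M' : ℂ) ∈ S := by
    rw [hS, Complex.mem_reProdIm]
    simp [hpi.le]
  have hpre : IsPreconnected S := (convex_reProdIm (convex_Ici M') (convex_Icc _ _)).isPreconnected
  have he : ∀ s ∈ S, Complex.exp (F₀ s) = Complex.exp (Complex.log (b s)) := fun s hs => by
    rw [hexp s (hSp hs), Complex.exp_log (Complex.slitPlane_ne_zero (hSl s hs))]
  have heq := eqOn_add_const_of_exp_eqOn hpre (hF.mono hSp) hlog he ha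
  refine ⟨F₀ M' - Complex.log (b M'), ?_, ?_⟩
  · rw [Complex.exp_sub, he _ ha, div_self (Complex.exp_ne_zero _)]
  · have ht : Tendsto (fun s => Complex.log (b s)) rightEnd (𝓝 0) := by
      have := hb.clog Complex.one_mem_slitPlane
      rwa [Complex.log_one] at this
    refine ht.congr' ?_
    have hev : ∀ᶠ s in rightEnd, s ∈ S := by
      rw [rightEnd, eventually_inf_principal, eventually_comap]
      filter_upwards [eventually_ge_atTop M'] with x hx s hs hss
      exact ⟨by rw [mem_preimage, hs]; exact hx, hss.2⟩
    filter_upwards [hev] with s hs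
    rw [heq hs]
    ring

theorem exp_int_mul_log {x : ℂ} (hx : x ≠ 0) (m : ℤ) : Complex.exp (m * Complex.log x) = x ^ m := by
  rw [Complex.exp_int_mul, Complex.exp_log hx]

/-- Adding `m log (s - brL)` to `F` gives a logarithm `h` of a function with a nonzero limit. In a
small convex piece of the open strip `h` is a principal logarithm plus a constant, hence bounded;
boundary points are reached along segments into the strip. Thus `F` is `-m log (s - brL)` up to a
bounded term, and the argument in that logarithm is bounded as well. -/
theorem growth_of_log {F b : ℂ → ℂ} (hF : ContinuousOn F (strip₁ \ {brL}))
    (hexp : ∀ s ∈ strip₁ \ {brL}, Complex.exp (F s) = b s) {m : ℤ} {c : ℂ} (hc : c ≠ 0)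
    (hb : Tendsto (fun s => (s - brL) ^ m * b s) (𝓝[ostrip₁] brL) (𝓝 c)) :
    F =O[𝓝[strip₁ \ {brL}] brL] fun s => Real.log ‖s - brL‖ := by
  have hlogc : ContinuousOn (fun s => Complex.log (s - brL)) (strip₁ \ {brL}) :=
    ContinuousOn.clog (by fun_prop) fun s hs => sub_brL_mem_slitPlane hs
  set h : ℂ → ℂ := fun s => F s + m * Complex.log (s - brL) with hh
  have hhc : ContinuousOn h (strip₁ \ {brL}) := hF.add (continuousOn_const.mul hlogc)
  have hhe : ∀ s ∈ strip₁ \ {brL}, Complex.exp (h s) = (s - brL) ^ m * b s := fun s hs => by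
    rw [hh, Complex.exp_add, hexp s hs,
      exp_int_mul_log (Complex.slitPlane_ne_zero (sub_brL_mem_slitPlane hs)), mul_comm]
  have hb1 : Tendsto (fun s => Complex.exp (h s) / c) (𝓝[ostrip₁] brL) (𝓝 1) := by
    rw [← div_self hc]
    refine (hb.div_const c).congr' ?_
    filter_upwards [self_mem_nhdsWithin] with s hs
    rw [hhe s (ostrip₁_subset' hs)]
  obtain ⟨δ, hδ, hsl⟩ : ∃ δ > 0, ∀ s ∈ ostrip₁ ∩ Metric.ball brL δ,
      Complex.exp (h s) / c ∈ Complex.slitPlane := by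
    have := hb1 (Complex.isOpen_slitPlane.mem_nhds Complex.one_mem_slitPlane)
    obtain ⟨δ, hδ, hs⟩ := Metric.mem_nhdsWithin_iff.1 this
    exact ⟨δ, hδ, fun s hs' => hs ⟨hs'.2, hs'.1⟩⟩
  have hpre : IsPreconnected (ostrip₁ ∩ Metric.ball brL δ) :=
    (convex_ostrip₁.inter (convex_ball _ _)).isPreconnected
  have hsub : ostrip₁ ∩ Metric.ball brL δ ⊆ strip₁ \ {brL} := fun s hs => ostrip₁_subset' hs.1
  obtain ⟨a, ha⟩ : (ostrip₁ ∩ Metric.ball brL δ).Nonempty := by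
    refine ⟨brL + (min (δ / 2) 1 : ℝ) * (brL + 1 - brL),
      add_smul_mem_ostrip₁ brL_mem_strip₁ (by positivity) (min_le_right _ _), ?_⟩
    have : |min (δ / 2) 1| < δ := by
      rw [abs_of_pos (by positivity)]
      exact (min_le_left _ _).trans_lt (half_lt_self hδ)
    rwa [Metric.mem_ball, dist_eq_norm, add_sub_cancel_left, add_sub_cancel_left, mul_one,
      Complex.norm_real, Real.norm_eq_abs]
  set ℓ : ℂ → ℂ := fun s => Complex.log (Complex.exp (h s) / c) + Complex.log c
  have hℓ : ContinuousOn ℓ (ostrip₁ ∩ Metric.ball brL δ) :=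
    (((hhc.mono hsub).cexp.div_const c).clog hsl).add continuousOn_const
  have heq := eqOn_add_const_of_exp_eqOn hpre (hhc.mono hsub) hℓ (fun s hs => by
    rw [show ℓ s = Complex.log (Complex.exp (h s) / c) + Complex.log c from rfl,
      Complex.exp_add (Complex.log _), Complex.exp_log (Complex.slitPlane_ne_zero (hsl s hs)),
      Complex.exp_log hc, div_mul_cancel₀ _ hc]) ha
  have hht : Tendsto h (𝓝[ostrip₁] brL) (𝓝 (Complex.log 1 + Complex.log c + (h a - ℓ a))) := by
    refine (((hb1.clog Complex.one_mem_slitPlane).add_const (Complex.log c)).add_const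
      (h a - ℓ a)).congr' ?_
    filter_upwards [inter_mem_nhdsWithin _ (Metric.ball_mem_nhds _ hδ)] with s hs
    exact (heq hs).symm
  obtain ⟨C, hC⟩ := hht.norm.isBoundedUnder_le
  rw [eventually_map, eventually_nhdsWithin_iff, Metric.eventually_nhds_iff] at hC
  obtain ⟨δ', hδ', hC⟩ := hC
  have hbound : ∀ s ∈ strip₁ \ {brL}, dist s brL < δ' → ‖h s‖ ≤ C := by
    intro s hs hsd
    have hpath : Tendsto (fun x : ℝ => s + (x : ℂ) * (brL + 1 - s)) (𝓝[>] 0) (𝓝 s) := by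
      have : Continuous fun x : ℝ => s + (x : ℂ) * (brL + 1 - s) := by fun_prop
      have := this.tendsto 0
      simp only [Complex.ofReal_zero, zero_mul, add_zero] at this
      exact this.mono_left inf_le_left
    have hin : ∀ᶠ x : ℝ in 𝓝[>] 0, s + (x : ℂ) * (brL + 1 - s) ∈ ostrip₁ := by
      filter_upwards [Ioo_mem_nhdsGT (show (0 : ℝ) < 1 by norm_num)] with x hx
      exact add_smul_mem_ostrip₁ hs.1 hx.1 hx.2.le
    have ht := ((hhc s hs).tendsto.comp (tendsto_nhdsWithin_iff.2
      ⟨hpath, hin.mono fun x hx => ostrip₁_subset' hx⟩)).norm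
    refine le_of_tendsto ht ?_
    filter_upwards [hin, hpath (Metric.isOpen_ball.mem_nhds hsd)] with x hx hx'
    exact hC hx' hx
  have hO : h =O[𝓝[strip₁ \ {brL}] brL] fun s => Real.log ‖s - brL‖ := by
    refine IsBigO.trans (IsBigO.of_bound (g := fun _ => (1 : ℂ)) C ?_) (LogGood.const_isBigO 1)
    rw [eventually_nhdsWithin_iff, Metric.eventually_nhds_iff]
    exact ⟨δ', hδ', fun s hd hs => by simpa using hbound s hs hd⟩
  have hlO : (fun s => Complex.log (s - brL)) =O[𝓝[strip₁ \ {brL}] brL]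
      fun s => Real.log ‖s - brL‖ := by
    have h1 : (fun s => ((Real.log ‖s - brL‖ : ℝ) : ℂ)) =O[𝓝[strip₁ \ {brL}] brL]
        fun s => Real.log ‖s - brL‖ := IsBigO.of_norm_left (by simpa using (isBigO_refl _ _).norm_left)
    have h2 : (fun s => ((Complex.arg (s - brL) : ℝ) : ℂ) * Complex.I) =O[𝓝[strip₁ \ {brL}] brL]
        fun s => Real.log ‖s - brL‖ := by
      refine IsBigO.trans (IsBigO.of_bound (g := fun _ => (1 : ℂ)) Real.pi ?_)
        (LogGood.const_isBigO 1)
      exact Eventually.of_forall fun s => by simpa using Complex.abs_arg_le_pi _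
    exact h1.add h2
  have := hO.sub (hlO.const_mul_left (m : ℂ))
  refine this.congr_left fun s => ?_
  simp [hh]

theorem exists_logGood_log {b : ℂ → ℂ} (hbc : ContinuousOn b (strip₁ \ {brL}))
    (hb0 : ∀ s ∈ strip₁ \ {brL}, b s ≠ 0) (hbd : DifferentiableOn ℂ b ostrip₁)
    (hb1 : Tendsto b rightEnd (𝓝 1)) {m : ℤ} {c : ℂ} (hc : c ≠ 0)
    (hbm : Tendsto (fun s => (s - brL) ^ m * b s) (𝓝[ostrip₁] brL) (𝓝 c)) :
    ∃ F : ℂ → ℂ, LogGood F strip₁ ostrip₁ brL ∧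
      (∀ s ∈ strip₁ \ {brL}, Complex.exp (F s) = b s) ∧ Tendsto F rightEnd (𝓝 0) := by
  obtain ⟨F₀, hF₀, he₀⟩ := exists_continuousOn_log_of_starConvex starConvex_strip₁_diff
    (ostrip₁_subset' brL_add_one_mem) hbc hb0
  obtain ⟨k, hk, hlim⟩ := exists_log_right hF₀ he₀ hb1
  have hc' : ContinuousOn (fun s => F₀ s - k) (strip₁ \ {brL}) := hF₀.sub continuousOn_const
  have he : ∀ s ∈ strip₁ \ {brL}, Complex.exp (F₀ s - k) = b s := fun s hs => by
    rw [Complex.exp_sub, hk, div_one, he₀ s hs]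
  exact ⟨fun s => F₀ s - k, ⟨hc', differentiableOn_of_exp_eqOn isOpen_ostrip₁
    (hc'.mono ostrip₁_subset') hbd fun s hs => he s (ostrip₁_subset' hs),
    growth_of_log hc' he hc hbm⟩, he, hlim⟩

end KunduEckhaus

end

noncomputable section

namespace KunduEckhaus

open Set Asymptotics

/-! ### The exponential coordinate -/

/-- The point `ζ = q₀ eˢ`. -/
def expc (q₀ : ℝ) (s : ℂ) : ℂ := q₀ * Complex.exp s

theorem differentiable_expc (q₀ : ℝ) : Differentiable ℂ (expc q₀) := by
  unfold expc
  fun_prop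

theorem hasDerivAt_expc (q₀ : ℝ) (s : ℂ) : HasDerivAt (expc q₀) (expc q₀ s) s :=
  (Complex.hasDerivAt_exp s).const_mul _

theorem norm_expc {q₀ : ℝ} (hq₀ : 0 < q₀) (s : ℂ) : ‖expc q₀ s‖ = q₀ * Real.exp s.re := by
  rw [expc, norm_mul, Complex.norm_real, Complex.norm_exp, Real.norm_of_nonneg hq₀.le]

theorem im_expc (q₀ : ℝ) (s : ℂ) : (expc q₀ s).im = q₀ * Real.exp s.re * Real.sin s.im := by
  rw [expc, Complex.im_ofReal_mul, Complex.exp_im, mul_assoc]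

theorem expc_ne_zero {q₀ : ℝ} (hq₀ : 0 < q₀) (s : ℂ) : expc q₀ s ≠ 0 :=
  mul_ne_zero (by exact_mod_cast hq₀.ne') (Complex.exp_ne_zero _)

theorem conj_expc (q₀ : ℝ) (s : ℂ) : conj (expc q₀ s) = expc q₀ (conj s) := by
  simp [expc, Complex.exp_conj]

theorem expc_brL (q₀ : ℝ) : expc q₀ brL = -(Complex.I * q₀) := by
  have : brL = -Real.pi / 2 * Complex.I := by rw [brL]; ring
  rw [expc, this, Complex.exp_neg_pi_div_two_mul_I]
  ring

theorem expc_sub_pi (q₀ : ℝ) (s : ℂ) : expc q₀ (s - Real.pi * Complex.I) = -expc q₀ s := by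
  rw [expc, Complex.exp_sub, Complex.exp_pi_mul_I, expc]
  ring

theorem expc_add_pi (q₀ : ℝ) (s : ℂ) : expc q₀ (s + Real.pi * Complex.I) = -expc q₀ s := by
  rw [expc, Complex.exp_add, Complex.exp_pi_mul_I, expc]
  ring

theorem refl_expc {q₀ : ℝ} (hq₀ : 0 < q₀) (s : ℂ) :
    refl q₀ (expc q₀ s) = expc q₀ (-conj s - Real.pi * Complex.I) := by
  have : (q₀ : ℂ) ≠ 0 := by exact_mod_cast hq₀.ne'
  rw [expc_sub_pi, refl, conj_expc, expc, expc, Complex.exp_neg]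
  have := Complex.exp_ne_zero (conj s)
  field_simp

theorem expc_norm_ge {q₀ : ℝ} (hq₀ : 0 < q₀) {s : ℂ} (hs : s ∈ strip₁) : q₀ ≤ ‖expc q₀ s‖ := by
  rw [norm_expc hq₀]
  exact le_mul_of_one_le_right hq₀.le (Real.one_le_exp hs.1)

theorem expc_im_nonpos {q₀ : ℝ} (hq₀ : 0 < q₀) {s : ℂ} (hs : s ∈ strip₁) :
    (expc q₀ s).im ≤ 0 := by
  rw [im_expc]
  exact mul_nonpos_of_nonneg_of_nonpos (by positivity)
    (Real.sin_nonpos_of_nonpos_of_neg_pi_le hs.2.2 hs.2.1)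

theorem expc_mem_Dminus {q₀ : ℝ} (hq₀ : 0 < q₀) {s : ℂ} (hs : s ∈ ostrip₁) :
    expc q₀ s ∈ Dminus q₀ := by
  have h1 : q₀ < ‖expc q₀ s‖ := by
    rw [norm_expc hq₀]
    exact lt_mul_of_one_lt_right hq₀ (Real.one_lt_exp_iff.2 hs.1)
  have h2 : (expc q₀ s).im < 0 := by
    rw [im_expc]
    exact mul_neg_of_pos_of_neg (by positivity) (Real.sin_neg_of_neg_of_neg_pi_lt hs.2.2 hs.2.1)
  exact mul_neg_of_pos_of_neg (by nlinarith) h2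

theorem expc_mem_DminusCl {q₀ : ℝ} (hq₀ : 0 < q₀) {s : ℂ} (hs : s ∈ strip₁ \ {brL}) :
    expc q₀ s ∈ DminusCl q₀ := by
  have hpi := Real.pi_pos
  have h1 := expc_norm_ge hq₀ hs.1
  have h2 := expc_im_nonpos hq₀ hs.1
  rw [mem_DminusCl_iff hq₀]
  refine ⟨mul_nonpos_of_nonneg_of_nonpos (by nlinarith) h2, expc_ne_zero hq₀ s, fun h => ?_,
    fun h => hs.2 ?_⟩
  · rw [h] at h2
    simp at h2
    linarith
  · rw [← expc_brL] at h
    obtain ⟨n, hn⟩ := Complex.exp_eq_exp_iff_exists_int.1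
      (mul_left_cancel₀ (by exact_mod_cast hq₀.ne') h)
    have him := congrArg Complex.im hn
    have hc : ((n : ℂ) * (2 * Real.pi * Complex.I)).im = n * (2 * Real.pi) := by simp
    rw [Complex.add_im, brL_im, hc] at him
    have h3 : -Real.pi ≤ s.im := hs.1.2.1
    have h4 : s.im ≤ 0 := hs.1.2.2
    have h5 : (-1 : ℝ) < n := by nlinarith
    have h6 : (n : ℝ) < 1 := by nlinarith
    have hn0 : n = 0 := by
      have : -1 < n := by exact_mod_cast h5
      have : n < 1 := by exact_mod_cast h6
      omega
    rw [hn, hn0]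
    simp

theorem tendsto_expc_rightEnd {q₀ : ℝ} (hq₀ : 0 < q₀) :
    Tendsto (expc q₀) rightEnd (Bornology.cobounded ℂ ⊓ 𝓟 (DminusCl q₀)) := by
  have hre : Tendsto Complex.re rightEnd atTop := tendsto_comap.mono_left inf_le_left
  refine tendsto_inf.2 ⟨?_, ?_⟩
  · rw [← tendsto_norm_atTop_iff_cobounded]
    simp only [norm_expc hq₀]
    exact (Real.tendsto_exp_atTop.comp hre).const_mul_atTop hq₀
  · rw [tendsto_principal]
    have h1 : ∀ᶠ s in rightEnd, s ∈ strip₁ := mem_inf_of_right (mem_principal_self _)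
    filter_upwards [h1, hre.eventually (eventually_gt_atTop 0)] with s hs hpos
    exact expc_mem_DminusCl hq₀ ⟨hs, fun h => by
      rw [mem_singleton_iff.1 h, brL_re] at hpos
      exact lt_irrefl _ hpos⟩

/-! ### The Blaschke product -/

section Blaschke

variable {q₀ : ℝ} {N : ℕ} {z : Fin N → ℂ}

theorem blaschke_eq_prod_refl (w : ℂ) : blaschke q₀ z w =
    ∏ n, ((w - z n) * (w - refl q₀ (z n))) / ((w - conj (z n)) * (w - conj (refl q₀ (z n)))) := by
  simp only [blaschke, refl, map_neg, map_div₀, map_pow, Complex.conj_ofReal, Complex.conj_conj,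
    sub_neg_eq_add]

/-- The factor of the Blaschke product without zeros in the outer lower domain. -/
def blaschkeRest (q₀ : ℝ) {N : ℕ} (z : Fin N → ℂ) (w : ℂ) : ℂ :=
  ∏ n, (w - refl q₀ (z n)) / ((w - conj (z n)) * (w - conj (refl q₀ (z n))))

theorem blaschke_eq_mul (w : ℂ) :
    blaschke q₀ z w = (∏ n, (w - z n)) * blaschkeRest q₀ z w := by
  rw [blaschke_eq_prod_refl, blaschkeRest, ← Finset.prod_mul_distrib]
  exact Finset.prod_congr rfl fun n _ => mul_div_assoc _ _ _

theorem conj_blaschke_conj (w : ℂ) : conj (blaschke q₀ z (conj w)) = (blaschke q₀ z w)⁻¹ := by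
  simp only [blaschke_eq_prod_refl, map_prod, map_div₀, map_mul, map_sub, Complex.conj_conj,
    ← Finset.prod_inv_distrib, inv_div]

/-- For each `n` the reflection exchanges the two numerator factors, and likewise the two
denominator factors, up to conjugation and scalars. The scalars leave the phase `(z n / conj (z n))
^ 2`, the source of `4 arg z_n` in the theta condition. -/
theorem blaschke_refl (hq₀ : q₀ ≠ 0) (hz : ∀ n, z n ≠ 0) {w : ℂ} (hw : w ≠ 0) :
    blaschke q₀ z (refl q₀ w) = (∏ n, (z n / conj (z n)) ^ 2) * conj (blaschke q₀ z w) := by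
  have hq : (q₀ : ℂ) ≠ 0 := by exact_mod_cast hq₀
  have hcw : conj w ≠ 0 := by simpa using hw
  simp only [blaschke_eq_prod_refl, map_prod, ← Finset.prod_mul_distrib]
  refine Finset.prod_congr rfl fun n _ => ?_
  have h0 := hz n
  have hc0 : conj (z n) ≠ 0 := by simpa using h0
  have e1 : refl q₀ w - z n = -(z n / conj w) * (conj w - conj (refl q₀ (z n))) := by
    simp only [refl, map_neg, map_div₀, map_pow, Complex.conj_ofReal, Complex.conj_conj]
    field_simp
    ring
  have e2 : refl q₀ w - refl q₀ (z n) = (q₀ ^ 2 / (conj w * conj (z n))) * (conj w - conj (z n)) := by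
    simp only [refl]
    field_simp
    ring
  have e3 : refl q₀ w - conj (z n) = -(conj (z n) / conj w) * (conj w - refl q₀ (z n)) := by
    simp only [refl]
    field_simp
    ring
  have e4 : refl q₀ w - conj (refl q₀ (z n)) = (q₀ ^ 2 / (conj w * z n)) * (conj w - z n) := by
    simp only [refl, map_neg, map_div₀, map_pow, Complex.conj_ofReal, Complex.conj_conj]
    field_simp
    ring
  rw [e1, e2, e3, e4]
  simp only [map_div₀, map_mul, map_sub, Complex.conj_conj]
  have e5 : ∀ a b c d : ℂ, -(z n / conj w) * a * (q₀ ^ 2 / (conj w * conj (z n)) * b) /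
      (-(conj (z n) / conj w) * c * (q₀ ^ 2 / (conj w * z n) * d)) =
      (z n / conj (z n)) ^ 2 * (b * a / (d * c)) := by
    intro a b c d
    rw [show -(z n / conj w) * a * (q₀ ^ 2 / (conj w * conj (z n)) * b) =
        (z n / conj (z n)) ^ 2 * (b * a) * (-(conj (z n) / conj w) * (q₀ ^ 2 / (conj w * z n))) by
        field_simp,
      show -(conj (z n) / conj w) * c * (q₀ ^ 2 / (conj w * z n) * d) =
        d * c * (-(conj (z n) / conj w) * (q₀ ^ 2 / (conj w * z n))) by ring,
      mul_div_mul_right _ _ (mul_ne_zero (neg_ne_zero.2 (div_ne_zero hc0 hcw))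
        (div_ne_zero (pow_ne_zero 2 hq) (mul_ne_zero hcw h0))), mul_div_assoc]
  exact e5 _ _ _ _

theorem tendsto_div_sub_cobounded (a c : ℂ) :
    Tendsto (fun w => (w - a) / (w - c)) (Bornology.cobounded ℂ) (𝓝 1) := by
  have h1 : Tendsto (fun w : ℂ => w - c) (Bornology.cobounded ℂ) (Bornology.cobounded ℂ) :=
    tendsto_sub_const_cobounded c
  have h2 := ((tendsto_inv₀_cobounded.comp h1).const_mul (c - a)).const_add 1
  rw [mul_zero, add_zero] at h2
  refine h2.congr' ?_
  filter_upwards [h1.eventually (Bornology.eventually_ne_cobounded 0)] with w hw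
  have hw : w - c ≠ 0 := hw
  simp only [Function.comp]
  field_simp
  ring

theorem tendsto_blaschke_cobounded :
    Tendsto (blaschke q₀ z) (Bornology.cobounded ℂ) (𝓝 1) := by
  have h : Tendsto (fun w => ∏ n, ((w - z n) / (w - conj (z n)) *
      ((w - refl q₀ (z n)) / (w - conj (refl q₀ (z n)))))) (Bornology.cobounded ℂ)
      (𝓝 (∏ _n : Fin N, (1 * 1 : ℂ))) :=
    tendsto_finsetProd _ fun n _ => (tendsto_div_sub_cobounded _ _).mul (tendsto_div_sub_cobounded _ _)
  simp only [mul_one, Finset.prod_const_one] at h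
  refine h.congr fun w => ?_
  rw [blaschke_eq_prod_refl]
  exact Finset.prod_congr rfl fun n _ => div_mul_div_comm _ _ _ _

variable (hq₀ : 0 < q₀) (hz : ∀ n, q₀ < ‖z n‖ ∧ (z n).im < 0) {w : ℂ} (hw : q₀ ≤ ‖w‖ ∧ w.im ≤ 0)
include hq₀ hz hw

/-- Outside the circle and in the closed lower half plane only `z n` itself occurs: `refl q₀ (z n)`
and `conj (z n)` lie in the upper half plane, and `conj (refl q₀ (z n))` lies inside the circle. -/
theorem blaschke_factors_ne_zero (n : Fin N) :
    w - refl q₀ (z n) ≠ 0 ∧ w - conj (z n) ≠ 0 ∧ w - conj (refl q₀ (z n)) ≠ 0 := by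
  have hpos : 0 < ‖z n‖ := hq₀.trans (hz n).1
  refine ⟨fun h => ?_, fun h => ?_, fun h => ?_⟩ <;> rw [sub_eq_zero] at h
  · have h1 := hw.2
    rw [h, refl_eq, Complex.im_ofReal_mul] at h1
    have : 0 < q₀ ^ 2 / ‖z n‖ ^ 2 := by positivity
    nlinarith [(hz n).2]
  · have h1 := hw.2
    rw [h, Complex.conj_im] at h1
    linarith [(hz n).2]
  · have h1 := hw.1
    rw [h, RCLike.norm_conj, norm_refl, le_div_iff₀ hpos] at h1
    nlinarith [(hz n).1]

theorem blaschkeRest_ne_zero : blaschkeRest q₀ z w ≠ 0 :=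
  Finset.prod_ne_zero_iff.2 fun n _ => by
    obtain ⟨h1, h2, h3⟩ := blaschke_factors_ne_zero hq₀ hz hw n
    exact div_ne_zero h1 (mul_ne_zero h2 h3)

theorem differentiableAt_blaschkeRest : DifferentiableAt ℂ (blaschkeRest q₀ z) w := by
  unfold blaschkeRest
  refine DifferentiableAt.fun_finsetProd fun n _ => ?_
  obtain ⟨h1, h2, h3⟩ := blaschke_factors_ne_zero hq₀ hz hw n
  exact DifferentiableAt.div (by fun_prop) (by fun_prop) (mul_ne_zero h2 h3)

end Blaschke

end KunduEckhaus

end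

noncomputable section

namespace KunduEckhaus

open Set Asymptotics

/-! ### The logarithm of `s₁₁` divided by its Blaschke product -/

/-- `F` is a logarithm of `s₁₁/B` in the coordinate `s` on the quarter strip. -/
structure IsScatLog (q₀ : ℝ) (qm qp : ℂ) (q : ℝ → ℝ → ℂ) (t : ℝ) {N : ℕ} (z : Fin N → ℂ)
    (F : ℂ → ℂ) (α : ℝ) : Prop where
  good : LogGood F strip₁ ostrip₁ brL
  eq : ∀ s ∈ strip₁ \ {brL},
    s11 q₀ qm qp q t (expc q₀ s) = Complex.exp (F s) * blaschke q₀ z (expc q₀ s)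
  lim : Tendsto F rightEnd (𝓝 0)
  corner : F (-(Real.pi * Complex.I)) = conj (F 0) + α * Complex.I
  theta : Complex.exp (α * Complex.I) * ∏ n, (z n / conj (z n)) ^ 2 = qm / qp

/-- The derivative of `expc` at `brL` is `-(I q₀) ≠ 0`, so `s - brL` and `expc q₀ s - expc q₀ brL`
have a nonzero limiting ratio and the exponent `m` is unchanged. -/
theorem tendsto_zpow_mul_expc {q₀ : ℝ} (hq₀ : 0 < q₀) {f D : ℂ → ℂ} {m : ℤ} {c d : ℂ}
    (hc : c ≠ 0) (hd : d ≠ 0)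
    (hf : Tendsto (fun w => (w - -(Complex.I * q₀)) ^ m * f w) (𝓝[Dminus q₀] (-(Complex.I * q₀)))
      (𝓝 c)) (hD : Tendsto D (𝓝 (-(Complex.I * q₀))) (𝓝 d)) :
    ∃ c' : ℂ, c' ≠ 0 ∧ Tendsto (fun s => (s - brL) ^ m * (f (expc q₀ s) / D (expc q₀ s)))
      (𝓝[ostrip₁] brL) (𝓝 c') := by
  have ht : Tendsto (expc q₀) (𝓝[ostrip₁] brL) (𝓝[Dminus q₀] (-(Complex.I * q₀))) := by
    refine tendsto_nhdsWithin_iff.2 ⟨?_, ?_⟩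
    · have := (differentiable_expc q₀).continuous.tendsto brL
      rw [expc_brL] at this
      exact this.mono_left inf_le_left
    · filter_upwards [self_mem_nhdsWithin] with s hs using expc_mem_Dminus hq₀ hs
  have hne : -(Complex.I * q₀) ≠ 0 := by simpa using hq₀.ne'
  have hslope : Tendsto (slope (expc q₀) brL) (𝓝[ostrip₁] brL) (𝓝 (-(Complex.I * q₀))) := by
    have h := (hasDerivAt_expc q₀ brL).tendsto_slope
    rw [expc_brL] at h
    exact h.mono_left (nhdsWithin_mono _ fun s hs h => brL_notMem_ostrip₁ (h ▸ hs))
  have h1 := ((hslope.zpow₀ m (Or.inl hne)).inv₀ (zpow_ne_zero m hne)).mul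
    ((hf.comp ht).div (hD.comp (ht.mono_right nhdsWithin_le_nhds)) hd)
  refine ⟨_, mul_ne_zero (inv_ne_zero (zpow_ne_zero m hne)) (div_ne_zero hc hd), h1.congr' ?_⟩
  filter_upwards [self_mem_nhdsWithin] with s hs
  have hsb : s - brL ≠ 0 := sub_ne_zero.2 fun h => brL_notMem_ostrip₁ (h ▸ hs)
  have hw : expc q₀ s - -(Complex.I * q₀) ≠ 0 := by
    intro h
    have h1 := expc_mem_Dminus hq₀ hs
    have hq : (‖-(Complex.I * (q₀ : ℂ))‖ ^ 2 - q₀ ^ 2) * (-(Complex.I * (q₀ : ℂ))).im < 0 := by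
      rw [← sub_eq_zero.1 h]
      exact h1
    simp at hq
  simp only [Function.comp, Pi.div_apply, slope_def_field, expc_brL, div_zpow, inv_div]
  have h2 := zpow_ne_zero m hw
  have h3 := zpow_ne_zero m hsb
  field_simp

namespace IsPotential

variable {q₀ : ℝ} {qm qp : ℂ} {q : ℝ → ℝ → ℂ} {t : ℝ} (H : IsPotential q₀ qm qp q t)
include H

theorem exists_logGood_s11 {N : ℕ} {z : Fin N → ℂ} (hz_inj : Function.Injective z)
    (hz_zeros : ∀ w : ℂ, (w ∈ Dminus q₀ ∧ w.im < 0 ∧ s11 q₀ qm qp q t w = 0) ↔ ∃ n, z n = w)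
    (hz_simple : ∀ n, deriv (s11 q₀ qm qp q t) (z n) ≠ 0)
    (hs11 : ∀ ζ ∈ Sigma0 q₀, s11 q₀ qm qp q t ζ ≠ 0) {m : ℤ} {c : ℂ} (hc : c ≠ 0)
    (hbr : Tendsto (fun w => (w - -(Complex.I * q₀)) ^ m * s11 q₀ qm qp q t w)
      (𝓝[Dminus q₀] (-(Complex.I * q₀))) (𝓝 c)) :
    ∃ F : ℂ → ℂ, LogGood F strip₁ ostrip₁ brL ∧ (∀ s ∈ strip₁ \ {brL},
      s11 q₀ qm qp q t (expc q₀ s) = Complex.exp (F s) * blaschke q₀ z (expc q₀ s)) ∧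
      Tendsto F rightEnd (𝓝 0) := by
  have hq₀ := H.pos
  have hzn : ∀ n, z n ∈ Dminus q₀ ∧ (z n).im < 0 ∧ s11 q₀ qm qp q t (z n) = 0 := fun n =>
    (hz_zeros _).2 ⟨n, rfl⟩
  have hzg : ∀ n, q₀ < ‖z n‖ ∧ (z n).im < 0 := fun n => by
    obtain ⟨h1, h2, -⟩ := hzn n
    have h1 : (‖z n‖ ^ 2 - q₀ ^ 2) * (z n).im < 0 := h1
    refine ⟨?_, h2⟩
    have h3 : 0 < ‖z n‖ ^ 2 - q₀ ^ 2 := by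
      by_contra! h
      nlinarith
    nlinarith [norm_nonneg (z n)]
  obtain ⟨g, hg, hgd, hge, hgz⟩ := exists_eq_prod_mul_of_simple (isOpen_Dminus q₀)
    subset_union_left H.continuousOn_s11 H.differentiableOn_s11 hz_inj (fun n => (hzn n).1)
    (fun n => (hzn n).2.2) hz_simple
  have hK : ∀ s ∈ strip₁, q₀ ≤ ‖expc q₀ s‖ ∧ (expc q₀ s).im ≤ 0 := fun s hs =>
    ⟨expc_norm_ge hq₀ hs, expc_im_nonpos hq₀ hs⟩
  have hC0 : ∀ s ∈ strip₁, blaschkeRest q₀ z (expc q₀ s) ≠ 0 := fun s hs =>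
    blaschkeRest_ne_zero hq₀ hzg (hK s hs)
  have hg0 : ∀ s ∈ strip₁ \ {brL}, g (expc q₀ s) ≠ 0 := by
    intro s hs h0
    have hcl := expc_mem_DminusCl hq₀ hs
    have hs0 : s11 q₀ qm qp q t (expc q₀ s) = 0 := by rw [hge, h0, mul_zero]
    rcases hcl with hD | hS
    · have him : (expc q₀ s).im < 0 := (hK s hs.1).2.lt_of_ne fun h => by
        have hD : (‖expc q₀ s‖ ^ 2 - q₀ ^ 2) * (expc q₀ s).im < 0 := hD
        rw [h, mul_zero] at hD
        exact lt_irrefl _ hD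
      obtain ⟨n, hn⟩ := (hz_zeros _).1 ⟨hD, him, hs0⟩
      exact hgz n (hn ▸ h0)
    · exact hs11 _ hS hs0
  have hBe : ∀ w, blaschke q₀ z w ≠ 0 → blaschkeRest q₀ z w ≠ 0 →
      s11 q₀ qm qp q t w / blaschke q₀ z w = g w / blaschkeRest q₀ z w := by
    intro w hw hw'
    rw [blaschke_eq_mul] at hw ⊢
    rw [hge, mul_div_mul_left _ _ (left_ne_zero_of_mul hw)]
  -- The factors `w - z n` are cancelled beforehand, so `b` is continuous and nonzero also at the
  -- zeros, where `s11 / blaschke` would be the junk value of `0 / 0`.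
  set b : ℂ → ℂ := fun s => g (expc q₀ s) / blaschkeRest q₀ z (expc q₀ s) with hb
  have hexpc := differentiable_expc q₀
  have hbc : ContinuousOn b (strip₁ \ {brL}) :=
    (hg.comp hexpc.continuous.continuousOn fun s hs => expc_mem_DminusCl hq₀ hs).div
      (fun s hs => ((differentiableAt_blaschkeRest hq₀ hzg (hK s hs.1)).continuousAt.comp
        hexpc.continuous.continuousAt).continuousWithinAt) fun s hs => hC0 s hs.1
  have hbd : DifferentiableOn ℂ b ostrip₁ :=
    (hgd.comp hexpc.differentiableOn fun s hs => expc_mem_Dminus hq₀ hs).div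
      (fun s hs => ((differentiableAt_blaschkeRest hq₀ hzg (hK s (ostrip₁_subset hs))).comp s
        (hexpc s)).differentiableWithinAt) fun s hs => hC0 s (ostrip₁_subset hs)
  have hstrip : ∀ᶠ s in rightEnd, s ∈ strip₁ := mem_inf_of_right (mem_principal_self _)
  have hb1 : Tendsto b rightEnd (𝓝 1) := by
    have ht := tendsto_expc_rightEnd hq₀
    have hB := (tendsto_blaschke_cobounded (q₀ := q₀) (z := z)).comp (ht.mono_right inf_le_left)
    have h := (H.tendsto_s11.comp ht).div hB one_ne_zero
    rw [div_one] at h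
    refine h.congr' ?_
    filter_upwards [hstrip, hB.eventually_ne one_ne_zero] with s hs hB
    exact hBe _ hB (hC0 s hs)
  have hp : q₀ ≤ ‖-(Complex.I * (q₀ : ℂ))‖ ∧ (-(Complex.I * (q₀ : ℂ))).im ≤ 0 := by
    rw [← expc_brL]
    exact hK _ brL_mem_strip₁
  have hpz : ∀ n, -(Complex.I * (q₀ : ℂ)) - z n ≠ 0 := fun n h => by
    have h1 := (hzg n).1
    rw [← sub_eq_zero.1 h, norm_neg, norm_mul, Complex.norm_I, one_mul, Complex.norm_real,
      Real.norm_of_nonneg hq₀.le] at h1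
    exact lt_irrefl _ h1
  have hprod : ∏ n, (-(Complex.I * (q₀ : ℂ)) - z n) ≠ 0 := Finset.prod_ne_zero_iff.2 fun n _ => hpz n
  have hBp : Tendsto (blaschke q₀ z) (𝓝 (-(Complex.I * q₀)))
      (𝓝 ((∏ n, (-(Complex.I * (q₀ : ℂ)) - z n)) * blaschkeRest q₀ z (-(Complex.I * q₀)))) := by
    have h1 : Continuous fun w : ℂ => ∏ n, (w - z n) := by fun_prop
    refine ((h1.tendsto _).mul
      (differentiableAt_blaschkeRest hq₀ hzg hp).continuousAt.tendsto).congr fun w => ?_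
    rw [blaschke_eq_mul]
  have hBp0 := mul_ne_zero hprod (blaschkeRest_ne_zero hq₀ hzg hp)
  obtain ⟨c', hc', hbr'⟩ := tendsto_zpow_mul_expc hq₀ hc hBp0 hbr hBp
  have hbm : Tendsto (fun s => (s - brL) ^ m * b s) (𝓝[ostrip₁] brL) (𝓝 c') := by
    refine hbr'.congr' ?_
    have ht : Tendsto (expc q₀) (𝓝[ostrip₁] brL) (𝓝 (-(Complex.I * q₀))) := by
      have := hexpc.continuous.tendsto brL
      rw [expc_brL] at this
      exact this.mono_left inf_le_left
    filter_upwards [self_mem_nhdsWithin, (hBp.comp ht).eventually_ne hBp0] with s hs hs'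
    rw [hBe _ hs' (hC0 s (ostrip₁_subset hs))]
  obtain ⟨F, hF, hFe, hF0⟩ := exists_logGood_log hbc
    (fun s hs => div_ne_zero (hg0 s hs) (hC0 s hs.1)) hbd hb1 hc' hbm
  refine ⟨F, hF, fun s hs => ?_, hF0⟩
  rw [hFe s hs, hb, blaschke_eq_mul, hge]
  have := hC0 s hs.1
  field_simp

theorem exists_isScatLog {N : ℕ} {z : Fin N → ℂ} (hz0 : ∀ n, z n ≠ 0) {F : ℂ → ℂ}
    (hs11 : ∀ ζ ∈ Sigma0 q₀, s11 q₀ qm qp q t ζ ≠ 0) (hF : LogGood F strip₁ ostrip₁ brL)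
    (he : ∀ s ∈ strip₁ \ {brL},
      s11 q₀ qm qp q t (expc q₀ s) = Complex.exp (F s) * blaschke q₀ z (expc q₀ s))
    (hlim : Tendsto F rightEnd (𝓝 0)) : ∃ α : ℝ, IsScatLog q₀ qm qp q t z F α := by
  have hpi := Real.pi_pos
  have hq₀ := H.pos
  have hm0 : (0 : ℂ) ∈ strip₁ \ {brL} := by
    refine ⟨?_, fun h => ?_⟩
    · rw [strip₁, Complex.mem_reProdIm]
      simp [hpi.le]
    · have := congrArg Complex.im (mem_singleton_iff.1 h)
      rw [brL_im, Complex.zero_im] at this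
      linarith
  have hm1 : -(Real.pi * Complex.I) ∈ strip₁ \ {brL} := by
    refine ⟨?_, fun h => ?_⟩
    · rw [strip₁, Complex.mem_reProdIm]
      simp [hpi.le]
    · have := congrArg Complex.im (mem_singleton_iff.1 h)
      rw [brL_im] at this
      simp at this
      linarith
  have hqz : expc q₀ 0 ∈ Sigma0 q₀ := by
    have hq : (q₀ : ℂ) ≠ 0 := by exact_mod_cast hq₀.ne'
    have e : expc q₀ 0 = q₀ := by simp [expc]
    rw [e]
    refine ⟨Or.inl (Complex.ofReal_im _), hq, fun h => ?_, fun h => ?_⟩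
    · have := congrArg Complex.re h
      simp at this
      exact hq₀.ne' this
    · have := congrArg Complex.re h
      simp at this
      exact hq₀.ne' this
  have hr : refl q₀ (expc q₀ 0) = expc q₀ (-(Real.pi * Complex.I)) := by
    rw [refl_expc hq₀]
    simp
  have h0 := he 0 hm0
  have h1 := he _ hm1
  set β : ℂ := ∏ n, (z n / conj (z n)) ^ 2 with hβ
  have hnβ : ‖β‖ = 1 := by
    rw [hβ, norm_prod]
    refine Finset.prod_eq_one fun n _ => ?_
    have : ‖z n‖ ≠ 0 := norm_ne_zero_iff.2 (hz0 n)
    rw [norm_pow, norm_div, RCLike.norm_conj, div_self this, one_pow]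
  have hnκ : ‖qm / qp‖ = 1 := by
    rw [norm_div, H.norm_m, H.norm_p, div_self hq₀.ne']
  have hβ0 : β ≠ 0 := norm_ne_zero_iff.1 (by rw [hnβ]; exact one_ne_zero)
  have hB0 : blaschke q₀ z (expc q₀ 0) ≠ 0 := fun h => hs11 _ hqz (by rw [h0, h, mul_zero])
  have key : Complex.exp (F (-(Real.pi * Complex.I)) - conj (F 0)) * β = qm / qp := by
    rw [← hr, H.s11_refl (Sigma0_subset_DminusCl _ hqz), h0, hr, ← hr,
      blaschke_refl hq₀.ne' hz0 (expc_ne_zero hq₀ 0), map_mul, ← Complex.exp_conj] at h1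
    have hcB : conj (blaschke q₀ z (expc q₀ 0)) ≠ 0 := by simpa using hB0
    have h2 : qm / qp * Complex.exp (conj (F 0)) =
        Complex.exp (F (-(Real.pi * Complex.I))) * β :=
      mul_right_cancel₀ hcB (by linear_combination h1)
    rw [Complex.exp_sub, div_mul_eq_mul_div, div_eq_iff (Complex.exp_ne_zero _)]
    exact h2.symm
  have hre : (F (-(Real.pi * Complex.I)) - conj (F 0)).re = 0 := by
    have := congrArg norm key
    rwa [norm_mul, hnβ, hnκ, mul_one, Complex.norm_exp, Real.exp_eq_one_iff] at this
  have hα : F (-(Real.pi * Complex.I)) - conj (F 0) =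
      (((F (-(Real.pi * Complex.I)) - conj (F 0)).im : ℝ) : ℂ) * Complex.I := by
    conv_lhs => rw [← Complex.re_add_im (F (-(Real.pi * Complex.I)) - conj (F 0)), hre]
    simp
  refine ⟨(F (-(Real.pi * Complex.I)) - conj (F 0)).im, hF, he, hlim, ?_, ?_⟩
  · rw [← hα]
    ring
  · rw [← hα]
    exact key

end IsPotential

end KunduEckhaus

end

noncomputable section

namespace KunduEckhaus

open Set Asymptotics

/-! ### The logarithm on the four quarter strips -/

/-- The reflection of `F` in the real axis. -/
def phi₂ (F : ℂ → ℂ) (s : ℂ) : ℂ := -conj (F (conj s))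
/-- The reflection of `F` under `ζ ↦ -q₀²/ζ^*`. -/
def phi₃ (F : ℂ → ℂ) (α : ℝ) (s : ℂ) : ℂ := conj (F (-conj s - Real.pi * Complex.I)) + α * Complex.I
/-- The composition of the two reflections. -/
def phi₄ (F : ℂ → ℂ) (α : ℝ) (s : ℂ) : ℂ := -F (-s - Real.pi * Complex.I) + α * Complex.I

theorem mem_strip₁ {s : ℂ} : s ∈ strip₁ ↔ 0 ≤ s.re ∧ -Real.pi ≤ s.im ∧ s.im ≤ 0 := Iff.rfl
theorem mem_strip₂ {s : ℂ} : s ∈ strip₂ ↔ 0 ≤ s.re ∧ 0 ≤ s.im ∧ s.im ≤ Real.pi := Iff.rfl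
theorem mem_strip₃ {s : ℂ} : s ∈ strip₃ ↔ s.re ≤ 0 ∧ 0 ≤ s.im ∧ s.im ≤ Real.pi := Iff.rfl
theorem mem_strip₄ {s : ℂ} : s ∈ strip₄ ↔ s.re ≤ 0 ∧ -Real.pi ≤ s.im ∧ s.im ≤ 0 := Iff.rfl
theorem mem_ostrip₁ {s : ℂ} : s ∈ ostrip₁ ↔ 0 < s.re ∧ -Real.pi < s.im ∧ s.im < 0 := Iff.rfl
theorem mem_ostrip₂ {s : ℂ} : s ∈ ostrip₂ ↔ 0 < s.re ∧ 0 < s.im ∧ s.im < Real.pi := Iff.rfl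
theorem mem_ostrip₃ {s : ℂ} : s ∈ ostrip₃ ↔ s.re < 0 ∧ 0 < s.im ∧ s.im < Real.pi := Iff.rfl
theorem mem_ostrip₄ {s : ℂ} : s ∈ ostrip₄ ↔ s.re < 0 ∧ -Real.pi < s.im ∧ s.im < 0 := Iff.rfl

theorem conj_brL : conj brL = brU := by simp [brL, brU, map_ofNat]

theorem conj_brU : conj brU = brL := by simp [brL, brU, map_ofNat]

theorem mapsTo_conj_strip₂ : MapsTo conj strip₂ strip₁ := fun s hs => by
  rw [mem_strip₂] at hs
  rw [mem_strip₁, Complex.conj_re, Complex.conj_im]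
  exact ⟨hs.1, by linarith, by linarith⟩

theorem mapsTo_conj_ostrip₂ : MapsTo conj ostrip₂ ostrip₁ := fun s hs => by
  rw [mem_ostrip₂] at hs
  rw [mem_ostrip₁, Complex.conj_re, Complex.conj_im]
  exact ⟨hs.1, by linarith, by linarith⟩

theorem mapsTo_conj_strip₄ : MapsTo conj strip₄ strip₃ := fun s hs => by
  rw [mem_strip₄] at hs
  rw [mem_strip₃, Complex.conj_re, Complex.conj_im]
  exact ⟨hs.1, by linarith, by linarith⟩

theorem logGood_conj {F : ℂ → ℂ} (hF : LogGood F strip₁ ostrip₁ brL) :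
    LogGood (fun s => conj (F (conj s))) strip₂ ostrip₂ brU := by
  have := hF.conj_conj isOpen_ostrip₁ mapsTo_conj_strip₂ mapsTo_conj_ostrip₂
  rwa [conj_brL] at this

theorem logGood_phi₂ {F : ℂ → ℂ} (hF : LogGood F strip₁ ostrip₁ brL) :
    LogGood (phi₂ F) strip₂ ostrip₂ brU := (logGood_conj hF).neg

theorem logGood_phi₃ {F : ℂ → ℂ} (hF : LogGood F strip₁ ostrip₁ brL) (α : ℝ) :
    LogGood (phi₃ F α) strip₃ ostrip₃ brU := by
  have h := ((logGood_conj hF).comp_const_sub (S' := strip₃) (U' := ostrip₃) (Real.pi * Complex.I)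
    (fun s hs => by
      rw [mem_strip₃] at hs
      rw [mem_strip₂]
      simp
      exact ⟨by linarith, by linarith, by linarith⟩)
    (fun s hs => by
      rw [mem_ostrip₃] at hs
      rw [mem_ostrip₂]
      simp
      exact ⟨by linarith, by linarith, by linarith⟩)).add_const (α * Complex.I)
  have e : (Real.pi * Complex.I - brU : ℂ) = brU := by rw [brU]; ring
  rw [e] at h
  have e' : phi₃ F α = fun s => conj (F (conj (Real.pi * Complex.I - s))) + α * Complex.I := by
    funext s
    simp only [phi₃, map_sub, map_mul, Complex.conj_ofReal, Complex.conj_I]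
    congr 3
    ring
  rwa [e']

theorem logGood_phi₄ {F : ℂ → ℂ} (hF : LogGood F strip₁ ostrip₁ brL) (α : ℝ) :
    LogGood (phi₄ F α) strip₄ ostrip₄ brL := by
  have h := ((hF.comp_const_sub (S' := strip₄) (U' := ostrip₄) (-(Real.pi * Complex.I))
    (fun s hs => by
      rw [mem_strip₄] at hs
      rw [mem_strip₁]
      simp
      exact ⟨by linarith, by linarith, by linarith⟩)
    (fun s hs => by
      rw [mem_ostrip₄] at hs
      rw [mem_ostrip₁]
      simp
      exact ⟨by linarith, by linarith, by linarith⟩)).neg).add_const (α * Complex.I)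
  have e : (-(Real.pi * Complex.I) - brL : ℂ) = brL := by rw [brL]; ring
  rw [e] at h
  have e' : phi₄ F α = fun s => -F (-(Real.pi * Complex.I) - s) + α * Complex.I := by
    funext s
    simp only [phi₄]
    congr 3
    ring
  rwa [e']

/-- The jumps of a piecewise holomorphic function across the contour, in the coordinate `s`. -/
structure IsJump (ℓ Φ₁ Φ₂ Φ₃ Φ₄ : ℂ → ℂ) : Prop where
  out_right : ∀ σ : ℝ, 0 ≤ σ → ℓ σ = Φ₂ σ - Φ₁ σ
  out_left : ∀ σ : ℝ, 0 ≤ σ → ℓ (σ + Real.pi * Complex.I) =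
    Φ₂ (σ + Real.pi * Complex.I) - Φ₁ (σ - Real.pi * Complex.I)
  in_right : ∀ σ : ℝ, σ ≤ 0 → ℓ σ = Φ₄ σ - Φ₃ σ
  in_left : ∀ σ : ℝ, σ ≤ 0 → ℓ (σ + Real.pi * Complex.I) =
    Φ₄ (σ - Real.pi * Complex.I) - Φ₃ (σ + Real.pi * Complex.I)
  lower : ∀ τ : ℝ, -Real.pi ≤ τ → τ ≤ 0 → τ ≠ -(Real.pi / 2) →
    ℓ (τ * Complex.I) = Φ₄ (τ * Complex.I) - Φ₁ (τ * Complex.I)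
  upper : ∀ τ : ℝ, 0 ≤ τ → τ ≤ Real.pi → τ ≠ Real.pi / 2 →
    ℓ (τ * Complex.I) = Φ₂ (τ * Complex.I) - Φ₃ (τ * Complex.I)

theorem eq_of_exp_eq_of_im_eq_zero {a b : ℂ} (h : Complex.exp a = Complex.exp b) (ha : a.im = 0)
    (hb : b.im = 0) : a = b := by
  have := congrArg norm h
  rw [Complex.norm_exp, Complex.norm_exp, Real.exp_eq_exp] at this
  exact Complex.ext this (ha.trans hb.symm)

theorem ofReal_mem_Sigma0 {q₀ x : ℝ} (hx : x ≠ 0) : (x : ℂ) ∈ Sigma0 q₀ := by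
  refine ⟨Or.inl (Complex.ofReal_im _), by exact_mod_cast hx, fun h => hx ?_, fun h => hx ?_⟩ <;>
  · have := congrArg Complex.re h
    simpa using this

theorem mul_I_mem_strip₁ {τ : ℝ} (h1 : -Real.pi ≤ τ) (h2 : τ ≤ 0) (h3 : τ ≠ -(Real.pi / 2)) :
    (τ * Complex.I : ℂ) ∈ strip₁ \ {brL} := by
  refine ⟨by rw [mem_strip₁]; simp [h1, h2], fun h => h3 ?_⟩
  have := congrArg Complex.im (mem_singleton_iff.1 h)
  rw [brL_im] at this
  simpa using this

theorem expc_mul_I_mem_Sigma0 {q₀ τ : ℝ} (hq₀ : 0 < q₀) (h1 : -Real.pi ≤ τ) (h2 : τ ≤ Real.pi)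
    (h3 : τ ≠ -(Real.pi / 2)) (h4 : τ ≠ Real.pi / 2) : expc q₀ (τ * Complex.I) ∈ Sigma0 q₀ := by
  have key : ∀ τ : ℝ, -Real.pi ≤ τ → τ ≤ 0 → τ ≠ -(Real.pi / 2) →
      expc q₀ (τ * Complex.I) ∈ Sigma0 q₀ := fun τ h1 h2 h3 => by
    have := (mem_DminusCl_iff hq₀).1 (expc_mem_DminusCl hq₀ (mul_I_mem_strip₁ h1 h2 h3))
    exact ⟨Or.inr (by simp [norm_expc hq₀]), this.2⟩
  rcases le_total τ 0 with h | h
  · exact key τ h1 h h3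
  · have := conj_mem_Sigma0 (key (-τ) (by linarith) (by linarith) fun h => h4 (by linarith))
    rw [conj_expc] at this
    simpa using this

section

variable {q₀ : ℝ} {qm qp : ℂ} {q : ℝ → ℝ → ℂ} {t : ℝ} {N : ℕ} {z : Fin N → ℂ} {F : ℂ → ℂ} {α : ℝ}
  (H : IsPotential q₀ qm qp q t) (hF : IsScatLog q₀ qm qp q t z F α)

include H hF in
theorem IsScatLog.eq₃ (hz0 : ∀ n, z n ≠ 0) {s : ℂ} (hs : s ∈ strip₃ \ {brU}) :
    s11 q₀ qm qp q t (expc q₀ s) = Complex.exp (phi₃ F α s) * blaschke q₀ z (expc q₀ s) := by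
  have hq₀ := H.pos
  have hs' : -conj s - Real.pi * Complex.I ∈ strip₁ \ {brL} := by
    refine ⟨?_, fun h => hs.2 ?_⟩
    · have := mem_strip₃.1 hs.1
      rw [mem_strip₁]
      simp
      exact ⟨by linarith, by linarith, by linarith⟩
    · have h := congrArg conj (mem_singleton_iff.1 h)
      rw [conj_brL] at h
      simp only [map_sub, map_neg, Complex.conj_conj, map_mul, Complex.conj_ofReal,
        Complex.conj_I] at h
      rw [mem_singleton_iff]
      have e : s = Real.pi * Complex.I - brU := by rw [← h]; ring
      rw [e, brU]
      ring
  have e := refl_expc hq₀ s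
  have e' : expc q₀ s = refl q₀ (expc q₀ (-conj s - Real.pi * Complex.I)) := by
    rw [← e, refl_refl hq₀.ne' (expc_ne_zero hq₀ s)]
  rw [e', H.s11_refl (expc_mem_DminusCl hq₀ hs'), hF.eq _ hs',
    blaschke_refl hq₀.ne' hz0 (expc_ne_zero hq₀ _), map_mul, ← Complex.exp_conj, ← hF.theta, phi₃,
    Complex.exp_add]
  ring

theorem conj_s11_conj {s : ℂ} {Φ : ℂ} (h : s11 q₀ qm qp q t (expc q₀ (conj s)) =
    Complex.exp Φ * blaschke q₀ z (expc q₀ (conj s))) :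
    conj (s11 q₀ qm qp q t (conj (expc q₀ s))) =
      Complex.exp (conj Φ) * (blaschke q₀ z (expc q₀ s))⁻¹ := by
  rw [conj_expc, h, map_mul, ← Complex.exp_conj, ← conj_expc, conj_blaschke_conj]

include hF in
theorem IsScatLog.eq₂ {s : ℂ} (hs : s ∈ strip₂ \ {brU}) :
    conj (s11 q₀ qm qp q t (conj (expc q₀ s))) =
      Complex.exp (-phi₂ F s) * (blaschke q₀ z (expc q₀ s))⁻¹ := by
  rw [conj_s11_conj (hF.eq (conj s) ⟨mapsTo_conj_strip₂ hs.1, fun h => hs.2 ?_⟩), phi₂, neg_neg]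
  rw [mem_singleton_iff, ← Complex.conj_conj s, mem_singleton_iff.1 h, conj_brL]

include H hF in
theorem IsScatLog.eq₄ (hz0 : ∀ n, z n ≠ 0) {s : ℂ} (hs : s ∈ strip₄ \ {brL}) :
    conj (s11 q₀ qm qp q t (conj (expc q₀ s))) =
      Complex.exp (-phi₄ F α s) * (blaschke q₀ z (expc q₀ s))⁻¹ := by
  rw [conj_s11_conj (hF.eq₃ H hz0 (s := conj s) ⟨mapsTo_conj_strip₄ hs.1, fun h => hs.2 ?_⟩)]
  · simp only [phi₃, phi₄, map_add, map_mul, Complex.conj_conj, Complex.conj_ofReal,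
      Complex.conj_I]
    congr 2
    ring
  · rw [mem_singleton_iff, ← Complex.conj_conj s, mem_singleton_iff.1 h, conj_brU]

include hF in
-- The two logarithms agree as numbers, not only modulo `2πi`, where the circle meets the positive
-- axis; the companion lemma does this on the negative axis. These equalities select the branch of
-- the jump on the arcs.
theorem IsScatLog.phi₃_zero : phi₃ F α 0 = F 0 := by
  have h := hF.corner
  simp only [phi₃, map_zero, neg_zero, zero_sub, h, map_add, Complex.conj_conj, map_mul,
    Complex.conj_ofReal, Complex.conj_I]
  ring

include hF in
theorem IsScatLog.phi₃_pi : phi₃ F α (Real.pi * Complex.I) = F (-(Real.pi * Complex.I)) := by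
  rw [hF.corner]
  simp [phi₃]

include H hF in
-- Both sides are logarithms of `1 + ρρ* = 1/(s11 s22)`, the Blaschke factors cancelling. On the
-- real axis both are real, hence equal. The branch points cut the circle into arcs each attached to
-- `q₀` or `-q₀`; equality holds there by the corner identities and spreads along the arc by
-- uniqueness of continuous logarithms.
theorem IsScatLog.isJump (hz0 : ∀ n, z n ≠ 0) (hs11 : ∀ ζ ∈ Sigma0 q₀, s11 q₀ qm qp q t ζ ≠ 0)
    {L : ℂ → ℂ} (hL : IsLogBranch q₀ qm qp q t L) :
    IsJump (fun s => L (expc q₀ s)) F (phi₂ F) (phi₃ F α) (phi₄ F α) := by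
  have hpi := Real.pi_pos
  have hq₀ := H.pos
  have key : ∀ {ζ : ℂ}, ζ ∈ Sigma0 q₀ → ∀ {a b : ℂ},
      s11 q₀ qm qp q t ζ = Complex.exp a * blaschke q₀ z ζ →
      conj (s11 q₀ qm qp q t (conj ζ)) = Complex.exp (-b) * (blaschke q₀ z ζ)⁻¹ →
      Complex.exp (L ζ) = Complex.exp (b - a) := by
    intro ζ hζ a b ha hb
    have hB : blaschke q₀ z ζ ≠ 0 := fun h => hs11 ζ hζ (by rw [ha, h, mul_zero])
    rw [hL.exp_eq ζ hζ, H.one_add_rho hζ (hs11 ζ hζ) (hs11 _ (conj_mem_Sigma0 hζ)), ha, hb,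
      mul_mul_mul_comm, mul_inv_cancel₀ hB, mul_one, ← Complex.exp_add, ← Complex.exp_neg]
    congr 1
    ring
  have eR : ∀ σ : ℝ, expc q₀ σ = ((q₀ * Real.exp σ : ℝ) : ℂ) := ofReal_mul_exp q₀
  have eL : ∀ σ : ℝ, expc q₀ (σ + Real.pi * Complex.I) = ((-(q₀ * Real.exp σ) : ℝ) : ℂ) :=
    ofReal_mul_exp_add_pi q₀
  have eL' : ∀ σ : ℝ, expc q₀ (σ - Real.pi * Complex.I) = expc q₀ (σ + Real.pi * Complex.I) :=
    fun σ => by rw [expc_add_pi, expc_sub_pi]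
  have hne : ∀ σ : ℝ, q₀ * Real.exp σ ≠ 0 := fun σ => by positivity
  have sR : ∀ σ : ℝ, expc q₀ σ ∈ Sigma0 q₀ := fun σ => by
    rw [eR]
    exact ofReal_mem_Sigma0 (hne σ)
  have sL : ∀ σ : ℝ, expc q₀ (σ + Real.pi * Complex.I) ∈ Sigma0 q₀ := fun σ => by
    rw [eL]
    exact ofReal_mem_Sigma0 (neg_ne_zero.2 (hne σ))
  have rR : ∀ σ : ℝ, (L (expc q₀ σ)).im = 0 := fun σ => by
    rw [eR]
    exact hL.real _ (hne σ)
  have rL : ∀ σ : ℝ, (L (expc q₀ (σ + Real.pi * Complex.I))).im = 0 := fun σ => by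
    rw [eL]
    exact hL.real _ (neg_ne_zero.2 (hne σ))
  have nU : ∀ {s : ℂ}, s.im ≠ Real.pi / 2 → s ∉ ({brU} : Set ℂ) := fun {s} h h' => h (by
    rw [mem_singleton_iff.1 h', brU_im])
  have nL : ∀ {s : ℂ}, s.im ≠ -(Real.pi / 2) → s ∉ ({brL} : Set ℂ) := fun {s} h h' => h (by
    rw [mem_singleton_iff.1 h', brL_im])
  have h0U : (0 : ℝ) ≠ Real.pi / 2 := (half_pos hpi).ne
  have h0L : (0 : ℝ) ≠ -(Real.pi / 2) := (neg_neg_of_pos (half_pos hpi)).ne'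
  have hpU : Real.pi ≠ Real.pi / 2 := (half_lt_self hpi).ne'
  have hpL : -Real.pi ≠ -(Real.pi / 2) := fun h => hpU (neg_injective h)
  have jR : ∀ σ : ℝ, 0 ≤ σ → L (expc q₀ σ) = phi₂ F σ - F σ := fun σ hσ => by
    refine eq_of_exp_eq_of_im_eq_zero (key (sR σ) (hF.eq _ ⟨?_, nL ?_⟩)
      (hF.eq₂ ⟨?_, nU ?_⟩)) (rR σ) ?_
    · rw [mem_strip₁]; simp [hσ, hpi.le]
    · simp
    · rw [mem_strip₂]; simp [hσ, hpi.le]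
    · simpa using h0U
    · simp [phi₂]
  have jL : ∀ σ : ℝ, 0 ≤ σ → L (expc q₀ (σ + Real.pi * Complex.I)) =
      phi₂ F (σ + Real.pi * Complex.I) - F (σ - Real.pi * Complex.I) := fun σ hσ => by
    refine eq_of_exp_eq_of_im_eq_zero (key (sL σ) (a := F (σ - Real.pi * Complex.I)) ?_
      (hF.eq₂ ⟨?_, nU ?_⟩)) (rL σ) ?_
    · rw [← eL']
      refine hF.eq _ ⟨?_, nL ?_⟩
      · rw [mem_strip₁]; simp [hσ, hpi.le]
      · simpa using hpL
    · rw [mem_strip₂]; simp [hσ, hpi.le]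
    · simpa using hpU
    · simp [phi₂, sub_eq_add_neg]
  have kR : ∀ σ : ℝ, σ ≤ 0 → L (expc q₀ σ) = phi₄ F α σ - phi₃ F α σ := fun σ hσ => by
    refine eq_of_exp_eq_of_im_eq_zero (key (sR σ) (hF.eq₃ H hz0 ⟨?_, nU ?_⟩)
      (hF.eq₄ H hz0 ⟨?_, nL ?_⟩)) (rR σ) ?_
    · rw [mem_strip₃]; simp [hσ, hpi.le]
    · simpa using h0U
    · rw [mem_strip₄]; simp [hσ, hpi.le]
    · simp
    · simp [phi₃, phi₄]
  have kL : ∀ σ : ℝ, σ ≤ 0 → L (expc q₀ (σ + Real.pi * Complex.I)) =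
      phi₄ F α (σ - Real.pi * Complex.I) - phi₃ F α (σ + Real.pi * Complex.I) := fun σ hσ => by
    refine eq_of_exp_eq_of_im_eq_zero (key (sL σ) (hF.eq₃ H hz0 ⟨?_, nU ?_⟩)
      (b := phi₄ F α (σ - Real.pi * Complex.I)) ?_) (rL σ) ?_
    · rw [mem_strip₃]; simp [hσ, hpi.le]
    · simpa using hpU
    · rw [← eL']
      refine hF.eq₄ H hz0 ⟨?_, nL ?_⟩
      · rw [mem_strip₄]; simp [hσ, hpi.le]
      · simpa using hpL
    · simp [phi₃, phi₄]
  have cI : Continuous fun τ : ℝ => (τ * Complex.I : ℂ) := by fun_prop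
  have cE : Continuous fun τ : ℝ => expc q₀ (τ * Complex.I) :=
    (differentiable_expc q₀).continuous.comp cI
  have g₂ := logGood_phi₂ hF.good
  have g₃ := logGood_phi₃ hF.good α
  have g₄ := logGood_phi₄ hF.good α
  -- Propagation along a connected piece of the lower arc from one parameter `τ₀` where the values
  -- agree.
  have lo : ∀ {A : Set ℝ}, IsPreconnected A → (∀ τ ∈ A, -Real.pi ≤ τ ∧ τ ≤ 0 ∧ τ ≠ -(Real.pi / 2)) →
      ∀ τ₀ ∈ A, L (expc q₀ (τ₀ * Complex.I)) = phi₄ F α (τ₀ * Complex.I) - F (τ₀ * Complex.I) →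
      ∀ τ ∈ A, L (expc q₀ (τ * Complex.I)) = phi₄ F α (τ * Complex.I) - F (τ * Complex.I) := by
    intro A hA hAs τ₀ hτ₀ h
    have mem : ∀ τ ∈ A, expc q₀ (τ * Complex.I) ∈ Sigma0 q₀ := fun τ hτ => by
      obtain ⟨h1, h2, h3⟩ := hAs τ hτ
      exact expc_mul_I_mem_Sigma0 hq₀ h1 (by linarith) h3 (by linarith)
    have m₁ : ∀ τ ∈ A, (τ * Complex.I : ℂ) ∈ strip₁ \ {brL} := fun τ hτ =>
      mul_I_mem_strip₁ (hAs τ hτ).1 (hAs τ hτ).2.1 (hAs τ hτ).2.2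
    have m₄ : ∀ τ ∈ A, (τ * Complex.I : ℂ) ∈ strip₄ \ {brL} := fun τ hτ =>
      ⟨mem_strip₄.2 (by simpa using ⟨(hAs τ hτ).1, (hAs τ hτ).2.1⟩), (m₁ τ hτ).2⟩
    exact eqOn_of_exp_eqOn hA (hL.cont.comp cE.continuousOn mem)
      ((g₄.cont.comp cI.continuousOn m₄).sub (hF.good.cont.comp cI.continuousOn m₁))
      (fun τ hτ => key (mem τ hτ) (hF.eq _ (m₁ τ hτ)) (hF.eq₄ H hz0 (m₄ τ hτ))) hτ₀ h
  have up : ∀ {A : Set ℝ}, IsPreconnected A → (∀ τ ∈ A, 0 ≤ τ ∧ τ ≤ Real.pi ∧ τ ≠ Real.pi / 2) →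
      ∀ τ₀ ∈ A, L (expc q₀ (τ₀ * Complex.I)) =
        phi₂ F (τ₀ * Complex.I) - phi₃ F α (τ₀ * Complex.I) →
      ∀ τ ∈ A, L (expc q₀ (τ * Complex.I)) =
        phi₂ F (τ * Complex.I) - phi₃ F α (τ * Complex.I) := by
    intro A hA hAs τ₀ hτ₀ h
    have mem : ∀ τ ∈ A, expc q₀ (τ * Complex.I) ∈ Sigma0 q₀ := fun τ hτ => by
      obtain ⟨h1, h2, h3⟩ := hAs τ hτ
      exact expc_mul_I_mem_Sigma0 hq₀ (by linarith) h2 (by linarith) h3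
    have m₂ : ∀ τ ∈ A, (τ * Complex.I : ℂ) ∈ strip₂ \ {brU} := fun τ hτ =>
      ⟨mem_strip₂.2 (by simpa using ⟨(hAs τ hτ).1, (hAs τ hτ).2.1⟩),
        nU (by simpa using (hAs τ hτ).2.2)⟩
    have m₃ : ∀ τ ∈ A, (τ * Complex.I : ℂ) ∈ strip₃ \ {brU} := fun τ hτ =>
      ⟨mem_strip₃.2 (by simpa using ⟨(hAs τ hτ).1, (hAs τ hτ).2.1⟩), (m₂ τ hτ).2⟩
    exact eqOn_of_exp_eqOn hA (hL.cont.comp cE.continuousOn mem)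
      ((g₂.cont.comp cI.continuousOn m₂).sub (g₃.cont.comp cI.continuousOn m₃))
      (fun τ hτ => key (mem τ hτ) (hF.eq₃ H hz0 (m₃ τ hτ)) (hF.eq₂ (m₂ τ hτ))) hτ₀ h
  have z₃ := hF.phi₃_zero
  have p₃ := hF.phi₃_pi
  have jR0 := jR 0 le_rfl
  have jL0 := jL 0 le_rfl
  have kR0 := kR 0 le_rfl
  have kL0 := kL 0 le_rfl
  simp only [Complex.ofReal_zero, zero_add, zero_sub] at jR0 jL0 kR0 kL0
  refine ⟨jR, jL, kR, kL, fun τ h1 h2 h3 => ?_, fun τ h1 h2 h3 => ?_⟩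
  · rcases lt_or_gt_of_ne h3 with h | h
    · refine lo isPreconnected_Ico (A := Ico (-Real.pi) (-(Real.pi / 2)))
        (fun x hx => ⟨hx.1, by linarith [hx.2], hx.2.ne⟩) (-Real.pi) ⟨le_rfl, by linarith⟩ ?_ τ ⟨h1, h⟩
      have e := eL' 0
      simp only [Complex.ofReal_zero, zero_add, zero_sub] at e
      rw [Complex.ofReal_neg, neg_mul, e, kL0, p₃]
    · refine lo isPreconnected_Ioc (A := Ioc (-(Real.pi / 2)) 0)
        (fun x hx => ⟨by linarith [hx.1], hx.2, hx.1.ne'⟩) 0 ⟨by linarith, le_rfl⟩ ?_ τ ⟨h, h2⟩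
      rw [Complex.ofReal_zero, zero_mul, kR0, z₃]
  · rcases lt_or_gt_of_ne h3 with h | h
    · refine up isPreconnected_Ico (A := Ico 0 (Real.pi / 2))
        (fun x hx => ⟨hx.1, by linarith [hx.2], hx.2.ne⟩) 0 ⟨le_rfl, by linarith⟩ ?_ τ ⟨h1, h⟩
      rw [Complex.ofReal_zero, zero_mul, jR0, z₃]
    · refine up isPreconnected_Ioc (A := Ioc (Real.pi / 2) Real.pi)
        (fun x hx => ⟨by linarith [hx.1], hx.2, hx.1.ne'⟩) Real.pi ⟨by linarith, le_rfl⟩ ?_ τ ⟨h, h2⟩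
      rw [jL0, p₃]

end

end KunduEckhaus

end

noncomputable section

namespace KunduEckhaus

open Set Asymptotics

/-! ### Existence of the logarithm on the continuous spectrum -/

/-- The image of the right half of `Σ₀` in the coordinate `s`. -/
def cross : Set ℂ := {s | s.im = 0 ∨ s.re = 0 ∧ |s.im| < Real.pi / 2}

theorem starConvex_cross : StarConvex ℝ 0 cross := by
  rw [starConvex_zero_iff]
  intro s hs a ha ha1
  rcases hs with h | ⟨h1, h2⟩
  · left
    simp [h]
  · right
    rw [Complex.real_smul, Complex.re_ofReal_mul, Complex.im_ofReal_mul, h1, mul_zero, abs_mul,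
      abs_of_nonneg ha]
    exact ⟨rfl, (mul_le_of_le_one_left (abs_nonneg _) ha1).trans_lt h2⟩

theorem ofReal_mem_cross (σ : ℝ) : (σ : ℂ) ∈ cross := Or.inl (Complex.ofReal_im σ)

/-- A continuous logarithm is shifted by a period so that it equals the real logarithm of `‖G‖` at
`0`; by uniqueness of lifts it then does so along the whole real axis. -/
theorem exists_log_cross {G : ℂ → ℂ} (hG : ContinuousOn G cross) (h0 : ∀ s ∈ cross, G s ≠ 0)
    (hr : ∀ σ : ℝ, G σ = ‖G σ‖) :
    ∃ ℓ : ℂ → ℂ, ContinuousOn ℓ cross ∧ (∀ s ∈ cross, Complex.exp (ℓ s) = G s) ∧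
      ∀ σ : ℝ, (ℓ σ).im = 0 := by
  have hz : (0 : ℂ) ∈ cross := Or.inl rfl
  obtain ⟨ℓ, hℓ, he⟩ := exists_continuousOn_log_of_starConvex starConvex_cross hz hG h0
  have hpos : ∀ σ : ℝ, 0 < ‖G σ‖ := fun σ => norm_pos_iff.2 (h0 _ (ofReal_mem_cross σ))
  have hlog : ∀ σ : ℝ, Complex.exp ((Real.log ‖G σ‖ : ℝ) : ℂ) = G σ := fun σ => by
    rw [← Complex.ofReal_exp, Real.exp_log (hpos σ), ← hr]
  set c := ℓ 0 - ((Real.log ‖G 0‖ : ℝ) : ℂ) with hc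
  have hc1 : Complex.exp c = 1 := by
    have := hlog 0
    rw [Complex.ofReal_zero] at this
    rw [hc, Complex.exp_sub, he 0 hz, this, div_self (h0 0 hz)]
  have he' : ∀ s ∈ cross, Complex.exp (ℓ s - c) = G s := fun s hs => by
    rw [Complex.exp_sub, hc1, div_one, he s hs]
  have hℓ' : ContinuousOn (fun s => ℓ s - c) cross := hℓ.sub continuousOn_const
  refine ⟨fun s => ℓ s - c, hℓ', he', fun σ => ?_⟩
  have hGc : Continuous fun σ : ℝ => G σ :=
    hG.comp_continuous Complex.continuous_ofReal ofReal_mem_cross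
  have h1 : Continuous fun σ : ℝ => ((Real.log ‖G σ‖ : ℝ) : ℂ) :=
    Complex.continuous_ofReal.comp (hGc.norm.log fun σ => (hpos σ).ne')
  have := eqOn_of_exp_eqOn isPreconnected_univ (f := fun σ : ℝ => ℓ σ - c)
    (hℓ'.comp_continuous Complex.continuous_ofReal ofReal_mem_cross).continuousOn h1.continuousOn
    (fun σ _ => by rw [he' _ (ofReal_mem_cross σ), hlog]) (mem_univ 0)
    (by simp [hc])
  simp only [this (mem_univ σ), Complex.ofReal_im]

theorem neg_mem_Sigma0 {q₀ : ℝ} {ζ : ℂ} (h : ζ ∈ Sigma0 q₀) : -ζ ∈ Sigma0 q₀ := by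
  obtain ⟨h1, h2, h3, h4⟩ := h
  exact ⟨by simpa using h1, neg_ne_zero.2 h2, fun h => h4 (neg_eq_iff_eq_neg.1 h),
    fun h => h3 (neg_injective h)⟩

theorem re_ne_zero_of_mem_Sigma0 {q₀ : ℝ} {ζ : ℂ} (h : ζ ∈ Sigma0 q₀) : ζ.re ≠ 0 := by
  obtain ⟨h1, h2, h3, h4⟩ := h
  intro hre
  rcases h1 with h1 | h1
  · exact h2 (Complex.ext hre h1)
  · have h5 : ζ = ζ.im * Complex.I := by
      apply Complex.ext <;> simp [hre]
    have h6 : |ζ.im| = q₀ := by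
      rw [h5] at h1
      simpa using h1
    rcases abs_choice ζ.im with h7 | h7
    · apply h3
      rw [h5, ← h6, h7]
      simp [mul_comm]
    · apply h4
      rw [h5, ← h6, h7]
      simp [mul_comm]

theorem expc_log {q₀ : ℝ} (hq₀ : 0 < q₀) {ζ : ℂ} (hζ : ζ ≠ 0) :
    expc q₀ (Complex.log (ζ / q₀)) = ζ := by
  have hq : (q₀ : ℂ) ≠ 0 := by exact_mod_cast hq₀.ne'
  rw [expc, Complex.exp_log (div_ne_zero hζ hq), mul_div_cancel₀ _ hq]

theorem log_mem_cross {q₀ : ℝ} (hq₀ : 0 < q₀) {ζ : ℂ} (hζ : ζ ∈ Sigma0 q₀) (hre : 0 < ζ.re) :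
    Complex.log (ζ / q₀) ∈ cross := by
  have hre' : 0 < (ζ / q₀).re := by
    rw [Complex.div_ofReal_re]
    positivity
  rcases hζ.1 with h | h
  · left
    rw [Complex.log_im, Complex.arg_eq_zero_iff]
    exact ⟨hre'.le, by rw [Complex.div_ofReal_im, h, zero_div]⟩
  · right
    refine ⟨?_, ?_⟩
    · rw [Complex.log_re, norm_div, Complex.norm_real, Real.norm_of_nonneg hq₀.le, h,
        div_self hq₀.ne', Real.log_one]
    · rw [Complex.log_im, Complex.abs_arg_lt_pi_div_two_iff]
      exact Or.inl hre'

theorem expc_mem_Sigma0_of_mem_cross {q₀ : ℝ} (hq₀ : 0 < q₀) {s : ℂ} (hs : s ∈ cross) :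
    expc q₀ s ∈ Sigma0 q₀ := by
  have hpi := Real.pi_pos
  rcases hs with h | ⟨h1, h2⟩
  · have e : s = (s.re : ℂ) := Complex.ext rfl (by simp [h])
    rw [e, show expc q₀ (s.re : ℂ) = _ from ofReal_mul_exp q₀ s.re]
    exact ofReal_mem_Sigma0 (by positivity)
  · have e : s = s.im * Complex.I := by
      apply Complex.ext <;> simp [h1]
    rw [abs_lt] at h2
    rw [e]
    exact expc_mul_I_mem_Sigma0 hq₀ (by linarith) (by linarith) (by linarith) (by linarith)

/-- Without `0` and the branch points, `Σ` splits by the sign of `Re ζ`. In the coordinate `log (±ζ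
/ q₀)` each half is the star-shaped `cross`, and the two logarithms are glued over disjoint
relatively open pieces. -/
theorem exists_log_Sigma0 {q₀ : ℝ} (hq₀ : 0 < q₀) {g : ℂ → ℂ} (hg : ContinuousOn g (Sigma0 q₀))
    (h0 : ∀ ζ ∈ Sigma0 q₀, g ζ ≠ 0) (hr : ∀ x : ℝ, x ≠ 0 → g x = ‖g x‖) :
    ∃ L : ℂ → ℂ, ContinuousOn L (Sigma0 q₀) ∧ (∀ ζ ∈ Sigma0 q₀, Complex.exp (L ζ) = g ζ) ∧
      ∀ x : ℝ, x ≠ 0 → (L x).im = 0 := by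
  have hcE := (differentiable_expc q₀).continuous
  obtain ⟨ℓ, hℓ, he, hi⟩ := exists_log_cross (G := fun s => g (expc q₀ s))
    (hg.comp hcE.continuousOn fun s hs => expc_mem_Sigma0_of_mem_cross hq₀ hs)
    (fun s hs => h0 _ (expc_mem_Sigma0_of_mem_cross hq₀ hs)) (fun σ => by
      rw [show expc q₀ (σ : ℂ) = _ from ofReal_mul_exp q₀ σ]
      exact hr _ (by positivity))
  obtain ⟨ℓ', hℓ', he', hi'⟩ := exists_log_cross (G := fun s => g (-expc q₀ s))
    (hg.comp hcE.neg.continuousOn fun s hs => neg_mem_Sigma0 (expc_mem_Sigma0_of_mem_cross hq₀ hs))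
    (fun s hs => h0 _ (neg_mem_Sigma0 (expc_mem_Sigma0_of_mem_cross hq₀ hs))) (fun σ => by
      rw [show expc q₀ (σ : ℂ) = _ from ofReal_mul_exp q₀ σ, ← Complex.ofReal_neg]
      exact hr _ (neg_ne_zero.2 (by positivity)))
  have hclog : ContinuousOn (fun ζ : ℂ => Complex.log (ζ / q₀)) {ζ | 0 < ζ.re} :=
    ContinuousOn.clog (by fun_prop) fun ζ hζ => Or.inl (by
      have hζ : 0 < ζ.re := hζ
      rw [Complex.div_ofReal_re]
      positivity)
  set L : ℂ → ℂ := fun ζ => if 0 < ζ.re then ℓ (Complex.log (ζ / q₀)) else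
    ℓ' (Complex.log (-ζ / q₀)) with hL
  have hLp : ∀ {ζ : ℂ}, 0 < ζ.re → L ζ = ℓ (Complex.log (ζ / q₀)) := fun h => if_pos h
  have hLn : ∀ {ζ : ℂ}, ζ.re < 0 → L ζ = ℓ' (Complex.log (-ζ / q₀)) := fun h => if_neg h.not_gt
  have hneg : ∀ {ζ : ℂ}, ζ.re < 0 → 0 < (-ζ).re := fun {ζ} h => by
    rw [Complex.neg_re]
    linarith
  refine ⟨L, fun ζ hζ => ?_, fun ζ hζ => ?_, fun x hx => ?_⟩
  · rcases (re_ne_zero_of_mem_Sigma0 hζ).lt_or_gt with h | h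
    · have hA : ContinuousOn L (Sigma0 q₀ ∩ {ζ | ζ.re < 0}) := by
        refine ContinuousOn.congr (hℓ'.comp (hclog.comp continuous_neg.continuousOn
          fun ζ hζ => hneg hζ.2) fun ζ hζ => log_mem_cross hq₀ (neg_mem_Sigma0 hζ.1) (hneg hζ.2))
          fun ζ hζ => hLn hζ.2
      exact (hA ζ ⟨hζ, h⟩).mono_of_mem_nhdsWithin (inter_mem_nhdsWithin _
        ((isOpen_lt Complex.continuous_re continuous_const).mem_nhds h))
    · have hA : ContinuousOn L (Sigma0 q₀ ∩ {ζ | 0 < ζ.re}) := by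
        refine ContinuousOn.congr (hℓ.comp (hclog.mono inter_subset_right)
          fun ζ hζ => log_mem_cross hq₀ hζ.1 hζ.2) fun ζ hζ => hLp hζ.2
      exact (hA ζ ⟨hζ, h⟩).mono_of_mem_nhdsWithin (inter_mem_nhdsWithin _
        ((isOpen_lt continuous_const Complex.continuous_re).mem_nhds h))
  · rcases (re_ne_zero_of_mem_Sigma0 hζ).lt_or_gt with h | h
    · rw [hLn h, he' _ (log_mem_cross hq₀ (neg_mem_Sigma0 hζ) (hneg h)),
        expc_log hq₀ (neg_ne_zero.2 hζ.2.1), neg_neg]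
    · rw [hLp h, he _ (log_mem_cross hq₀ hζ h), expc_log hq₀ hζ.2.1]
  · have e : ∀ y : ℝ, 0 < y → Complex.log ((y : ℂ) / q₀) = ((Real.log (y / q₀) : ℝ) : ℂ) :=
      fun y hy => by rw [← Complex.ofReal_div, Complex.ofReal_log (by positivity)]
    rcases hx.lt_or_gt with h | h
    · rw [hLn (by simpa using h), ← Complex.ofReal_neg, e _ (by linarith), hi']
    · rw [hLp (by simpa using h), e _ h, hi]

theorem IsPotential.exists_isLogBranch {q₀ : ℝ} {qm qp : ℂ} {q : ℝ → ℝ → ℂ} {t : ℝ}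
    (H : IsPotential q₀ qm qp q t) (hs11 : ∀ ζ ∈ Sigma0 q₀, s11 q₀ qm qp q t ζ ≠ 0) :
    ∃ L, IsLogBranch q₀ qm qp q t L := by
  have hc : ContinuousOn (s11 q₀ qm qp q t) (Sigma0 q₀) :=
    H.continuousOn_s11.mono (Sigma0_subset_DminusCl q₀)
  have h0 : ∀ ζ ∈ Sigma0 q₀,
      s11 q₀ qm qp q t ζ * conj (s11 q₀ qm qp q t (conj ζ)) ≠ 0 := fun ζ hζ =>
    mul_ne_zero (hs11 ζ hζ) (by simpa using hs11 _ (conj_mem_Sigma0 hζ))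
  obtain ⟨L, hL, he, hr⟩ := exists_log_Sigma0 H.pos
    (g := fun ζ => (s11 q₀ qm qp q t ζ * conj (s11 q₀ qm qp q t (conj ζ)))⁻¹)
    ((hc.mul (Complex.continuous_conj.comp_continuousOn
      (hc.comp Complex.continuous_conj.continuousOn fun ζ hζ => conj_mem_Sigma0 hζ))).inv₀ h0)
    (fun ζ hζ => inv_ne_zero (h0 ζ hζ)) (fun x hx => by
      rw [Complex.conj_ofReal, Complex.mul_conj', norm_inv, norm_pow, Complex.norm_real, norm_norm]
      push_cast
      rfl)
  exact ⟨L, hL, fun ζ hζ => by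
    rw [he ζ hζ, H.one_add_rho hζ (hs11 ζ hζ) (hs11 _ (conj_mem_Sigma0 hζ))], hr⟩

end KunduEckhaus

end

noncomputable section

namespace KunduEckhaus

open Set Asymptotics

/-! ### The Cauchy integral of the logarithm -/

theorem tendsto_integral_vertical {g : ℂ → ℂ} {l : Filter ℝ} [l.IsCountablyGenerated] {S : Set ℂ}
    {a : ℂ} {u v : ℝ} (huv : u ≤ v) (hg : Tendsto g (comap Complex.re l ⊓ 𝓟 S) (𝓝 a))
    (hS : ∀ᶠ ρ : ℝ in l, ∀ τ ∈ Icc u v, (ρ + τ * Complex.I : ℂ) ∈ S)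
    (hc : ∀ᶠ ρ : ℝ in l, ContinuousOn (fun τ : ℝ => g (ρ + τ * Complex.I)) (Icc u v)) :
    Tendsto (fun ρ : ℝ => ∫ τ in u..v, g (ρ + (τ : ℝ) * Complex.I)) l (𝓝 ((v - u) * a)) := by
  have hev : ∀ {P : ℂ → Prop}, (∀ᶠ s in comap Complex.re l ⊓ 𝓟 S, P s) →
      ∀ᶠ ρ : ℝ in l, ∀ τ ∈ Icc u v, P (ρ + τ * Complex.I) := fun {P} h => by
    rw [eventually_inf_principal, eventually_comap] at h
    filter_upwards [h, hS] with ρ hρ hρS τ hτ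
    exact hρ _ (by simp) (hρS τ hτ)
  have hlim : Tendsto (fun ρ : ℝ => ∫ τ in u..v, g (ρ + (τ : ℝ) * Complex.I)) l
      (𝓝 (∫ _τ in u..v, a)) := by
    refine intervalIntegral.tendsto_integral_filter_of_dominated_convergence
      (fun _ => ‖a‖ + 1) ?_ ?_ (by simp) ?_
    · filter_upwards [hc] with ρ hρ
      rw [uIoc_of_le huv]
      exact (hρ.mono Ioc_subset_Icc_self).aestronglyMeasurable measurableSet_Ioc
    · filter_upwards [hev (hg.norm.eventually_le_const (lt_add_one ‖a‖))] with ρ hρ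
      refine ae_of_all _ fun τ hτ => ?_
      rw [uIoc_of_le huv] at hτ
      exact hρ τ (Ioc_subset_Icc_self hτ)
    · refine ae_of_all _ fun τ hτ => ?_
      rw [uIoc_of_le huv] at hτ
      exact tendsto_def.2 fun s hs => (hev (hg hs)).mono fun ρ hρ => hρ τ (Ioc_subset_Icc_self hτ)
  simpa using hlim

theorem LogGood.continuousOn_vertical {f : ℂ → ℂ} {S U : Set ℂ} {p : ℂ} (h : LogGood f S U p)
    {ρ : ℝ} (hρ : ρ ≠ p.re) {A : Set ℝ} (hA : ∀ τ ∈ A, (ρ + τ * Complex.I : ℂ) ∈ S) :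
    ContinuousOn (fun τ : ℝ => f (ρ + τ * Complex.I)) A :=
  h.cont.comp (by fun_prop) fun τ hτ => ⟨hA τ hτ, fun e => hρ (by
    rw [← mem_singleton_iff.1 e]
    simp)⟩

theorem eq_of_expc_eq {q₀ : ℝ} (hq₀ : 0 < q₀) {s s₀ : ℂ} (hs : |s.im| ≤ Real.pi)
    (hs₀ : |s₀.im| < Real.pi) (h : expc q₀ s = expc q₀ s₀) : s = s₀ := by
  have hpi := Real.pi_pos
  obtain ⟨n, hn⟩ := Complex.exp_eq_exp_iff_exists_int.1
    (mul_left_cancel₀ (by exact_mod_cast hq₀.ne') h)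
  have him := congrArg Complex.im hn
  have hc : ((n : ℂ) * (2 * Real.pi * Complex.I)).im = n * (2 * Real.pi) := by simp
  rw [Complex.add_im, hc] at him
  rw [abs_le] at hs
  rw [abs_lt] at hs₀
  have h5 : (-1 : ℝ) < n := by nlinarith
  have h6 : (n : ℝ) < 1 := by nlinarith
  have hn0 : n = 0 := by
    have : -1 < n := by exact_mod_cast h5
    have : n < 1 := by exact_mod_cast h6
    omega
  rw [hn, hn0]
  simp

/-- The Cauchy kernel `ζ / (ζ - w)`. -/
def cauchyK (w ζ : ℂ) : ℂ := ζ / (ζ - w)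

/-- On the strip containing `s₀` the choice `c = Φ s₀` removes the pole of the Cauchy kernel; on the
other strips there is no pole and any `c` is allowed. Using one `c` on all four strips leaves the
jumps unchanged. The extra `ζ` in `cauchyK` comes from `dζ = ζ ds`. -/
theorem LogGood.exists_cauchy {q₀ : ℝ} (hq₀ : 0 < q₀) {Φ : ℂ → ℂ} {S U : Set ℂ} {p : ℂ}
    (h : LogGood Φ S U p) (hUo : IsOpen U) (hUS : U ⊆ S) (hpS : p ∈ S) (hpU : p ∉ U)
    (hS : ∀ s ∈ S, |s.im| ≤ Real.pi) {s₀ c : ℂ} (hs₀ : |s₀.im| < Real.pi)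
    (hc : s₀ ∉ S ∨ s₀ ∈ U ∧ c = Φ s₀) :
    ∃ g, LogGood g S U p ∧ ∀ s ∈ S, s ≠ s₀ → g s = (Φ s - c) * cauchyK (expc q₀ s₀) (expc q₀ s) := by
  have hE := differentiable_expc q₀
  have h0 : ∀ s ∈ S, expc q₀ s - expc q₀ s₀ = 0 → s = s₀ := fun s hs h =>
    eq_of_expc_eq hq₀ (hS s hs) hs₀ (sub_eq_zero.1 h)
  rcases hc with hc | ⟨hc, rfl⟩
  · have hne : ∀ s ∈ S, expc q₀ s - expc q₀ s₀ ≠ 0 := fun s hs he => hc (h0 s hs he ▸ hs)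
    refine ⟨fun s => (Φ s + -c) * cauchyK (expc q₀ s₀) (expc q₀ s), (h.add_const (-c)).mul ?_ hpS ?_,
      fun s _ _ => by simp only [sub_eq_add_neg]⟩
    · exact hE.continuous.continuousOn.div (hE.continuous.sub continuous_const).continuousOn hne
    · exact hE.differentiableOn.div (hE.sub_const _).differentiableOn fun s hs => hne s (hUS hs)
  · refine h.sub_mul_inv hUo hUS hpS hpU hc hE.continuous hE (hE.sub_const (expc q₀ s₀)) h0
      (sub_self _) ?_
    rw [((hasDerivAt_expc q₀ s₀).sub_const _).deriv]
    exact expc_ne_zero hq₀ s₀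

theorem isOpen_ostrip₂ : IsOpen ostrip₂ := isOpen_Ioi.reProdIm isOpen_Ioo
theorem isOpen_ostrip₃ : IsOpen ostrip₃ := isOpen_Iio.reProdIm isOpen_Ioo
theorem isOpen_ostrip₄ : IsOpen ostrip₄ := isOpen_Iio.reProdIm isOpen_Ioo

/-- The limits at the ends of the strips of the four branches of the logarithm. -/
structure HasEnds (Φ₁ Φ₂ Φ₃ Φ₄ : ℂ → ℂ) (a b : ℂ) : Prop where
  e₁ : Tendsto Φ₁ (comap Complex.re atTop ⊓ 𝓟 strip₁) (𝓝 a)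
  e₂ : Tendsto Φ₂ (comap Complex.re atTop ⊓ 𝓟 strip₂) (𝓝 a)
  e₃ : Tendsto Φ₃ (comap Complex.re atBot ⊓ 𝓟 strip₃) (𝓝 b)
  e₄ : Tendsto Φ₄ (comap Complex.re atBot ⊓ 𝓟 strip₄) (𝓝 b)

/-- The constant `c` drops out of every jump and reappears only at the ends. Each end consists of
two strips of width `π`, which gives `2π` times the limiting values `(b - c) k₀` at `ζ → 0` and `(a
- c) k₁` at `ζ → ∞`. -/
theorem hasSigmaIntegral_of_isJump {q₀ : ℝ} (hq₀ : 0 < q₀) {L f k : ℂ → ℂ} {Φ₁ Φ₂ Φ₃ Φ₄ : ℂ → ℂ}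
    (hJ : IsJump (fun s => L (expc q₀ s)) Φ₁ Φ₂ Φ₃ Φ₄) {a b : ℂ} (hE : HasEnds Φ₁ Φ₂ Φ₃ Φ₄ a b)
    (hfc : ContinuousOn f (Sigma0 q₀)) (hf : ∀ s, logInt q₀ f s = L (expc q₀ s) * k (expc q₀ s))
    {s₀ c : ℂ} (h0re : s₀.re ≠ 0) (h0im : s₀.im ≠ 0) (h0pi : |s₀.im| < Real.pi)
    {g₁ g₂ g₃ g₄ : ℂ → ℂ}
    (h₁ : LogGood g₁ strip₁ ostrip₁ brL) (h₂ : LogGood g₂ strip₂ ostrip₂ brU)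
    (h₃ : LogGood g₃ strip₃ ostrip₃ brU) (h₄ : LogGood g₄ strip₄ ostrip₄ brL)
    (e₁ : ∀ s ∈ strip₁, s ≠ s₀ → g₁ s = (Φ₁ s - c) * k (expc q₀ s))
    (e₂ : ∀ s ∈ strip₂, s ≠ s₀ → g₂ s = (Φ₂ s - c) * k (expc q₀ s))
    (e₃ : ∀ s ∈ strip₃, s ≠ s₀ → g₃ s = (Φ₃ s - c) * k (expc q₀ s))
    (e₄ : ∀ s ∈ strip₄, s ≠ s₀ → g₄ s = (Φ₄ s - c) * k (expc q₀ s)) {k₀ k₁ : ℂ}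
    (hk₀ : Tendsto k (𝓝 0) (𝓝 k₀)) (hk₁ : Tendsto k (Bornology.cobounded ℂ) (𝓝 k₁)) :
    HasSigmaIntegral q₀ f (2 * Real.pi * Complex.I * ((b - c) * k₀ - (a - c) * k₁)) := by
  have hpi := Real.pi_pos
  have nre : ∀ {s : ℂ}, s.re = 0 → s ≠ s₀ := fun h h' => h0re (h' ▸ h)
  have nim : ∀ {s : ℂ}, s.im = 0 → s ≠ s₀ := fun h h' => h0im (h' ▸ h)
  have npi : ∀ {s : ℂ}, |s.im| = Real.pi → s ≠ s₀ := fun h h' => h0pi.ne (h' ▸ h)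
  have eL : ∀ σ : ℝ, expc q₀ (σ - Real.pi * Complex.I) = expc q₀ (σ + Real.pi * Complex.I) :=
    fun σ => by rw [expc_add_pi, expc_sub_pi]
  have top : Tendsto (expc q₀) (comap Complex.re atTop) (Bornology.cobounded ℂ) := by
    rw [← tendsto_norm_atTop_iff_cobounded]
    simp only [norm_expc hq₀]
    exact (Real.tendsto_exp_atTop.comp tendsto_comap).const_mul_atTop hq₀
  have bot : Tendsto (expc q₀) (comap Complex.re atBot) (𝓝 0) := by
    rw [tendsto_zero_iff_norm_tendsto_zero]
    simp only [norm_expc hq₀]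
    simpa using (Real.tendsto_exp_atBot.comp tendsto_comap).const_mul q₀
  have limTop : ∀ {Φ g : ℂ → ℂ} {S : Set ℂ}, Tendsto Φ (comap Complex.re atTop ⊓ 𝓟 S) (𝓝 a) →
      (∀ s ∈ S, s ≠ s₀ → g s = (Φ s - c) * k (expc q₀ s)) →
      Tendsto g (comap Complex.re atTop ⊓ 𝓟 S) (𝓝 ((a - c) * k₁)) := by
    intro Φ g S hΦ hg
    refine ((hΦ.sub_const c).mul (hk₁.comp (top.mono_left inf_le_left))).congr' ?_
    have h1 : ∀ᶠ s in comap Complex.re atTop ⊓ 𝓟 S, s ∈ S := mem_inf_of_right (mem_principal_self _)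
    have h2 : ∀ᶠ s in comap Complex.re atTop ⊓ 𝓟 S, s₀.re < s.re :=
      (tendsto_comap.mono_left inf_le_left).eventually (eventually_gt_atTop _)
    filter_upwards [h1, h2] with s hs hs'
    exact (hg s hs fun h => hs'.ne' (by rw [h])).symm
  have limBot : ∀ {Φ g : ℂ → ℂ} {S : Set ℂ}, Tendsto Φ (comap Complex.re atBot ⊓ 𝓟 S) (𝓝 b) →
      (∀ s ∈ S, s ≠ s₀ → g s = (Φ s - c) * k (expc q₀ s)) →
      Tendsto g (comap Complex.re atBot ⊓ 𝓟 S) (𝓝 ((b - c) * k₀)) := by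
    intro Φ g S hΦ hg
    refine ((hΦ.sub_const c).mul (hk₀.comp (bot.mono_left inf_le_left))).congr' ?_
    have h1 : ∀ᶠ s in comap Complex.re atBot ⊓ 𝓟 S, s ∈ S := mem_inf_of_right (mem_principal_self _)
    have h2 : ∀ᶠ s in comap Complex.re atBot ⊓ 𝓟 S, s.re < s₀.re :=
      (tendsto_comap.mono_left inf_le_left).eventually (eventually_lt_atBot _)
    filter_upwards [h1, h2] with s hs hs'
    exact (hg s hs fun h => hs'.ne (by rw [h])).symm
  have m₁ : ∀ ρ : ℝ, 0 < ρ → ∀ τ ∈ Icc (-Real.pi) 0, (ρ + τ * Complex.I : ℂ) ∈ strip₁ :=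
    fun ρ hρ τ hτ => mem_strip₁.2 (by simpa using ⟨hρ.le, hτ⟩)
  have m₂ : ∀ ρ : ℝ, 0 < ρ → ∀ τ ∈ Icc 0 Real.pi, (ρ + τ * Complex.I : ℂ) ∈ strip₂ :=
    fun ρ hρ τ hτ => mem_strip₂.2 (by simpa using ⟨hρ.le, hτ⟩)
  have m₃ : ∀ ρ : ℝ, ρ < 0 → ∀ τ ∈ Icc 0 Real.pi, (ρ + τ * Complex.I : ℂ) ∈ strip₃ :=
    fun ρ hρ τ hτ => mem_strip₃.2 (by simpa using ⟨hρ.le, hτ⟩)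
  have m₄ : ∀ ρ : ℝ, ρ < 0 → ∀ τ ∈ Icc (-Real.pi) 0, (ρ + τ * Complex.I : ℂ) ∈ strip₄ :=
    fun ρ hρ τ hτ => mem_strip₄.2 (by simpa using ⟨hρ.le, hτ⟩)
  have l₁ := tendsto_integral_vertical (by linarith) (limTop hE.e₁ e₁)
    ((eventually_gt_atTop 0).mono m₁) ((eventually_gt_atTop 0).mono fun ρ hρ =>
      h₁.continuousOn_vertical (by rw [brL_re]; exact hρ.ne') (m₁ ρ hρ))
  have l₂ := tendsto_integral_vertical hpi.le (limTop hE.e₂ e₂)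
    ((eventually_gt_atTop 0).mono m₂) ((eventually_gt_atTop 0).mono fun ρ hρ =>
      h₂.continuousOn_vertical (by rw [brU_re]; exact hρ.ne') (m₂ ρ hρ))
  have l₃ := tendsto_integral_vertical hpi.le (limBot hE.e₃ e₃)
    ((eventually_lt_atBot 0).mono m₃) ((eventually_lt_atBot 0).mono fun ρ hρ =>
      h₃.continuousOn_vertical (by rw [brU_re]; exact hρ.ne) (m₃ ρ hρ))
  have l₄ := tendsto_integral_vertical (by linarith) (limBot hE.e₄ e₄)
    ((eventually_lt_atBot 0).mono m₄) ((eventually_lt_atBot 0).mono fun ρ hρ =>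
      h₄.continuousOn_vertical (by rw [brL_re]; exact hρ.ne) (m₄ ρ hρ))
  have main := hasSigmaIntegral_of_logGood hq₀ (f := f)
    (hfc.comp Complex.continuous_ofReal.continuousOn fun x hx =>
      ofReal_mem_Sigma0 (ne_of_gt hx))
    (hfc.comp Complex.continuous_ofReal.continuousOn fun x hx =>
      ofReal_mem_Sigma0 (ne_of_lt hx)) h₁ h₂ h₃ h₄ ?_ ?_ ?_ ?_ ?_ ?_ l₁ l₂ l₃ l₄
  · convert main using 1
    push_cast
    ring
  · intro σ hσ
    rw [hf, e₁ _ (mem_strip₁.2 (by simp [hσ, hpi.le])) (nim (by simp)),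
      e₂ _ (mem_strip₂.2 (by simp [hσ, hpi.le])) (nim (by simp)), hJ.out_right σ hσ]
    ring
  · intro σ hσ
    rw [hf, e₁ _ (mem_strip₁.2 (by simp [hσ, hpi.le])) (npi (by simp [abs_of_pos hpi])),
      e₂ _ (mem_strip₂.2 (by simp [hσ, hpi.le])) (npi (by simp [abs_of_pos hpi])),
      hJ.out_left σ hσ, eL]
    ring
  · intro σ hσ
    rw [hf, e₃ _ (mem_strip₃.2 (by simp [hσ, hpi.le])) (nim (by simp)),
      e₄ _ (mem_strip₄.2 (by simp [hσ, hpi.le])) (nim (by simp)), hJ.in_right σ hσ]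
    ring
  · intro σ hσ
    rw [hf, e₃ _ (mem_strip₃.2 (by simp [hσ, hpi.le])) (npi (by simp [abs_of_pos hpi])),
      e₄ _ (mem_strip₄.2 (by simp [hσ, hpi.le])) (npi (by simp [abs_of_pos hpi])),
      hJ.in_left σ hσ, eL]
    ring
  · intro τ h1 h2 h3
    rw [hf, e₁ _ (mem_strip₁.2 (by simp [h1, h2])) (nre (by simp)),
      e₄ _ (mem_strip₄.2 (by simp [h1, h2])) (nre (by simp)), hJ.lower τ h1 h2 h3]
    ring
  · intro τ h1 h2 h3
    rw [hf, e₂ _ (mem_strip₂.2 (by simp [h1, h2])) (nre (by simp)),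
      e₃ _ (mem_strip₃.2 (by simp [h1, h2])) (nre (by simp)), hJ.upper τ h1 h2 h3]
    ring

/-- The left ends of the inner strips are reflections of the right end of `strip₁`, where `F → 0`;
only the additive constant `iα` remains. -/
theorem hasEnds_phi {F : ℂ → ℂ} (hF : Tendsto F rightEnd (𝓝 0)) (α : ℝ) :
    HasEnds F (phi₂ F) (phi₃ F α) (phi₄ F α) 0 (α * Complex.I) := by
  have mem : ∀ {l : Filter ℝ} {S : Set ℂ}, ∀ᶠ s in comap Complex.re l ⊓ 𝓟 S, s ∈ S :=
    mem_inf_of_right (mem_principal_self _)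
  have key : ∀ {l : Filter ℝ} {S : Set ℂ} {φ : ℂ → ℂ},
      Tendsto (fun s => (φ s).re) (comap Complex.re l ⊓ 𝓟 S) atTop → MapsTo φ S strip₁ →
      Tendsto (fun s => F (φ s)) (comap Complex.re l ⊓ 𝓟 S) (𝓝 0) := fun h1 h2 =>
    hF.comp (tendsto_inf.2 ⟨tendsto_comap_iff.2 h1, tendsto_principal.2 (mem.mono h2)⟩)
  have reT : ∀ {S : Set ℂ}, Tendsto Complex.re (comap Complex.re atTop ⊓ 𝓟 S) atTop :=
    @fun _ => tendsto_comap.mono_left inf_le_left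
  have reB : ∀ {S : Set ℂ}, Tendsto (fun s => -s.re) (comap Complex.re atBot ⊓ 𝓟 S) atTop :=
    @fun _ => tendsto_neg_atBot_atTop.comp (tendsto_comap.mono_left inf_le_left)
  refine ⟨hF, ?_, ?_, ?_⟩
  · have h := (Complex.continuous_conj.tendsto 0).comp
      (key (φ := conj) (S := strip₂) (l := atTop) (by simpa using reT) mapsTo_conj_strip₂)
    change Tendsto (fun s => -conj (F (conj s))) _ _
    simpa [Function.comp_def] using h.neg
  · have h := (Complex.continuous_conj.tendsto 0).comp
      (key (φ := fun s => -conj s - Real.pi * Complex.I) (S := strip₃) (l := atBot)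
        (by simpa using reB) fun s hs => by
          rw [mem_strip₃] at hs
          rw [mem_strip₁]
          simp
          exact ⟨by linarith, by linarith, by linarith⟩)
    change Tendsto (fun s => conj (F (-conj s - Real.pi * Complex.I)) + α * Complex.I) _ _
    simpa [Function.comp_def] using h.add_const (α * Complex.I)
  · have h := key (φ := fun s => -s - Real.pi * Complex.I) (S := strip₄) (l := atBot)
        (by simpa using reB) fun s hs => by
          rw [mem_strip₄] at hs
          rw [mem_strip₁]
          simp
          exact ⟨by linarith, by linarith, by linarith⟩
    change Tendsto (fun s => -F (-s - Real.pi * Complex.I) + α * Complex.I) _ _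
    simpa using h.neg.add_const (α * Complex.I)

section

variable {q₀ : ℝ} {qm qp : ℂ} {q : ℝ → ℝ → ℂ} {t : ℝ} {N : ℕ} {z : Fin N → ℂ} {F : ℂ → ℂ} {α : ℝ}
  (H : IsPotential q₀ qm qp q t) (hF : IsScatLog q₀ qm qp q t z F α) (hz0 : ∀ n, z n ≠ 0)
  (hs11 : ∀ ζ ∈ Sigma0 q₀, s11 q₀ qm qp q t ζ ≠ 0) {L : ℂ → ℂ} (hL : IsLogBranch q₀ qm qp q t L)
include H hF hz0 hs11 hL

/-- The Cauchy kernel tends to `0` at `ζ = 0` and to `1` at infinity, while `Φ → 0` at infinity, so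
only the subtracted constant contributes and the integral is `2πi c`. -/
theorem IsScatLog.hasSigmaIntegral_cauchy {s₀ c : ℂ} (h0re : s₀.re ≠ 0) (h0im : s₀.im ≠ 0)
    (h0pi : |s₀.im| < Real.pi) (c₁ : s₀ ∉ strip₁ ∨ s₀ ∈ ostrip₁ ∧ c = F s₀)
    (c₂ : s₀ ∉ strip₂ ∨ s₀ ∈ ostrip₂ ∧ c = phi₂ F s₀)
    (c₃ : s₀ ∉ strip₃ ∨ s₀ ∈ ostrip₃ ∧ c = phi₃ F α s₀)
    (c₄ : s₀ ∉ strip₄ ∨ s₀ ∈ ostrip₄ ∧ c = phi₄ F α s₀) :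
    HasSigmaIntegral q₀ (fun ζ => L ζ / (ζ - expc q₀ s₀)) (2 * Real.pi * Complex.I * c) := by
  have hpi := Real.pi_pos
  have hq₀ := H.pos
  obtain ⟨g₁, h₁, e₁⟩ := hF.good.exists_cauchy hq₀ isOpen_ostrip₁ ostrip₁_subset brL_mem_strip₁
    brL_notMem_ostrip₁ (fun s hs => abs_le.2 ⟨hs.2.1, hs.2.2.trans hpi.le⟩) h0pi c₁
  obtain ⟨g₂, h₂, e₂⟩ := (logGood_phi₂ hF.good).exists_cauchy hq₀ isOpen_ostrip₂
    (fun s hs => mem_strip₂.2 ⟨hs.1.le, hs.2.1.le, hs.2.2.le⟩)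
    (mem_strip₂.2 (by rw [brU_re, brU_im]; exact ⟨le_rfl, by linarith, by linarith⟩))
    (fun h => lt_irrefl 0 (by simpa [brU_re] using h.1))
    (fun s hs => abs_le.2 ⟨(neg_nonpos.2 hpi.le).trans hs.2.1, hs.2.2⟩) h0pi c₂
  obtain ⟨g₃, h₃, e₃⟩ := (logGood_phi₃ hF.good α).exists_cauchy hq₀ isOpen_ostrip₃
    (fun s hs => mem_strip₃.2 ⟨hs.1.le, hs.2.1.le, hs.2.2.le⟩)
    (mem_strip₃.2 (by rw [brU_re, brU_im]; exact ⟨le_rfl, by linarith, by linarith⟩))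
    (fun h => lt_irrefl 0 (by simpa [brU_re] using h.1))
    (fun s hs => abs_le.2 ⟨(neg_nonpos.2 hpi.le).trans hs.2.1, hs.2.2⟩) h0pi c₃
  obtain ⟨g₄, h₄, e₄⟩ := (logGood_phi₄ hF.good α).exists_cauchy hq₀ isOpen_ostrip₄
    (fun s hs => mem_strip₄.2 ⟨hs.1.le, hs.2.1.le, hs.2.2.le⟩)
    (mem_strip₄.2 (by rw [brL_re, brL_im]; exact ⟨le_rfl, by linarith, by linarith⟩))
    (fun h => lt_irrefl 0 (by simpa [brL_re] using h.1))
    (fun s hs => abs_le.2 ⟨hs.2.1, hs.2.2.trans hpi.le⟩) h0pi c₄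
  have hw := expc_ne_zero hq₀ s₀
  have hsig : ∀ ζ ∈ Sigma0 q₀, ζ - expc q₀ s₀ ≠ 0 := by
    intro ζ hζ h
    have hζ := hζ.1
    rw [sub_eq_zero.1 h, im_expc, norm_expc hq₀] at hζ
    rcases hζ with h | h
    · have h1 := (mul_eq_zero.1 h).resolve_left (by positivity)
      rw [Real.sin_eq_zero_iff_of_lt_of_lt (abs_lt.1 h0pi).1 (abs_lt.1 h0pi).2] at h1
      exact h0im h1
    · exact h0re (Real.exp_eq_one_iff _ |>.1 (mul_left_cancel₀ hq₀.ne' (h.trans (mul_one q₀).symm)))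
  have hk₀ : Tendsto (cauchyK (expc q₀ s₀)) (𝓝 0) (𝓝 0) := by
    have : ContinuousAt (cauchyK (expc q₀ s₀)) 0 :=
      continuousAt_id.div (continuousAt_id.sub continuousAt_const) (by simpa using hw)
    simpa [ContinuousAt, cauchyK] using this
  have hk₁ : Tendsto (cauchyK (expc q₀ s₀)) (Bornology.cobounded ℂ) (𝓝 1) := by
    refine (tendsto_div_sub_cobounded 0 (expc q₀ s₀)).congr fun ζ => ?_
    rw [cauchyK, sub_zero]
  have := hasSigmaIntegral_of_isJump hq₀ (f := fun ζ => L ζ / (ζ - expc q₀ s₀))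
    (hF.isJump H hz0 hs11 hL) (hasEnds_phi hF.lim α)
    (hL.cont.div (by fun_prop) hsig) (fun s => by
      simp only [logInt, cauchyK, expc]
      ring) h0re h0im h0pi h₁ h₂ h₃ h₄ e₁ e₂ e₃ e₄ hk₀ hk₁
  simpa using this

theorem IsScatLog.hasSigmaIntegral_zero :
    HasSigmaIntegral q₀ (fun ζ => L ζ / ζ) ((-(2 * Real.pi * α) : ℝ) : ℂ) := by
  have hq₀ := H.pos
  -- The kernel `1` has no pole, so nothing is subtracted and `1 + I` is an arbitrary point meeting
  -- the position conditions. The end `ζ → 0` contributes `2πi · iα`.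
  have := hasSigmaIntegral_of_isJump hq₀ (f := fun ζ => L ζ / ζ) (k := fun _ => 1) (s₀ := 1 + Complex.I)
    (c := 0) (hF.isJump H hz0 hs11 hL) (hasEnds_phi hF.lim α)
    (hL.cont.div (by fun_prop) fun ζ hζ => hζ.2.1) (fun s => by
      have := expc_ne_zero hq₀ s
      exact (div_mul_cancel₀ _ this).trans (mul_one _).symm) (by simp) (by simp) (by
        simp only [Complex.add_im, Complex.one_im, Complex.I_im, zero_add, abs_one]
        linarith [Real.pi_gt_three]) hF.good
    (logGood_phi₂ hF.good) (logGood_phi₃ hF.good α) (logGood_phi₄ hF.good α)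
    (fun s _ _ => by ring) (fun s _ _ => by ring) (fun s _ _ => by ring) (fun s _ _ => by ring)
    tendsto_const_nhds tendsto_const_nhds
  convert this using 1
  push_cast
  linear_combination (-2 * Real.pi * α : ℂ) * Complex.I_mul_I

end

end KunduEckhaus

end

noncomputable section

namespace KunduEckhaus

open Set

/-! ### Trace formulae and theta condition -/

theorem exists_expc_eq {q₀ : ℝ} (hq₀ : 0 < q₀) {w : ℂ} (him : w.im ≠ 0) :
    ∃ s, expc q₀ s = w ∧ |s.im| < Real.pi ∧ (0 < s.im ↔ 0 < w.im) ∧ (s.im < 0 ↔ w.im < 0) ∧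
      (0 < s.re ↔ q₀ < ‖w‖) ∧ (s.re < 0 ↔ ‖w‖ < q₀) := by
  have hw : w ≠ 0 := fun h => him (by rw [h, Complex.zero_im])
  have hn : 0 < ‖w‖ := norm_pos_iff.2 hw
  have him' : (w / q₀).im ≠ 0 := by
    rw [Complex.div_ofReal_im]
    exact div_ne_zero him hq₀.ne'
  have harg : Complex.arg (w / q₀) ≠ 0 := fun h => him' (Complex.arg_eq_zero_iff.1 h).2
  have hlt : Complex.arg (w / q₀) < Real.pi := Complex.arg_lt_pi_iff.2 (Or.inr him')
  have hneg : Complex.arg (w / q₀) < 0 ↔ w.im < 0 := by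
    rw [Complex.arg_neg_iff, Complex.div_ofReal_im, div_lt_iff₀ hq₀, zero_mul]
  refine ⟨Complex.log (w / q₀), expc_log hq₀ hw, ?_, ?_, ?_, ?_, ?_⟩
  · rw [Complex.log_im, abs_lt]
    exact ⟨Complex.neg_pi_lt_arg _, hlt⟩
  · rw [Complex.log_im]
    constructor <;> intro h <;> by_contra! h'
    · exact absurd (hneg.2 (h'.lt_of_ne him)) h.not_gt
    · exact absurd (hneg.1 (h'.lt_of_ne harg)) h.not_gt
  · rw [Complex.log_im, hneg]
  · rw [Complex.log_re, norm_div, Complex.norm_real, Real.norm_of_nonneg hq₀.le,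
      Real.log_pos_iff (by positivity), one_lt_div hq₀]
  · rw [Complex.log_re, norm_div, Complex.norm_real, Real.norm_of_nonneg hq₀.le,
      Real.log_neg_iff (by positivity), div_lt_one hq₀]

theorem exists_expc_of_mem_Dminus {q₀ : ℝ} (hq₀ : 0 < q₀) {w : ℂ} (hw : w ∈ Dminus q₀) :
    ∃ s, expc q₀ s = w ∧ (s ∈ ostrip₁ ∨ s ∈ ostrip₃) := by
  have hw : (‖w‖ ^ 2 - q₀ ^ 2) * w.im < 0 := hw
  obtain ⟨s, hs, h1, h2, h3, h4, h5⟩ := exists_expc_eq hq₀ (w := w) fun h => by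
    rw [h, mul_zero] at hw
    exact lt_irrefl _ hw
  refine ⟨s, hs, ?_⟩
  rw [abs_lt] at h1
  have hn := norm_nonneg w
  rcases mul_neg_iff.1 hw with ⟨ha, hb⟩ | ⟨ha, hb⟩
  · exact Or.inl ⟨h4.2 (by nlinarith), h1.1, h3.2 hb⟩
  · exact Or.inr ⟨h5.2 (by nlinarith), h2.2 hb, h1.2⟩

theorem exists_expc_of_mem_Dplus {q₀ : ℝ} (hq₀ : 0 < q₀) {w : ℂ} (hw : w ∈ Dplus q₀) :
    ∃ s, expc q₀ s = w ∧ (s ∈ ostrip₂ ∨ s ∈ ostrip₄) := by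
  obtain ⟨s, hs, h⟩ := exists_expc_of_mem_Dminus hq₀ (conj_mem_Dminus.2 hw)
  refine ⟨conj s, by rw [← conj_expc, hs, Complex.conj_conj], h.imp (fun h => ?_) fun h => ?_⟩
  · rw [mem_ostrip₁] at h
    rw [mem_ostrip₂, Complex.conj_re, Complex.conj_im]
    exact ⟨h.1, by linarith, by linarith⟩
  · rw [mem_ostrip₃] at h
    rw [mem_ostrip₄, Complex.conj_re, Complex.conj_im]
    exact ⟨h.1, by linarith, by linarith⟩

theorem div_conj_sq {z : ℂ} (hz : z ≠ 0) :
    (z / conj z) ^ 2 = Complex.exp ((4 * Complex.arg z : ℝ) * Complex.I) := by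
  have hn : (‖z‖ : ℂ) ≠ 0 := by simpa using hz
  have h1 : conj z = ‖z‖ * Complex.exp (-(Complex.arg z * Complex.I)) := by
    conv_lhs => rw [← Complex.norm_mul_exp_arg_mul_I z]
    rw [map_mul, Complex.conj_ofReal, ← Complex.exp_conj, map_mul, Complex.conj_ofReal,
      Complex.conj_I, mul_neg]
  have h2 : z / conj z = Complex.exp (2 * (Complex.arg z * Complex.I)) := by
    rw [h1, div_eq_iff (mul_ne_zero hn (Complex.exp_ne_zero _)), mul_left_comm, ← Complex.exp_add]
    conv_lhs => rw [← Complex.norm_mul_exp_arg_mul_I z]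
    congr 2
    ring
  rw [h2, ← Complex.exp_nat_mul]
  congr 1
  push_cast
  ring

section

variable {q₀ : ℝ} {qm qp : ℂ} {q : ℝ → ℝ → ℂ} {t : ℝ} {N : ℕ} {z : Fin N → ℂ} {F : ℂ → ℂ} {α : ℝ}

theorem IsScatLog.arg_eq (hF : IsScatLog q₀ qm qp q t z F α) (hz0 : ∀ n, z n ≠ 0) :
    ((Complex.arg (qm / qp) : ℝ) : Real.Angle) = ((α + 4 * ∑ n, Complex.arg (z n) : ℝ) : Real.Angle) := by
  have h : qm / qp = Complex.exp ((α + 4 * ∑ n, Complex.arg (z n) : ℝ) * Complex.I) := by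
    rw [← hF.theta, Finset.prod_congr rfl fun n _ => div_conj_sq (hz0 n), ← Complex.exp_sum,
      ← Complex.exp_add]
    congr 1
    push_cast
    rw [Finset.mul_sum, add_mul, Finset.sum_mul]
  rw [h, Complex.exp_mul_I, ← Complex.ofReal_cos, ← Complex.ofReal_sin]
  exact Complex.arg_cos_add_sin_mul_I_coe_angle ((α + 4 * ∑ n, Complex.arg (z n) : ℝ) : Real.Angle)

variable (H : IsPotential q₀ qm qp q t) (hF : IsScatLog q₀ qm qp q t z F α) (hz0 : ∀ n, z n ≠ 0)
  (hs11 : ∀ ζ ∈ Sigma0 q₀, s11 q₀ qm qp q t ζ ≠ 0) {L : ℂ → ℂ} (hL : IsLogBranch q₀ qm qp q t L)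
include H hF hz0 hs11 hL

theorem IsScatLog.trace_s11 {w : ℂ} (hw : w ∈ Dminus q₀) :
    ∃ J : ℂ, HasSigmaIntegral q₀ (fun ζ => L ζ / (ζ - w)) J ∧ s11 q₀ qm qp q t w =
      Complex.exp (1 / (2 * (Real.pi : ℂ) * Complex.I) * J) * blaschke q₀ z w := by
  have hpi : (2 * (Real.pi : ℂ) * Complex.I) ≠ 0 := Complex.two_pi_I_ne_zero
  have hpi' := Real.pi_pos
  obtain ⟨s, rfl, hs | hs⟩ := exists_expc_of_mem_Dminus H.pos hw
  · refine ⟨_, hF.hasSigmaIntegral_cauchy H hz0 hs11 hL (c := F s) hs.1.ne' hs.2.2.ne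
      (abs_lt.2 ⟨hs.2.1, hs.2.2.trans hpi'⟩) (Or.inr ⟨hs, rfl⟩)
      (Or.inl fun h => hs.2.2.not_ge h.2.1) (Or.inl fun h => hs.2.2.not_ge h.2.1)
      (Or.inl fun h => (show (0 : ℝ) < s.re from hs.1).not_ge h.1), ?_⟩
    rw [one_div, inv_mul_cancel_left₀ hpi, hF.eq s (ostrip₁_subset' hs)]
  · refine ⟨_, hF.hasSigmaIntegral_cauchy H hz0 hs11 hL (c := phi₃ F α s) hs.1.ne hs.2.1.ne'
      (abs_lt.2 ⟨(neg_neg_of_pos hpi').trans hs.2.1, hs.2.2⟩) (Or.inl fun h => hs.2.1.not_ge h.2.2)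
      (Or.inl fun h => (show s.re < 0 from hs.1).not_ge h.1)
      (Or.inr ⟨hs, rfl⟩) (Or.inl fun h => hs.2.1.not_ge h.2.2), ?_⟩
    rw [one_div, inv_mul_cancel_left₀ hpi, hF.eq₃ H hz0 ⟨mem_strip₃.2 ⟨hs.1.le, hs.2.1.le, hs.2.2.le⟩,
      fun h => ?_⟩]
    have := hs.1
    simp [mem_singleton_iff.1 h, brU_re] at this

theorem IsScatLog.trace_s22 {w : ℂ} (hw : w ∈ Dplus q₀) :
    ∃ J : ℂ, HasSigmaIntegral q₀ (fun ζ => L ζ / (ζ - w)) J ∧ s22 q₀ qm qp q t w =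
      Complex.exp (-(1 / (2 * (Real.pi : ℂ) * Complex.I)) * J) * (blaschke q₀ z w)⁻¹ := by
  have hpi : (2 * (Real.pi : ℂ) * Complex.I) ≠ 0 := Complex.two_pi_I_ne_zero
  have hpi' := Real.pi_pos
  have h22 := H.s22_conj (subset_union_left (conj_mem_Dminus.2 hw))
  rw [Complex.conj_conj] at h22
  obtain ⟨s, rfl, hs | hs⟩ := exists_expc_of_mem_Dplus H.pos hw
  · refine ⟨_, hF.hasSigmaIntegral_cauchy H hz0 hs11 hL (c := phi₂ F s) hs.1.ne' hs.2.1.ne'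
      (abs_lt.2 ⟨(neg_neg_of_pos hpi').trans hs.2.1, hs.2.2⟩) (Or.inl fun h => hs.2.1.not_ge h.2.2)
      (Or.inr ⟨hs, rfl⟩) (Or.inl fun h => (show (0 : ℝ) < s.re from hs.1).not_ge h.1)
      (Or.inl fun h => hs.2.1.not_ge h.2.2), ?_⟩
    rw [h22, neg_mul, one_div, inv_mul_cancel_left₀ hpi,
      hF.eq₂ ⟨mem_strip₂.2 ⟨hs.1.le, hs.2.1.le, hs.2.2.le⟩, fun h => ?_⟩]
    have := hs.1
    simp [mem_singleton_iff.1 h, brU_re] at this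
  · refine ⟨_, hF.hasSigmaIntegral_cauchy H hz0 hs11 hL (c := phi₄ F α s) hs.1.ne hs.2.2.ne
      (abs_lt.2 ⟨hs.2.1, hs.2.2.trans hpi'⟩) (Or.inl fun h => (show s.re < 0 from hs.1).not_ge h.1)
      (Or.inl fun h => hs.2.2.not_ge h.2.1) (Or.inl fun h => hs.2.2.not_ge h.2.1)
      (Or.inr ⟨hs, rfl⟩), ?_⟩
    rw [h22, neg_mul, one_div, inv_mul_cancel_left₀ hpi,
      hF.eq₄ H hz0 ⟨mem_strip₄.2 ⟨hs.1.le, hs.2.1.le, hs.2.2.le⟩, fun h => ?_⟩]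
    have := hs.1
    simp [mem_singleton_iff.1 h, brL_re] at this

theorem IsScatLog.theta_condition : ∃ J : ℝ, HasSigmaIntegral q₀ (fun ζ => L ζ / ζ) (J : ℂ) ∧
    ((Complex.arg (qm / qp) : ℝ) : Real.Angle) =
      ((-(1 / (2 * Real.pi)) * J + 4 * ∑ n, Complex.arg (z n) : ℝ) : Real.Angle) := by
  have hpi := Real.pi_pos
  refine ⟨_, hF.hasSigmaIntegral_zero H hz0 hs11 hL, ?_⟩
  rw [hF.arg_eq hz0]
  congr 2
  field_simp

end

theorem HasSigmaIntegral.unique {q₀ : ℝ} {f : ℂ → ℂ} {v v' : ℂ} (h : HasSigmaIntegral q₀ f v)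
    (h' : HasSigmaIntegral q₀ f v') : v = v' :=
  tendsto_nhds_unique h.lim h'.lim

theorem hasSigmaIntegral_zero_fun (q₀ : ℝ) : HasSigmaIntegral q₀ (fun _ => 0) 0 :=
  ⟨fun _ _ _ _ => intervalIntegrable_const, fun _ _ _ _ => intervalIntegrable_const,
    intervalIntegrable_const, by simp [sigmaTrunc]⟩

theorem isLogBranch_zero {q₀ : ℝ} {qm qp : ℂ} {q : ℝ → ℝ → ℂ} {t : ℝ}
    (h : ∀ ζ ∈ Sigma0 q₀, rho q₀ qm qp q t ζ = 0) : IsLogBranch q₀ qm qp q t fun _ => 0 :=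
  ⟨continuousOn_const, fun ζ hζ => by simp [h ζ hζ], fun _ _ => rfl⟩

end KunduEckhaus

end

/-! ### Assembly of the theorem -/

theorem mainTheorem7
    (q₀ : ℝ) (hq₀ : 0 < q₀) (qm qp : ℂ) (hqm : ‖qm‖ = q₀) (hqp : ‖qp‖ = q₀)
    (q : ℝ → ℝ → ℂ) (t : ℝ)
    (hq : Continuous fun x : ℝ => q x t)
    (hqL1p : IntegrableOn (fun x : ℝ => q x t - qp) (Set.Ici 0))
    (hqL1m : IntegrableOn (fun x : ℝ => q x t - qm) (Set.Iic 0))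
    (N : ℕ) (z : Fin N → ℂ) (hz_inj : Function.Injective z)
    -- `z₁, …, z_N` are the zeros of `s₁₁` in the lower half of `D⁻`, and they are simple
    (hz_zeros : ∀ w : ℂ, (w ∈ Dminus q₀ ∧ w.im < 0 ∧ s11 q₀ qm qp q t w = 0) ↔ ∃ n, z n = w)
    (hz_simple : ∀ n, deriv (s11 q₀ qm qp q t) (z n) ≠ 0)
    -- `s₁₁` has no zeros on the continuous spectrum
    (hs11 : ∀ ζ ∈ Sigma0 q₀, s11 q₀ qm qp q t ζ ≠ 0)
    -- `s₁₁` behaves like a nonzero multiple of an integral power at the two branch points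
    (hbranch : ∀ p : ℂ, (p = Complex.I * (q₀ : ℂ) ∨ p = -(Complex.I * (q₀ : ℂ))) →
      ∃ (m : ℤ) (c : ℂ), c ≠ 0 ∧
        Tendsto (fun w => (w - p) ^ m * s11 q₀ qm qp q t w) (𝓝[Dminus q₀] p) (𝓝 c)) :
    -- the logarithm of `1 + ρρ^*` exists
    (∃ L : ℂ → ℂ, IsLogBranch q₀ qm qp q t L) ∧
    (∀ L : ℂ → ℂ, IsLogBranch q₀ qm qp q t L →
      -- trace formula for `s₁₁`
      (∀ w ∈ Dminus q₀, ∃ J : ℂ, HasSigmaIntegral q₀ (fun ζ => L ζ / (ζ - w)) J ∧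
        s11 q₀ qm qp q t w =
          Complex.exp (1 / (2 * (Real.pi : ℂ) * Complex.I) * J) * blaschke q₀ z w) ∧
      -- trace formula for `s₂₂`
      (∀ w ∈ Dplus q₀, ∃ J : ℂ, HasSigmaIntegral q₀ (fun ζ => L ζ / (ζ - w)) J ∧
        s22 q₀ qm qp q t w =
          Complex.exp (-(1 / (2 * (Real.pi : ℂ) * Complex.I)) * J) * (blaschke q₀ z w)⁻¹) ∧
      -- theta condition, modulo `2π`
      (∃ J : ℝ, HasSigmaIntegral q₀ (fun ζ => L ζ / ζ) (J : ℂ) ∧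
        ((Complex.arg (qm / qp) : ℝ) : Real.Angle) =
          ((-(1 / (2 * Real.pi)) * J + 4 * ∑ n, Complex.arg (z n) : ℝ) : Real.Angle))) ∧
    -- theta condition in the reflectionless case
    ((∀ ζ ∈ Sigma0 q₀, rho q₀ qm qp q t ζ = 0) →
      ((Complex.arg (qm / qp) : ℝ) : Real.Angle) =
        ((4 * ∑ n, Complex.arg (z n) : ℝ) : Real.Angle)) := by
  have H : IsPotential q₀ qm qp q t := ⟨hq₀, hqm, hqp, hq, hqL1p, hqL1m⟩
  obtain ⟨m, c, hc, hbr⟩ := hbranch _ (Or.inr rfl)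
  have hz0 : ∀ n, z n ≠ 0 := fun n h => by
    have := ((hz_zeros (z n)).2 ⟨n, rfl⟩).2.1
    simp [h] at this
  obtain ⟨F, hF, he, hlim⟩ := H.exists_logGood_s11 hz_inj hz_zeros hz_simple hs11 hc hbr
  obtain ⟨α, hα⟩ := H.exists_isScatLog hz0 hs11 hF he hlim
  refine ⟨H.exists_isLogBranch hs11, fun L hL => ⟨fun w hw => hα.trace_s11 H hz0 hs11 hL hw,
    fun w hw => hα.trace_s22 H hz0 hs11 hL hw, hα.theta_condition H hz0 hs11 hL⟩, fun hρ => ?_⟩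
  -- When `ρ = 0` the zero function is an admissible branch, so its theta integral is `0` by
  -- uniqueness of the limit.
  obtain ⟨J, hJ, hθ⟩ := hα.theta_condition H hz0 hs11 (isLogBranch_zero hρ)
  simp only [zero_div] at hJ
  have hJ0 : J = 0 := by exact_mod_cast hJ.unique (hasSigmaIntegral_zero_fun q₀)
  rw [hθ, hJ0, mul_zero, zero_add]
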